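/- Let $S^1=\mathbb R/2\pi\mathbb Z$. For $c>0$ let $M_c=[0,c]\times S^1\times S^1$ with coordinates $(t,x,y)$, oriented by $dt\wedge dx\wedge dy$, and let $\xi_c=\ker(\cos(\pi t)\,dy+\sin(\pi t)\,dx)$. For $a>0$, with $p=r^2/2$ and $q=\theta$ on $\mathbb R^2$, let $T_a=S^1\times\{p\le a\}$ with $\alpha$ the $S^1$-coordinate, oriented by $d\alpha\wedge dp\wedge dq$, and let $\eta_a=\ker(\cos(\pi p)\,d\alpha+\sin(\pi p)\,dq)$; orient $\eta_a$ as cooriented by this form. These are positive contact structures. A cobordism-with-sides from $M_c$ to $T_a\amalg T_a$ is a compact connected oriented smooth 4-manifold $X$ with corners whose boundary is the union of a bottom $-M_c$, a top $T_a\amalg T_a$ and sides $[0,1]\times\partial M_c$, where the sides meet the bottom in $\{0\}\times\partial M_c=\partial M_c$ and the top in $\{1\}\times\partial M_c=\partial(T_a\amalg T_a)$, and the only corners are along these tori. **Theorem.** For every integer $k>1$ there is a smooth cobordism-with-sides $X_k$ from $M_{k+1/2}$ to $T_{1/2}\amalg T_{1/2}$, with a symplectic form $\omega_k$ such that $\omega_k\wedge\omega_k$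 gives its orientation, containing smoothly embedded 2-spheres $S_1,\dots,S_{2k-2}$ in its interior, such that: 1. Each $S_i$ is symplectic, and all intersections between distinct $S_i$'s are transverse and positive, for the orientations given by $\omega_k$. 2. $S_i\cdot S_j=0$ (in particular $S_i\cdot S_i=0$) unless $j-i=\pm1$, and $S_i\cdot S_{i+1}=+1$. 3. There is a nowhere-zero Liouville vector field $V$ for $\omega_k$, defined in a neighborhood of the bottom and the sides, pointing into $X_k$ along the bottom and tangent to the sides, which induces $\xi_{k+1/2}$ on the bottom, i.e. $\xi_{k+1/2}=\ker(\imath_V\omega_k|_{M_{k+1/2}})$. 4. Along the top, the contact structure $\eta_{1/2}$ on each copy of $T_{1/2}$ is dominated by $\omega_k$, i.e. $\omega_k|_{\eta_{1/2}}>0$, and it agrees with $\ker(\imath_V\omega_k|_{T_{1/2}})$ on a neighborhood of $\partial T_{1/2}$. -/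

import Mathlib

open Set Topology
open scoped Manifold ContDiff

noncomputable section

namespace GayCobordism

/-! ### Differential forms and vector fields on a smooth 4-manifold without boundary -/

/-- The model space `ℝ⁴`. -/
abbrev E4 : Type := EuclideanSpace ℝ (Fin 4)

/-- The unit sphere `S²` in `ℝ³`. -/
abbrev S2 : Type := Metric.sphere (0 : EuclideanSpace ℝ (Fin 3)) 1

section Forms

variable {Y : Type} [TopologicalSpace Y] [ChartedSpace E4 Y]

/-- A (not necessarily smooth) differential 2-form. -/
abbrev TwoForm (Y : Type) [TopologicalSpace Y] [ChartedSpace E4 Y] : Type :=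
  ∀ y : Y, TangentSpace (𝓡 4) y [⋀^Fin 2]→L[ℝ] ℝ

/-- The expression of a 2-form in a chart `e`: its pullback under `e.symm`
(meaningful on `e.target`). -/
def formInChart (Ω : TwoForm Y) (e : OpenPartialHomeomorph Y E4) (x : E4) :
    E4 [⋀^Fin 2]→L[ℝ] ℝ :=
  (Ω (e.symm x)).compContinuousLinearMap (mfderiv (𝓡 4) (𝓡 4) e.symm x)

/-- The expression of a vector field in a chart `e`: its pushforward under `e`
(meaningful on `e.target`). -/
def fieldInChart (V : ∀ y : Y, TangentSpace (𝓡 4) y) (e : OpenPartialHomeomorph Y E4)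
    (x : E4) : E4 :=
  mfderiv (𝓡 4) (𝓡 4) e (e.symm x) (V (e.symm x))

/-- A symplectic form: a smooth, closed, nondegenerate 2-form. -/
structure IsSymplectic (Ω : TwoForm Y) : Prop where
  smooth : ∀ e ∈ atlas E4 Y, ContDiffOn ℝ ∞ (formInChart Ω e) e.target
  closed : ∀ e ∈ atlas E4 Y, ∀ x ∈ e.target, extDeriv (formInChart Ω e) x = 0
  nondegenerate : ∀ (y : Y) (v : TangentSpace (𝓡 4) y), v ≠ 0 → ∃ w, Ω y ![v, w] ≠ 0

/-- `V` is a smooth vector field on the open set `U` which is Liouville for `Ω`, that is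
`d (ι_V Ω) = Ω` on `U` (for closed `Ω` this is `L_V Ω = Ω`). -/
structure IsLiouvilleOn (Ω : TwoForm Y) (V : ∀ y : Y, TangentSpace (𝓡 4) y) (U : Set Y) :
    Prop where
  isOpen : IsOpen U
  smooth : ∀ e ∈ atlas E4 Y, ContDiffOn ℝ ∞ (fieldInChart V e) (e.target ∩ e.symm ⁻¹' U)
  liouville : ∀ e ∈ atlas E4 Y, ∀ x ∈ e.target, e.symm x ∈ U →
    extDeriv (fun z => (formInChart Ω e z).curryLeft (fieldInChart V e z)) x =
      formInChart Ω e x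

/-- Half of `Ω ∧ Ω` evaluated on four tangent vectors at `y`. For symplectic `Ω` its sign is the
symplectic orientation. -/
def omegaSq (Ω : TwoForm Y) (y : Y) (a b c d : TangentSpace (𝓡 4) y) : ℝ :=
  Ω y ![a, b] * Ω y ![c, d] - Ω y ![a, c] * Ω y ![b, d] + Ω y ![a, d] * Ω y ![b, c]

end Forms

/-! ### The contact manifolds `(M_{a,b}, ξ_{a,b})` and `(T_a, η_a)`

The circle is `ℝ / 2πℤ`, realized as `Circle` through `Circle.exp`. Three-dimensional pieces are
described by their points together with a covering map from `ℝ³` giving angular coordinates.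
Tangent vectors, forms and smoothness are expressed in these coordinates. -/

/-- Angular coordinates `(t, x, y) ↦ (t, e^{ix}, e^{iy})` on `ℝ × S¹ × S¹`. -/
def torusCoord (z : ℝ × ℝ × ℝ) : ℝ × Circle × Circle :=
  (z.1, Circle.exp z.2.1, Circle.exp z.2.2)

/-- The thickened torus `M_{a,b} = [a,b] × S¹ × S¹`. -/
def thickTorus (a b : ℝ) : Set (ℝ × Circle × Circle) := {m | m.1 ∈ Icc a b}

/-- The contact form `cos (π t) dy + sin (π t) dx`, at the point `z = (t, x, y)` and evaluated on
the vector `v`. Its kernel is `ξ`. -/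
def xiForm (z v : ℝ × ℝ × ℝ) : ℝ :=
  Real.cos (Real.pi * z.1) * v.2.2 + Real.sin (Real.pi * z.1) * v.2.1

/-- Coordinates `(α, u, w) ↦ (e^{iα}, u, w)` on `S¹ × ℝ²`. -/
def solidCoord (z : ℝ × ℝ × ℝ) : Circle × ℝ × ℝ := (Circle.exp z.1, z.2)

/-- The toric coordinate `p = r² / 2` on `ℝ²`. -/
def toricP (m : ℝ × ℝ) : ℝ := (m.1 ^ 2 + m.2 ^ 2) / 2

/-- The solid torus `T_a = S¹ × {p ≤ a}`. -/
def solidTorus (a : ℝ) : Set (Circle × ℝ × ℝ) := {m | toricP m.2 ≤ a}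

/-- The boundary torus of `T_a`. -/
def solidTorusBoundary (a : ℝ) : Set (Circle × ℝ × ℝ) := {m | toricP m.2 = a}

/-- The contact form `cos (π p) dα + sin (π p) dq`, at the point `z = (α, u, w)` and evaluated on
the vector `v`. Its kernel is `η`. Since `u dw - w du = r² dq = 2 p dq`, the term `sin (π p) dq`
is `(π / 2) sinc (π p) (u dw - w du)`, which is smooth across the core `p = 0`. -/
def etaForm (z v : ℝ × ℝ × ℝ) : ℝ :=
  Real.cos (Real.pi * toricP z.2) * v.1 +
    Real.pi / 2 * Real.sinc (Real.pi * toricP z.2) * (z.2.1 * v.2.2 - z.2.2 * v.2.1)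

/-- The standard volume form of `ℝ³`: it is `dt ∧ dx ∧ dy` on `M_{a,b}` and
`dα ∧ du ∧ dw = dα ∧ dp ∧ dq` on `T_a`. These are the orientations for which `ξ` and `η` are
positive contact structures. -/
def vol3 (a b c : ℝ × ℝ × ℝ) : ℝ :=
  Matrix.det !![a.1, a.2.1, a.2.2; b.1, b.2.1, b.2.2; c.1, c.2.1, c.2.2]

/-! ### Cobordisms with sides -/

/-- The three kinds of boundary faces. -/
inductive Face
  | bottom
  | side
  | top

section Cobordism

variable {Y : Type} [TopologicalSpace Y] [ChartedSpace E4 Y]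

/-- The derivative at `z` of a map `g` out of a three-dimensional piece `Q`, in the coordinates
`κ : ℝ³ → Q`. -/
def coordDeriv {Q : Type} (κ : ℝ × ℝ × ℝ → Q) (g : Q → Y) (z : ℝ × ℝ × ℝ) :
    ℝ × ℝ × ℝ →L[ℝ] TangentSpace (𝓡 4) (g (κ z)) :=
  mfderiv 𝓘(ℝ, ℝ × ℝ × ℝ) (𝓡 4) (g ∘ κ) z

/-- `g` is a smooth embedding of the (compact) piece `D ⊆ Q` into `Y`, where `Q` has the
coordinates `κ`. Smoothness on `D` means, as usual, smoothness of an extension to an open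
neighbourhood. -/
structure IsSmoothEmbeddingOn {Q : Type} (κ : ℝ × ℝ × ℝ → Q) (D : Set Q) (g : Q → Y) :
    Prop where
  smooth : ∃ O : Set (ℝ × ℝ × ℝ), IsOpen O ∧ κ ⁻¹' D ⊆ O ∧
    ContMDiffOn 𝓘(ℝ, ℝ × ℝ × ℝ) (𝓡 4) ∞ (g ∘ κ) O
  injOn : InjOn g D
  immersion : ∀ z, κ z ∈ D → Function.Injective (coordDeriv κ g z)

/-- `f` is a triple of local boundary defining functions for the domain with corners `X` and its
faces `F` near the point `y`: near `y` the functions are smooth, `X` is where all three are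
nonnegative, each face is where moreover its function vanishes, the differentials at `y` of the
functions vanishing at `y` are linearly independent, and bottom and top do not meet. (A face that
does not pass through `y` has a function that is positive at `y`.) -/
structure IsAdapted (X : Set Y) (F : Face → Set Y) (f : Face → Y → ℝ) (y : Y) : Prop where
  smooth : ∀ i, ∀ᶠ z in 𝓝 y, ContMDiffAt (𝓡 4) 𝓘(ℝ, ℝ) ∞ (f i) z
  domain : ∀ᶠ z in 𝓝 y, (z ∈ X ↔ ∀ i, 0 ≤ f i z)
  face : ∀ᶠ z in 𝓝 y, ∀ i, (z ∈ F i ↔ z ∈ X ∧ f i z = 0)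
  independent : LinearIndependent ℝ
    (fun i : {i : Face // f i y = 0} => mvfderiv (𝓡 4) (f i.1) y)
  disjoint : ¬ (f Face.bottom y = 0 ∧ f Face.top y = 0)

/-- The faces determined by parametrizations of the bottom `M_c = [0,c] × S¹ × S¹`, of the two
sides `[0,1] × S¹ × S¹` and of the two solid tori `T_a` at the top. -/
def faces (c a : ℝ) (β : ℝ × Circle × Circle → Y) (σ : Fin 2 → ℝ × Circle × Circle → Y)
    (τ : Fin 2 → Circle × ℝ × ℝ → Y) : Face → Set Y
  | Face.bottom => β '' thickTorus 0 c
  | Face.side => ⋃ i, σ i '' thickTorus 0 1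
  | Face.top => ⋃ i, τ i '' solidTorus a

/-- A compact connected smooth cobordism-with-sides `X` from the thickened torus `M_c` to
`T_a ∐ T_a`, oriented by `Ω ∧ Ω`. It is a compact domain with corners in a 4-manifold `Y` without
boundary. Its boundary is the union of a bottom `M_c`, of sides `[0,1] × ∂M_c`, and of a top
`T_a ∐ T_a`. The sides meet the bottom in `{0} × ∂M_c = ∂M_c` and the top in
`{1} × ∂M_c = ∂(T_a ∐ T_a)`, and the only corners are there. The oriented boundary is
`-M_c` at the bottom and `T_a ∐ T_a` at the top. -/
structure CobordismWithSides (Ω : TwoForm Y) (c a : ℝ) where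
  /-- The underlying compact domain. -/
  X : Set Y
  /-- The parametrization of the bottom. -/
  β : ℝ × Circle × Circle → Y
  /-- The parametrizations of the two sides. -/
  σ : Fin 2 → ℝ × Circle × Circle → Y
  /-- The parametrizations of the two components of the top. -/
  τ : Fin 2 → Circle × ℝ × ℝ → Y
  compact : IsCompact X
  connected : IsConnected X
  face_subset : ∀ i, faces c a β σ τ i ⊆ X
  corners : ∀ y ∈ X, ∃ f, IsAdapted X (faces c a β σ τ) f y
  bottom_embedding : IsSmoothEmbeddingOn torusCoord (thickTorus 0 c) β
  side_embedding : ∀ i, IsSmoothEmbeddingOn torusCoord (thickTorus 0 1) (σ i)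
  side_disjoint : Disjoint (σ 0 '' thickTorus 0 1) (σ 1 '' thickTorus 0 1)
  top_embedding : ∀ i, IsSmoothEmbeddingOn solidCoord (solidTorus a) (τ i)
  top_disjoint : Disjoint (τ 0 '' solidTorus a) (τ 1 '' solidTorus a)
  side_bottom_left : ∀ x y : Circle, σ 0 (0, x, y) = β (0, x, y)
  side_bottom_right : ∀ x y : Circle, σ 1 (0, x, y) = β (c, x, y)
  side_top : ∀ i, σ i '' {m | m.1 = 1} = τ i '' solidTorusBoundary a
  /-- Outward normal first, the bottom is `-M_c`. -/
  bottom_oriented : ∀ z, torusCoord z ∈ thickTorus 0 c →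
    ∃ f, IsAdapted X (faces c a β σ τ) f (β (torusCoord z)) ∧
      ∀ n, mvfderiv (𝓡 4) (f Face.bottom) (β (torusCoord z)) n < 0 →
        ∀ v₁ v₂ v₃, 0 < vol3 v₁ v₂ v₃ →
          omegaSq Ω (β (torusCoord z)) n (coordDeriv torusCoord β z v₁)
            (coordDeriv torusCoord β z v₂) (coordDeriv torusCoord β z v₃) < 0
  /-- Outward normal first, the top is `T_a ∐ T_a`. -/
  top_oriented : ∀ i, ∀ z, solidCoord z ∈ solidTorus a →
    ∃ f, IsAdapted X (faces c a β σ τ) f (τ i (solidCoord z)) ∧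
      ∀ n, mvfderiv (𝓡 4) (f Face.top) (τ i (solidCoord z)) n < 0 →
        ∀ v₁ v₂ v₃, 0 < vol3 v₁ v₂ v₃ →
          0 < omegaSq Ω (τ i (solidCoord z)) n (coordDeriv solidCoord (τ i) z v₁)
            (coordDeriv solidCoord (τ i) z v₂) (coordDeriv solidCoord (τ i) z v₃)

namespace CobordismWithSides

variable {Ω : TwoForm Y} {c a : ℝ}

/-- The boundary faces of `W`. -/
def face (W : CobordismWithSides Ω c a) : Face → Set Y := faces c a W.β W.σ W.τ

end CobordismWithSides

end Cobordism

/-! ### Spheres and their intersections -/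

section Spheres

variable {Y : Type} [TopologicalSpace Y] [ChartedSpace E4 Y]

/-- The pullback of the 2-form `Ω` under `s : S² → Y`, at `p`. -/
def pullTwo (Ω : TwoForm Y) (s : S2 → Y) (p : S2) (u v : TangentSpace (𝓡 2) p) : ℝ :=
  Ω (s p) ![mfderiv (𝓡 2) (𝓡 4) s p u, mfderiv (𝓡 2) (𝓡 4) s p v]

/-- `s` is a smooth embedding of the 2-sphere. -/
structure IsEmbeddedSphere (s : S2 → Y) : Prop where
  smooth : ContMDiff (𝓡 2) (𝓡 4) ∞ s
  injective : Function.Injective s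
  immersion : ∀ p, Function.Injective (mfderiv (𝓡 2) (𝓡 4) s p)

/-- `s` is a symplectic sphere: `Ω` pulls back to an area form. -/
def IsSymplecticSphere (Ω : TwoForm Y) (s : S2 → Y) : Prop :=
  ∀ (p : S2) (u : TangentSpace (𝓡 2) p), u ≠ 0 → ∃ v, pullTwo Ω s p u v ≠ 0

/-- Half of `Ω ∧ Ω` on `(ds u₁, ds u₂, dr v₁, dr v₂)` at a common point `s p = r q`. -/
def crossing (Ω : TwoForm Y) (s r : S2 → Y) (p q : S2)
    (u₁ u₂ : TangentSpace (𝓡 2) p) (v₁ v₂ : TangentSpace (𝓡 2) q) : ℝ :=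
  omegaSq Ω (s p) (mfderiv (𝓡 2) (𝓡 4) s p u₁) (mfderiv (𝓡 2) (𝓡 4) s p u₂)
    (mfderiv (𝓡 2) (𝓡 4) r q v₁) (mfderiv (𝓡 2) (𝓡 4) r q v₂)

/-- `s p = r q` is a transverse intersection of sign `+1`. Here the domain of `s` is oriented by
`s^* Ω`, the domain of `r` by `r₀^* Ω` (`s` and `r₀` are symplectic spheres), and `Y` by
`Ω ∧ Ω`. -/
def IsPositiveCrossing (Ω : TwoForm Y) (s r₀ r : S2 → Y) (p q : S2) : Prop :=
  s p = r q ∧ ∃ u₁ u₂ v₁ v₂, 0 < pullTwo Ω s p u₁ u₂ ∧ 0 < pullTwo Ω r₀ q v₁ v₂ ∧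
    0 < crossing Ω s r p q u₁ u₂ v₁ v₂

/-- `s p = r q` is a transverse intersection of sign `-1`, with the same conventions. -/
def IsNegativeCrossing (Ω : TwoForm Y) (s r₀ r : S2 → Y) (p q : S2) : Prop :=
  s p = r q ∧ ∃ u₁ u₂ v₁ v₂, 0 < pullTwo Ω s p u₁ u₂ ∧ 0 < pullTwo Ω r₀ q v₁ v₂ ∧
    crossing Ω s r p q u₁ u₂ v₁ v₂ < 0

/-- `s · r₀ = n`: the algebraic intersection number in `A` of the symplectic spheres `s` and `r₀`
(possibly the same), oriented by `Ω`. It is the signed count of the intersections of `s` with a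
sphere `r` which is homotopic to `r₀` in `A` and transverse to `s`. -/
def HasIntersectionNumber (Ω : TwoForm Y) (A : Set Y) (s r₀ : S2 → Y) (n : ℤ) : Prop :=
  ∃ r : S2 → Y, ContMDiff (𝓡 2) (𝓡 4) ∞ r ∧
    (∃ H : unitInterval × S2 → Y, Continuous H ∧ (∀ z, H z ∈ A) ∧
      (∀ p, H (0, p) = r₀ p) ∧ ∀ p, H (1, p) = r p) ∧
    (∀ p q, s p = r q → IsPositiveCrossing Ω s r₀ r p q ∨ IsNegativeCrossing Ω s r₀ r p q) ∧
    {z : S2 × S2 | s z.1 = r z.2}.Finite ∧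
    n = ({z : S2 × S2 | IsPositiveCrossing Ω s r₀ r z.1 z.2}.ncard : ℤ) -
      ({z : S2 × S2 | IsNegativeCrossing Ω s r₀ r z.1 z.2}.ncard : ℤ)

end Spheres

end GayCobordism

end

open GayCobordism

open GayCobordism

noncomputable section

namespace ToricChain

/-! ### Planar and spherical area forms -/

/-! On a round sphere with height `h` and azimuth `φ`, the area form off the poles is `-dh ∧ dφ`, so
the field `h ∂_h` is Liouville with primitive `-h dφ`. On `S² × S²` a point thus has a pair of
heights in the square `[-1,1]²`, which is the moment polygon, and two angles; the product Liouville
field is radial in the plane of heights. Over the four edges of the square lie spheres of square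
zero, and spheres over adjacent edges meet once, orthogonally for the symplectic form, hence
positively. Removing the torus over the origin and passing to the infinite cyclic cover that unwinds
the angle of the pair of heights turns the four edges into an infinite chain indexed by `ℤ`. The
symplectomorphism `quarter` of order four lifts the quarter turn of the square, so all charts and
all spheres are translates of a single one.

The cobordism `domain k` is cut out of this cover by conditions on heights and angle alone. Its
bottom lies over a spiralling arc of a small ellipse, transverse to the radial field. Its sides lie
over two radial segments, so the Liouville field is tangent to them. Its top lies over the segments
`h₂ = -1/2` and `(-1)^k h₁ = 1/2`, each running from the end of a side to an edge of the square; a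
circle collapses over that edge, so the preimage is a solid torus. Strictly between the two
truncated edges (those with index `0` and `2k - 1`) there remain `2k - 2` complete edges, which
carry the required spheres.

With angles `φ₁ = -(2x + y)` and `φ₂ = x + y` the primitive is `(2h₁ - h₂) dx + (h₁ - h₂) dy`. The
ellipse is the circle of radius `1/8` in the coordinates `2h₁ - h₂`, `h₁ - h₂`, so the bottom
carries exactly `1/8` of the form defining `ξ` (`form_field_bottomMap`); `t = 0` and `t = k + 1/2`
are the zeros of the two coordinates, i.e. the two sides. The coefficients are forced: if the solid
tori have framings `m` and `m'`, the condition that `η` agree with the Liouville structure up to the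
boundary puts the sides on the lines `m h₁ = h₂` and `h₁ = m' h₂`. These two linear forms must be a
lattice basis, that is `1 - m m' = ±1`, and positive framings then give `m m' = 2`; here `m = 2` and
`m' = 1`.

On a solid torus placed at height `prof m p`, the symplectic form restricts to `-prof'` times `du ∧
dw - m dp ∧ dα`, and the wedge of the latter with the form defining `η` is `cos (π p) + m sin (π p)`
times the volume (`form_map`, `eta_topForm`). Domination therefore needs only a decreasing profile.
Near the boundary the profile is dictated by the Liouville field (`outer`); near the core it is `1 -
p`, for which the solid torus is smooth; a cutoff interpolates and monotonicity survives
(`deriv_prof_neg`). -/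

/-- The cross product of planar vectors. -/
def cross (a b : ℂ) : ℝ := a.re * b.im - a.im * b.re

/-- The dot product of planar vectors. -/
def dot (a b : ℂ) : ℝ := a.re * b.re + a.im * b.im

/-- The ambient space of a product of two 2-spheres. -/
abbrev Amb : Type := (ℂ × ℝ) × (ℂ × ℝ)

/-- The wedge product of two covectors. -/
def wedge {E : Type*} [NormedAddCommGroup E] [NormedSpace ℝ E] (f g : E →L[ℝ] ℝ) :
    E [⋀^Fin 2]→L[ℝ] ℝ where
  toFun v := f (v 0) * g (v 1) - f (v 1) * g (v 0)
  map_update_add' m i x y := by fin_cases i <;> simp <;> ring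
  map_update_smul' m i x y := by fin_cases i <;> simp <;> ring
  cont := by fun_prop
  map_eq_zero_of_eq' v i j h hij := by
    fin_cases i <;> fin_cases j <;> simp_all

@[simp] lemma wedge_apply {E : Type*} [NormedAddCommGroup E] [NormedSpace ℝ E]
    (f g : E →L[ℝ] ℝ) (v : Fin 2 → E) : wedge f g v = f (v 0) * g (v 1) - f (v 1) * g (v 0) := rfl

/-- The area form of the unit sphere in `ℂ × ℝ`, i.e. `s · (a × b)`. -/
def area (s a b : ℂ × ℝ) : ℝ :=
  s.2 * cross a.1 b.1 + a.2 * cross b.1 s.1 + b.2 * cross s.1 a.1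

/-- The area form of the unit sphere, as an alternating form. -/
def areaForm (s : ℂ × ℝ) : (ℂ × ℝ) [⋀^Fin 2]→L[ℝ] ℝ :=
  let x := Complex.reCLM ∘L ContinuousLinearMap.fst ℝ ℂ ℝ
  let y := Complex.imCLM ∘L ContinuousLinearMap.fst ℝ ℂ ℝ
  let h := ContinuousLinearMap.snd ℝ ℂ ℝ
  s.2 • wedge x y + s.1.re • wedge y h + s.1.im • wedge h x

lemma areaForm_apply (s : ℂ × ℝ) (v : Fin 2 → ℂ × ℝ) : areaForm s v = area s (v 0) (v 1) := by
  simp [areaForm, area, cross]; ring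

/-- The product area form. -/
def ambForm (x : Amb) : Amb [⋀^Fin 2]→L[ℝ] ℝ :=
  (areaForm x.1).compContinuousLinearMap (ContinuousLinearMap.fst ℝ _ _) +
    (areaForm x.2).compContinuousLinearMap (ContinuousLinearMap.snd ℝ _ _)

/-- The product area form as a function of two vectors. -/
def ambArea (x a b : Amb) : ℝ := area x.1 a.1 b.1 + area x.2 a.2 b.2

lemma ambForm_apply (x : Amb) (v : Fin 2 → Amb) : ambForm x v = ambArea x (v 0) (v 1) := by
  simp [ambForm, ambArea, areaForm_apply]

/-- The equation of the unit sphere. -/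
def OnSphere (s : ℂ × ℝ) : Prop := s.1.re ^ 2 + s.1.im ^ 2 + s.2 ^ 2 = 1

lemma OnSphere.abs_le {s : ℂ × ℝ} (h : OnSphere s) : -1 ≤ s.2 ∧ s.2 ≤ 1 := by
  unfold OnSphere at h
  constructor <;> nlinarith [sq_nonneg s.1.re, sq_nonneg s.1.im]

/-- Tangency to the unit sphere. -/
def TangentTo (s a : ℂ × ℝ) : Prop := dot s.1 a.1 + s.2 * a.2 = 0

/-- In action-angle coordinates the area form is `-dh ∧ dφ`. -/
lemma area_action_angle {s a b : ℂ × ℝ} (hs : OnSphere s) (ha : TangentTo s a)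
    (hb : TangentTo s b) :
    (1 - s.2 ^ 2) * area s a b = -(a.2 * cross s.1 b.1 - b.2 * cross s.1 a.1) := by
  unfold OnSphere at hs
  unfold TangentTo at ha hb
  simp only [area, cross, dot] at *
  obtain ⟨⟨x, y⟩, h⟩ := s
  obtain ⟨⟨a1, a2⟩, a3⟩ := a
  obtain ⟨⟨b1, b2⟩, b3⟩ := b
  simp only at *
  linear_combination (-(h * (a1 * b2 - a2 * b1))) * hs + h * (x * b2 - y * b1) * ha -
    h * (x * a2 - y * a1) * hb

/-! ### The symplectic rotation of order four -/

/-- The rotation of the sphere by `π` about a horizontal axis. -/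
def flip : (ℂ × ℝ) ≃L[ℝ] (ℂ × ℝ) :=
  Complex.conjCLE.prodCongr (ContinuousLinearEquiv.neg ℝ)

@[simp] lemma flip_re (s : ℂ × ℝ) : (flip s).1.re = s.1.re := by simp [flip]
@[simp] lemma flip_im (s : ℂ × ℝ) : (flip s).1.im = -s.1.im := by simp [flip]
@[simp] lemma flip_snd (s : ℂ × ℝ) : (flip s).2 = -s.2 := by simp [flip]

/-- `(u, v) ↦ (flip v, u)`. It rotates the pair of heights by `π / 2`. -/
def quarter : Amb ≃L[ℝ] Amb :=
  (ContinuousLinearEquiv.prodComm ℝ (ℂ × ℝ) (ℂ × ℝ)).trans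
    (flip.prodCongr (ContinuousLinearEquiv.refl ℝ (ℂ × ℝ)))

@[simp] lemma quarter_fst (x : Amb) : (quarter x).1 = flip x.2 := rfl
@[simp] lemma quarter_snd (x : Amb) : (quarter x).2 = x.1 := rfl

/-! ### Lambert's equal-area coordinates -/

/-- The square of the Euclidean norm on the plane. -/
def nsq (z : ℂ) : ℝ := z.re ^ 2 + z.im ^ 2

lemma nsq_nonneg (z : ℂ) : 0 ≤ nsq z := by unfold nsq; positivity

lemma nsq_pos {z : ℂ} (h : z ≠ 0) : 0 < nsq z := by
  have : nsq z = Complex.normSq z := by rw [Complex.normSq_apply]; unfold nsq; ring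
  rw [this]; exact Complex.normSq_pos.2 h

@[fun_prop] lemma contDiff_re {n : WithTop ℕ∞} : ContDiff ℝ n Complex.re := Complex.reCLM.contDiff
@[fun_prop] lemma contDiff_im {n : WithTop ℕ∞} : ContDiff ℝ n Complex.im := Complex.imCLM.contDiff

@[fun_prop] lemma contDiff_nsq {n : WithTop ℕ∞} : ContDiff ℝ n nsq := by unfold nsq; fun_prop

lemma hasFDerivAt_nsq (z : ℂ) :
    HasFDerivAt nsq ((2 * z.re) • Complex.reCLM + (2 * z.im) • Complex.imCLM) z := by
  have h := (Complex.reCLM.hasFDerivAt (x := z)).pow 2 |>.add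
    ((Complex.imCLM.hasFDerivAt (x := z)).pow 2)
  exact h.congr_fderiv (by ext; simp)

/-- The inverse of Lambert's projection from the south pole. -/
def lambert (z : ℂ) : ℂ × ℝ := (√(1 - nsq z / 4) • z, 1 - nsq z / 2)

/-- Lambert's projection from the south pole. -/
def unlambert (s : ℂ × ℝ) : ℂ := √(2 / (1 + s.2)) • s.1

lemma lambert_onSphere {z : ℂ} (h : nsq z ≤ 4) : OnSphere (lambert z) := by
  have := Real.sq_sqrt (show 0 ≤ 1 - nsq z / 4 by linarith)
  simp only [OnSphere, lambert, Complex.real_smul, Complex.mul_re, Complex.mul_im,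
    Complex.ofReal_re, Complex.ofReal_im]
  have h2 : z.re ^ 2 + z.im ^ 2 = nsq z := rfl
  linear_combination (z.re ^ 2 + z.im ^ 2) * this + (1 - nsq z / 4) * h2

lemma unlambert_lambert {z : ℂ} (h : nsq z < 4) : unlambert (lambert z) = z := by
  simp only [unlambert, lambert, smul_smul]
  rw [← Real.sqrt_mul (by apply div_nonneg <;> linarith)]
  rw [show 2 / (1 + (1 - nsq z / 2)) * (1 - nsq z / 4) = 1 by
    rw [div_mul_eq_mul_div, div_eq_one_iff_eq (by linarith)]; ring]
  simp

lemma nsq_smul (r : ℝ) (z : ℂ) : nsq (r • z) = r ^ 2 * nsq z := by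
  simp [nsq]; ring

lemma nsq_unlambert {s : ℂ × ℝ} (hs : OnSphere s) (h : -1 < s.2) :
    nsq (unlambert s) = 2 * (1 - s.2) := by
  have h1 : 0 < 1 + s.2 := by linarith
  rw [unlambert, nsq_smul, Real.sq_sqrt (by positivity)]
  have : nsq s.1 = 1 - s.2 ^ 2 := by unfold OnSphere at hs; unfold nsq; linarith
  rw [this]; field_simp; ring

lemma lambert_unlambert {s : ℂ × ℝ} (hs : OnSphere s) (h : -1 < s.2) :
    lambert (unlambert s) = s := by
  have h1 : 0 < 1 + s.2 := by linarith
  refine Prod.ext ?_ ?_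
  · simp only [lambert, nsq_unlambert hs h]
    rw [unlambert, smul_smul, ← Real.sqrt_mul (by linarith [hs.abs_le.2])]
    rw [show (1 - 2 * (1 - s.2) / 4) * (2 / (1 + s.2)) = 1 by field_simp; ring]
    simp
  · simp only [lambert, nsq_unlambert hs h]; ring

lemma contDiffAt_lambert {n : WithTop ℕ∞} {z : ℂ} (h : nsq z < 4) : ContDiffAt ℝ n lambert z := by
  unfold lambert
  refine ContDiffAt.prodMk (ContDiffAt.smul (ContDiffAt.sqrt (by fun_prop) ?_) (by fun_prop))
    (by fun_prop)
  linarith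

lemma contDiffAt_unlambert {n : WithTop ℕ∞} {s : ℂ × ℝ} (h : -1 < s.2) :
    ContDiffAt ℝ n unlambert s := by
  unfold unlambert
  have h1 : 0 < 1 + s.2 := by linarith
  refine ContDiffAt.smul (ContDiffAt.sqrt (ContDiffAt.div (by fun_prop) (by fun_prop) ?_) ?_)
    (by fun_prop)
  · exact h1.ne'
  · exact (div_pos two_pos h1).ne'

lemma hasFDerivAt_lambert {z : ℂ} (h : nsq z < 4) : ∃ D : ℂ →L[ℝ] ℂ × ℝ,
    HasFDerivAt lambert D z ∧ ∀ v, D v =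
      (√(1 - nsq z / 4) • v - (dot z v / (4 * √(1 - nsq z / 4))) • z, -dot z v) := by
  have h0 : 0 < 1 - nsq z / 4 := by linarith
  have h1 : HasFDerivAt (fun z => 1 - nsq z / 4)
      (-((4 : ℝ)⁻¹ • ((2 * z.re) • Complex.reCLM + (2 * z.im) • Complex.imCLM))) z := by
    simpa [div_eq_inv_mul] using ((hasFDerivAt_nsq z).const_smul (4 : ℝ)⁻¹).const_sub 1
  have h2 := (h1.sqrt h0.ne').smul (hasFDerivAt_id z)
  have h3 : HasFDerivAt (fun z => 1 - nsq z / 2)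
      (-((2 : ℝ)⁻¹ • ((2 * z.re) • Complex.reCLM + (2 * z.im) • Complex.imCLM))) z := by
    simpa [div_eq_inv_mul] using ((hasFDerivAt_nsq z).const_smul (2 : ℝ)⁻¹).const_sub 1
  refine ⟨_, h2.prodMk h3, fun v => ?_⟩
  have hs : √(1 - nsq z / 4) ≠ 0 := (Real.sqrt_pos.2 h0).ne'
  refine Prod.ext ?_ ?_
  · simp only [dot, ContinuousLinearMap.prod_apply, add_apply,
      smul_apply, ContinuousLinearMap.smulRight_apply,
      neg_apply, Complex.reCLM_apply, Complex.imCLM_apply,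
      ContinuousLinearMap.id_apply, id, smul_eq_mul, sub_eq_add_neg, ← neg_smul]
    congr 2
    field_simp
  · simp [dot]; ring

lemma fderiv_lambert {z : ℂ} (h : nsq z < 4) (v : ℂ) : fderiv ℝ lambert z v =
      (√(1 - nsq z / 4) • v - (dot z v / (4 * √(1 - nsq z / 4))) • z, -dot z v) := by
  obtain ⟨D, hD, h⟩ := hasFDerivAt_lambert h
  rw [hD.fderiv, h]

/-- Lambert's projection is equal-area. This makes the symplectic form constant in every chart, so
that its smoothness and closedness need no computation. -/
lemma area_lambert {z : ℂ} (h : nsq z < 4) (v w : ℂ) :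
    area (lambert z) (fderiv ℝ lambert z v) (fderiv ℝ lambert z w) = cross v w := by
  rw [fderiv_lambert h, fderiv_lambert h]
  have h0 : 0 < 1 - nsq z / 4 := by linarith
  have hs2 := Real.sq_sqrt h0.le
  have hs : √(1 - nsq z / 4) ≠ 0 := (Real.sqrt_pos.2 h0).ne'
  simp only [lambert]
  set s := √(1 - nsq z / 4)
  have hN : nsq z = 4 - 4 * s ^ 2 := by linarith
  have hz : z.re ^ 2 + z.im ^ 2 = 4 - 4 * s ^ 2 := hN
  rw [hN]
  simp only [area, cross, dot, Complex.smul_re, Complex.smul_im, smul_eq_mul, Complex.sub_re,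
    Complex.sub_im]
  field_simp
  linear_combination ((16 * s ^ 4 + 8 * s ^ 2) * (v.re * w.im - v.im * w.re)) * hz

lemma tangentTo_lambert {z : ℂ} (h : nsq z < 4) (v : ℂ) :
    TangentTo (lambert z) (fderiv ℝ lambert z v) := by
  rw [fderiv_lambert h]
  have h0 : 0 < 1 - nsq z / 4 := by linarith
  have hs2 := Real.sq_sqrt h0.le
  have hs : √(1 - nsq z / 4) ≠ 0 := (Real.sqrt_pos.2 h0).ne'
  simp only [lambert]
  set s := √(1 - nsq z / 4)
  have hN : nsq z = 4 - 4 * s ^ 2 := by linarith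
  have hz : z.re ^ 2 + z.im ^ 2 = 4 - 4 * s ^ 2 := hN
  rw [hN]
  simp only [TangentTo, dot, Complex.smul_re, Complex.smul_im, smul_eq_mul, Complex.sub_re,
    Complex.sub_im]
  field_simp
  linear_combination (-2 * (z.re * v.re + z.im * v.im)) * hz

/-- The height component prescribes `dot z v`; substituting it in the planar component determines
`v`, and tangency of `a` makes the two components consistent. -/
lemma exists_fderiv_lambert {z : ℂ} (h : nsq z < 4) {a : ℂ × ℝ} (ha : TangentTo (lambert z) a) :
    ∃ v, fderiv ℝ lambert z v = a := by
  have h0 : 0 < 1 - nsq z / 4 := by linarith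
  have hs2 := Real.sq_sqrt h0.le
  have hs : √(1 - nsq z / 4) ≠ 0 := (Real.sqrt_pos.2 h0).ne'
  set s := √(1 - nsq z / 4) with hsdef
  have hd : dot z ((s⁻¹ : ℝ) • (a.1 - (a.2 / (4 * s)) • z)) = -a.2 := by
    simp only [TangentTo, lambert, ← hsdef] at ha
    simp only [dot, Complex.smul_re, Complex.smul_im, smul_eq_mul, Complex.sub_re,
      Complex.sub_im] at ha ⊢
    have hN : nsq z = 4 - 4 * s ^ 2 := by linarith
    have hz : z.re ^ 2 + z.im ^ 2 = 4 - 4 * s ^ 2 := hN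
    rw [hN] at ha
    field_simp
    linear_combination 4 * ha - a.2 * hz
  refine ⟨(s⁻¹ : ℝ) • (a.1 - (a.2 / (4 * s)) • z), ?_⟩
  rw [fderiv_lambert h, hd, ← hsdef]
  refine Prod.ext ?_ (by simp)
  rw [smul_smul, mul_inv_cancel₀ hs, one_smul, neg_div, neg_smul, sub_neg_eq_add, sub_add_cancel]

/-! ### The radial Liouville field -/

/-- The radial field `h ∂_h` on the sphere away from the poles. -/
def sphereField (s : ℂ × ℝ) : ℂ × ℝ := (-(s.2 ^ 2 / (1 - s.2 ^ 2)) • s.1, s.2)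

/-- The radial field in Lambert's coordinates. -/
def planeField (z : ℂ) : ℂ := (1 / 2 - 1 / nsq z) • z

/-- The height in the plane is `1 - |z|² / 2`, so a radial field `V` raising the height at rate `h`
satisfies `dot z V = |z|² / 2 - 1`; this fixes the coefficient in `planeField`. -/
lemma fderiv_lambert_planeField {z : ℂ} (h : nsq z < 4) (hz : z ≠ 0) :
    fderiv ℝ lambert z (planeField z) = sphereField (lambert z) := by
  rw [fderiv_lambert h]
  have h0 : 0 < 1 - nsq z / 4 := by linarith
  have hn := nsq_pos hz
  have hs2 := Real.sq_sqrt h0.le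
  have hs : √(1 - nsq z / 4) ≠ 0 := (Real.sqrt_pos.2 h0).ne'
  have hd : dot z (planeField z) = nsq z / 2 - 1 := by
    simp only [dot, planeField, Complex.real_smul, Complex.mul_re, Complex.mul_im,
      Complex.ofReal_re, Complex.ofReal_im]
    have : nsq z ≠ 0 := hn.ne'
    field_simp
    simp only [nsq]; ring
  rw [hd]
  refine Prod.ext ?_ ?_
  · simp only [sphereField, lambert, planeField, smul_smul, ← sub_smul]
    congr 1
    set s := √(1 - nsq z / 4)
    have hN : nsq z = 4 - 4 * s ^ 2 := by linarith
    have h1 : 1 - (1 - nsq z / 2) ^ 2 = nsq z * s ^ 2 := by rw [hs2]; ring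
    rw [h1]
    have : nsq z ≠ 0 := hn.ne'
    field_simp
    rw [hN]; ring
  · simp [sphereField, lambert]

lemma tangentTo_sphereField {s : ℂ × ℝ} (hs : OnSphere s) (h1 : -1 < s.2) (h2 : s.2 < 1) :
    TangentTo s (sphereField s) := by
  have : 1 - s.2 ^ 2 ≠ 0 := by nlinarith
  unfold OnSphere at hs
  simp only [TangentTo, sphereField, dot, Complex.smul_re, Complex.smul_im, smul_eq_mul]
  field_simp
  linear_combination (-s.2 ^ 2) * hs

lemma hasFDerivAt_planeField {z : ℂ} (hz : z ≠ 0) : ∃ D : ℂ →L[ℝ] ℂ,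
    HasFDerivAt planeField D z ∧
      ∀ v, D v = (1 / 2 - 1 / nsq z) • v + (2 * dot z v / nsq z ^ 2) • z := by
  have hn := (nsq_pos hz).ne'
  have h1 := ((hasDerivAt_inv hn).comp_hasFDerivAt z (hasFDerivAt_nsq z)).const_sub (1 / 2)
  refine ⟨_, (h1.smul (hasFDerivAt_id z)).congr_of_eventuallyEq
    (Filter.Eventually.of_forall fun x => ?_), fun v => ?_⟩
  · simp [planeField]
  · simp only [dot, add_apply, smul_apply, ContinuousLinearMap.smulRight_apply, neg_apply,
      Complex.reCLM_apply, Complex.imCLM_apply, ContinuousLinearMap.id_apply, id, smul_eq_mul,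
      Function.comp_apply, one_div]
    congr 2
    field_simp

lemma contDiffAt_planeField {n : WithTop ℕ∞} {z : ℂ} (hz : z ≠ 0) : ContDiffAt ℝ n planeField z := by
  have hn := (nsq_pos hz).ne'
  exact (contDiffAt_const.sub (contDiffAt_const.div contDiff_nsq.contDiffAt hn)).smul contDiffAt_id

/-- The primitive of the area form dual to the radial field. -/
lemma area_sphereField {s b : ℂ × ℝ} (h1 : -1 < s.2) (h2 : s.2 < 1) :
    area s (sphereField s) b = -(s.2 / (1 - s.2 ^ 2)) * cross s.1 b.1 := by
  have : 1 - s.2 ^ 2 ≠ 0 := by nlinarith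
  simp only [area, sphereField, cross, Complex.smul_re, Complex.smul_im, smul_eq_mul]
  field_simp
  ring

/-- The product radial field. -/
def ambField (x : Amb) : Amb := (sphereField x.1, sphereField x.2)

/-! ### Symmetries -/

/-- Both components lie on the unit sphere. -/
def OnSpheres (x : Amb) : Prop := OnSphere x.1 ∧ OnSphere x.2

/-- Both components avoid the poles. -/
def Free (x : Amb) : Prop := (-1 < x.1.2 ∧ x.1.2 < 1) ∧ (-1 < x.2.2 ∧ x.2.2 < 1)

/-- Tangency to the product of spheres. -/
def Tangent (x a : Amb) : Prop := TangentTo x.1 a.1 ∧ TangentTo x.2 a.2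

/-- A linear symmetry of the product of two spheres with its area form and radial field. -/
structure IsSymm (g : Amb ≃L[ℝ] Amb) : Prop where
  area : ∀ x a b, ambArea (g x) (g a) (g b) = ambArea x a b
  spheres : ∀ x, OnSpheres (g x) ↔ OnSpheres x
  free : ∀ x, Free (g x) ↔ Free x
  tangent : ∀ x a, Tangent (g x) (g a) ↔ Tangent x a
  field : ∀ x, ambField (g x) = g (ambField x)

@[simp] lemma cle_one_apply (x : Amb) : (1 : Amb ≃L[ℝ] Amb) x = x := rfl

@[simp] lemma cle_mul_apply (g h : Amb ≃L[ℝ] Amb) (x : Amb) : (g * h) x = g (h x) := rfl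

lemma IsSymm.one : IsSymm 1 := by constructor <;> intros <;> rfl

lemma IsSymm.mul {g h : Amb ≃L[ℝ] Amb} (hg : IsSymm g) (hh : IsSymm h) : IsSymm (g * h) where
  area x a b := by simp [hg.area, hh.area]
  spheres x := by simp [hg.spheres, hh.spheres]
  free x := by simp [hg.free, hh.free]
  tangent x a := by simp [hg.tangent, hh.tangent]
  field x := by rw [cle_mul_apply, cle_mul_apply, hg.field, hh.field]

lemma IsSymm.inv {g : Amb ≃L[ℝ] Amb} (hg : IsSymm g) : IsSymm g⁻¹ := by
  have h : ∀ x, g (g⁻¹ x) = x := fun x => g.apply_symm_apply x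
  refine ⟨fun x a b => ?_, fun x => ?_, fun x => ?_, fun x a => ?_, fun x => ?_⟩
  · rw [← hg.area, h, h, h]
  · rw [← hg.spheres, h]
  · rw [← hg.free, h]
  · rw [← hg.tangent, h, h]
  · apply g.injective; rw [← hg.field, h, h]

/-- `flip` is a rotation of the sphere, so it preserves area, and `h ∂_h` is unchanged under `h ↦
-h`. -/
lemma isSymm_quarter : IsSymm quarter where
  area x a b := by simp [ambArea, _root_.ToricChain.area, cross]; ring
  spheres x := by simp [OnSpheres, OnSphere, and_comm]
  free x := by
    simp only [Free, quarter_fst, quarter_snd, flip_snd]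
    constructor <;> rintro ⟨⟨_, _⟩, _, _⟩ <;> refine ⟨⟨?_, ?_⟩, ?_, ?_⟩ <;> linarith
  tangent x a := by simp [Tangent, TangentTo, dot, and_comm]
  field x := by
    refine Prod.ext (Prod.ext (Complex.ext ?_ ?_) ?_) rfl <;>
      simp [ambField, sphereField, -Complex.real_smul, Complex.smul_re, Complex.smul_im]

lemma isSymm_quarter_zpow (n : ℤ) : IsSymm (quarter ^ n) := by
  induction n using Int.induction_on with
  | zero => simpa using IsSymm.one
  | succ n ih => rw [zpow_add_one]; exact ih.mul isSymm_quarter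
  | pred n ih => rw [zpow_sub_one]; exact ih.mul isSymm_quarter.inv

/-- The exchange of the two spheres. -/
def exchange : Amb ≃L[ℝ] Amb := ContinuousLinearEquiv.prodComm ℝ (ℂ × ℝ) (ℂ × ℝ)

@[simp] lemma exchange_fst (x : Amb) : (exchange x).1 = x.2 := rfl
@[simp] lemma exchange_snd (x : Amb) : (exchange x).2 = x.1 := rfl

lemma isSymm_exchange : IsSymm exchange where
  area x a b := by simp [ambArea]; ring
  spheres x := by simp [OnSpheres, and_comm]
  free x := by simp [Free, and_comm]
  tangent x a := by simp [Tangent, and_comm]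
  field x := rfl

/-! ### The angle of a pair of heights -/

/-- The component of the heights in the direction `ψ`. -/
def along (ψ : ℝ) (x : Amb) : ℝ := x.1.2 * Real.cos ψ + x.2.2 * Real.sin ψ

/-- The component of the heights orthogonal to the direction `ψ`. -/
def across (ψ : ℝ) (x : Amb) : ℝ := x.2.2 * Real.cos ψ - x.1.2 * Real.sin ψ

/-- The angle of the heights that is within `π / 2` of `ψ`. -/
def lift (ψ : ℝ) (x : Amb) : ℝ := ψ + Real.arctan (across ψ x / along ψ x)

lemma along_add (ψ φ : ℝ) (x : Amb) :
    along (ψ + φ) x = along ψ x * Real.cos φ + across ψ x * Real.sin φ := by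
  simp only [along, across, Real.cos_add, Real.sin_add]; ring

lemma across_add (ψ φ : ℝ) (x : Amb) :
    across (ψ + φ) x = across ψ x * Real.cos φ - along ψ x * Real.sin φ := by
  simp only [along, across, Real.cos_add, Real.sin_add]; ring

/-- Turning the frame by the arctangent of the slope puts the pair of heights on its positive axis.
With `across_lift` this says that `lift ψ x` is a genuine polar angle of the heights. -/
lemma along_lift {ψ : ℝ} {x : Amb} (h : 0 < along ψ x) : 0 < along (lift ψ x) x := by
  rw [lift, along_add]
  set t := across ψ x / along ψ x with ht
  have : across ψ x = along ψ x * t := by rw [ht]; field_simp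
  rw [this]
  have hs : Real.sin (Real.arctan t) = t * Real.cos (Real.arctan t) := by
    rw [Real.sin_arctan, Real.cos_arctan]; ring
  rw [hs]
  have := Real.cos_arctan_pos t
  have : 0 < along ψ x * Real.cos (Real.arctan t) * (1 + t ^ 2) := by positivity
  linarith

lemma across_lift {ψ : ℝ} {x : Amb} (h : 0 < along ψ x) : across (lift ψ x) x = 0 := by
  rw [lift, across_add]
  set t := across ψ x / along ψ x with ht
  have : across ψ x = along ψ x * t := by rw [ht]; field_simp
  rw [this, Real.sin_arctan, Real.cos_arctan]; ring

lemma lift_mem (ψ : ℝ) (x : Amb) : |lift ψ x - ψ| < Real.pi / 2 := by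
  rw [lift, add_sub_cancel_left, abs_lt]
  exact ⟨Real.neg_pi_div_two_lt_arctan _, Real.arctan_lt_pi_div_two _⟩

lemma along_pos {ψ θ : ℝ} {x : Amb} (h1 : 0 < along θ x) (h2 : across θ x = 0)
    (h : |θ - ψ| < Real.pi / 2) : 0 < along ψ x := by
  have : ψ = θ + (ψ - θ) := by ring
  rw [this, along_add, h2, zero_mul, add_zero]
  rw [abs_lt] at h
  exact mul_pos h1 (Real.cos_pos_of_mem_Ioo ⟨by linarith, by linarith⟩)

lemma lift_eq {ψ θ : ℝ} {x : Amb} (h1 : 0 < along θ x) (h2 : across θ x = 0)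
    (h : |θ - ψ| < Real.pi / 2) : lift ψ x = θ := by
  have e : ψ = θ + (ψ - θ) := by ring
  rw [abs_lt] at h
  have h3 : across ψ x / along ψ x = Real.tan (θ - ψ) := by
    rw [e, along_add, across_add, h2, Real.tan_eq_sin_div_cos]
    simp only [add_sub_cancel]
    have h4 : 0 < Real.cos (ψ - θ) := Real.cos_pos_of_mem_Ioo ⟨by linarith, by linarith⟩
    rw [← neg_sub ψ θ, Real.sin_neg, Real.cos_neg]
    field_simp
    ring
  rw [lift, h3, Real.arctan_tan (by linarith) (by linarith)]; ring

lemma along_quarter (ψ : ℝ) (x : Amb) : along (ψ + Real.pi / 2) (quarter x) = along ψ x := by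
  simp [along, Real.cos_add_pi_div_two, Real.sin_add_pi_div_two]; ring

lemma across_quarter (ψ : ℝ) (x : Amb) : across (ψ + Real.pi / 2) (quarter x) = across ψ x := by
  simp [across, Real.cos_add_pi_div_two, Real.sin_add_pi_div_two]; ring

lemma along_quarter_zpow (n : ℤ) (ψ : ℝ) (x : Amb) :
    along (ψ + n * (Real.pi / 2)) ((quarter ^ n) x) = along ψ x := by
  induction n using Int.induction_on generalizing ψ x with
  | zero => simp
  | succ n ih =>
    rw [zpow_add_one, cle_mul_apply, ← along_quarter ψ x, ← ih (ψ + Real.pi / 2)]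
    congr 1; push_cast; ring
  | pred n ih =>
    have h := along_quarter (ψ - Real.pi / 2) (quarter⁻¹ x)
    rw [show quarter (quarter⁻¹ x) = x from quarter.apply_symm_apply x, sub_add_cancel] at h
    rw [zpow_sub_one, cle_mul_apply, h, ← ih (ψ - Real.pi / 2) (quarter⁻¹ x)]
    congr 1; push_cast; ring

lemma across_quarter_zpow (n : ℤ) (ψ : ℝ) (x : Amb) :
    across (ψ + n * (Real.pi / 2)) ((quarter ^ n) x) = across ψ x := by
  induction n using Int.induction_on generalizing ψ x with
  | zero => simp
  | succ n ih =>
    rw [zpow_add_one, cle_mul_apply, ← across_quarter ψ x, ← ih (ψ + Real.pi / 2)]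
    congr 1; push_cast; ring
  | pred n ih =>
    have h := across_quarter (ψ - Real.pi / 2) (quarter⁻¹ x)
    rw [show quarter (quarter⁻¹ x) = x from quarter.apply_symm_apply x, sub_add_cancel] at h
    rw [zpow_sub_one, cle_mul_apply, h, ← ih (ψ - Real.pi / 2) (quarter⁻¹ x)]
    congr 1; push_cast; ring

lemma lift_quarter_zpow (n : ℤ) (ψ : ℝ) (x : Amb) :
    lift (ψ + n * (Real.pi / 2)) ((quarter ^ n) x) = lift ψ x + n * (Real.pi / 2) := by
  simp only [lift, along_quarter_zpow, across_quarter_zpow]; ring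

/-! ### The ambient 4-manifold: a cyclic cover of `S² × S²` minus a torus -/

/-- Points of `S² × S²` with nonzero pair of heights, together with a choice of the angle of this
pair. -/
def Chain : Type := {q : Amb × ℝ // OnSpheres q.1 ∧ across q.2 q.1 = 0 ∧ 0 < along q.2 q.1}

namespace Chain

instance : TopologicalSpace Chain := instTopologicalSpaceSubtype
instance : T2Space Chain := inferInstanceAs (T2Space (Subtype _))
instance : SecondCountableTopology Chain := inferInstanceAs (SecondCountableTopology (Subtype _))

/-- The underlying point of `S² × S²`. -/
def pt (y : Chain) : Amb := y.1.1

/-- The angle of the pair of heights. -/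
def angle (y : Chain) : ℝ := y.1.2

lemma onSpheres (y : Chain) : OnSpheres y.pt := y.2.1
lemma across_angle (y : Chain) : across y.angle y.pt = 0 := y.2.2.1
lemma along_angle (y : Chain) : 0 < along y.angle y.pt := y.2.2.2

@[fun_prop] lemma continuous_pt : Continuous pt := continuous_fst.comp continuous_subtype_val
@[fun_prop] lemma continuous_angle : Continuous angle := continuous_snd.comp continuous_subtype_val

@[ext] lemma ext {y z : Chain} (h1 : y.pt = z.pt) (h2 : y.angle = z.angle) : y = z :=
  Subtype.ext (Prod.ext h1 h2)

/-- The points with heights in the half-plane of the directions within `π / 2` of `ψ`. -/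
def Good (ψ : ℝ) (x : Amb) : Prop := OnSpheres x ∧ 0 < along ψ x

/-- The point with given projection and angle. -/
def ofMem (q : Amb × ℝ) (h : OnSpheres q.1 ∧ across q.2 q.1 = 0 ∧ 0 < along q.2 q.1) : Chain :=
  ⟨q, h⟩

instance : Inhabited Chain :=
  ⟨⟨(((0, 1), (1, 0)), 0), by simp [OnSpheres, OnSphere, across, along]⟩⟩

open Classical in
/-- The point over `x` with angle within `π / 2` of `ψ`. -/
def mk (ψ : ℝ) (x : Amb) : Chain :=
  if h : Good ψ x then ofMem (x, lift ψ x) ⟨h.1, across_lift h.2, along_lift h.2⟩ else default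

lemma pt_mk {ψ : ℝ} {x : Amb} (h : Good ψ x) : (mk ψ x).pt = x := by
  rw [mk, dif_pos h]; rfl

lemma angle_mk {ψ : ℝ} {x : Amb} (h : Good ψ x) : (mk ψ x).angle = lift ψ x := by
  rw [mk, dif_pos h]; rfl

lemma good_pt {ψ : ℝ} {y : Chain} (h : |y.angle - ψ| < Real.pi / 2) : Good ψ y.pt :=
  ⟨y.onSpheres, along_pos y.along_angle y.across_angle h⟩

lemma lift_pt {ψ : ℝ} {y : Chain} (h : |y.angle - ψ| < Real.pi / 2) : lift ψ y.pt = y.angle :=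
  lift_eq y.along_angle y.across_angle h

lemma mk_pt {ψ : ℝ} {y : Chain} (h : |y.angle - ψ| < Real.pi / 2) : mk ψ y.pt = y :=
  ext (pt_mk (good_pt h)) (by rw [angle_mk (good_pt h), lift_pt h])

/-- Two such angles both lie within `π / 2` of their mean, and over that half-plane `mk` recovers a
point from its projection. Sheets of the cover over one point are in fact `2π` apart. -/
lemma ext_of_angle {y z : Chain} (h1 : y.pt = z.pt) (h2 : |y.angle - z.angle| < Real.pi) :
    y = z := by
  rw [abs_lt] at h2
  set ψ := (y.angle + z.angle) / 2 with hψ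
  have hy : |y.angle - ψ| < Real.pi / 2 := by rw [abs_lt]; constructor <;> linarith
  have hz : |z.angle - ψ| < Real.pi / 2 := by rw [abs_lt]; constructor <;> linarith
  rw [← mk_pt hy, ← mk_pt hz, h1]

lemma continuousOn_along {M : Type*} [TopologicalSpace M] {s : Set M} {ψ : M → ℝ} {f : M → Amb}
    (hψ : ContinuousOn ψ s) (hf : ContinuousOn f s) : ContinuousOn (fun m => along (ψ m) (f m)) s := by
  unfold along; fun_prop

lemma continuousOn_lift {M : Type*} [TopologicalSpace M] {s : Set M} {ψ : M → ℝ} {f : M → Amb}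
    (hψ : ContinuousOn ψ s) (hf : ContinuousOn f s) (h : ∀ m ∈ s, Good (ψ m) (f m)) :
    ContinuousOn (fun m => lift (ψ m) (f m)) s := by
  have h1 := continuousOn_along hψ hf
  have h2 : ContinuousOn (fun m => across (ψ m) (f m)) s := by unfold across; fun_prop
  have h3 := h2.div h1 (fun m hm => (h m hm).2.ne')
  exact hψ.add (Real.continuous_arctan.comp_continuousOn h3)

lemma continuousOn_of_pt_angle {M : Type*} [TopologicalSpace M] {s : Set M} {g : M → Chain}
    (h1 : ContinuousOn (pt ∘ g) s) (h2 : ContinuousOn (angle ∘ g) s) : ContinuousOn g s :=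
  Topology.IsInducing.subtypeVal.continuousOn_iff.2 (h1.prodMk h2)

lemma continuousAt_of_pt_angle {M : Type*} [TopologicalSpace M] {m : M} {g : M → Chain}
    (h1 : ContinuousAt (pt ∘ g) m) (h2 : ContinuousAt (angle ∘ g) m) : ContinuousAt g m :=
  Topology.IsInducing.subtypeVal.continuousAt_iff.2 (h1.prodMk h2)

lemma continuousOn_mk {M : Type*} [TopologicalSpace M] {s : Set M} {ψ : M → ℝ} {f : M → Amb}
    (hψ : ContinuousOn ψ s) (hf : ContinuousOn f s) (h : ∀ m ∈ s, Good (ψ m) (f m)) :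
    ContinuousOn (fun m => mk (ψ m) (f m)) s :=
  continuousOn_of_pt_angle (hf.congr fun m hm => pt_mk (h m hm))
    ((continuousOn_lift hψ hf h).congr fun m hm => angle_mk (h m hm))

end Chain

/-! ### Charts -/

/-- `ℝ⁴` as a product of two planes. -/
def planes : E4 ≃L[ℝ] ℂ × ℂ := LinearEquiv.toContinuousLinearEquiv
  { toFun := fun x => (⟨x 0, x 1⟩, ⟨x 2, x 3⟩)
    invFun := fun p => !₂[p.1.re, p.1.im, p.2.re, p.2.im]
    map_add' := fun x y => by apply Prod.ext <;> apply Complex.ext <;> simp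
    map_smul' := fun r x => by apply Prod.ext <;> apply Complex.ext <;> simp
    left_inv := fun x => by ext i; fin_cases i <;> simp
    right_inv := fun p => by ext <;> simp }

/-- The open ball of radius two. -/
def ball4 : Set E4 := {x | nsq (planes x).1 + nsq (planes x).2 < 4}

lemma isOpen_ball4 : IsOpen ball4 :=
  have h : Continuous nsq := (contDiff_nsq (n := 0)).continuous
  isOpen_lt ((h.comp (continuous_fst.comp planes.continuous)).add
    (h.comp (continuous_snd.comp planes.continuous))) continuous_const

lemma lt_of_mem_ball4 {x : E4} (h : x ∈ ball4) :
    nsq (planes x).1 < 4 ∧ nsq (planes x).2 < 4 := by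
  have h : nsq (planes x).1 + nsq (planes x).2 < 4 := h
  constructor <;> linarith [nsq_nonneg (planes x).1, nsq_nonneg (planes x).2]

/-- Lambert's coordinates on a product of two spheres. -/
def param (x : E4) : Amb := (lambert (planes x).1, lambert (planes x).2)

/-- The inverse of `param`. -/
def unparam (x : Amb) : E4 := planes.symm (unlambert x.1, unlambert x.2)

lemma contDiffAt_param {n : WithTop ℕ∞} {x : E4} (h : x ∈ ball4) : ContDiffAt ℝ n param x := by
  have h := lt_of_mem_ball4 h
  have hp := planes.contDiff (n := n) |>.contDiffAt (x := x)
  exact (ContDiffAt.comp (f := fun x => (planes x).1) x (contDiffAt_lambert h.1) hp.fst).prodMk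
    (ContDiffAt.comp (f := fun x => (planes x).2) x (contDiffAt_lambert h.2) hp.snd)

lemma contDiffAt_unparam {n : WithTop ℕ∞} {x : Amb} (h1 : -1 < x.1.2) (h2 : -1 < x.2.2) :
    ContDiffAt ℝ n unparam x := by
  have h := ((contDiffAt_unlambert (n := n) h1).comp x contDiffAt_fst).prodMk
    ((contDiffAt_unlambert h2).comp x contDiffAt_snd)
  exact planes.symm.contDiff.contDiffAt.comp x h

lemma fderiv_param {x : E4} (h : x ∈ ball4) (v : E4) : fderiv ℝ param x v =
    (fderiv ℝ lambert (planes x).1 (planes v).1, fderiv ℝ lambert (planes x).2 (planes v).2) := by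
  have h := lt_of_mem_ball4 h
  have h1 := ((contDiffAt_lambert (n := 1) h.1).differentiableAt one_ne_zero).hasFDerivAt
  have h2 := ((contDiffAt_lambert (n := 1) h.2).differentiableAt one_ne_zero).hasFDerivAt
  have hp := planes.hasFDerivAt (x := x)
  exact congrArg (· v) ((h1.comp x hp.fst).prodMk (h2.comp x hp.snd)).fderiv

/-- The standard symplectic form of `ℝ⁴`. -/
def stdForm : E4 [⋀^Fin 2]→L[ℝ] ℝ :=
  let z := ContinuousLinearMap.fst ℝ ℂ ℂ ∘L (planes : E4 →L[ℝ] ℂ × ℂ)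
  let w := ContinuousLinearMap.snd ℝ ℂ ℂ ∘L (planes : E4 →L[ℝ] ℂ × ℂ)
  wedge (Complex.reCLM ∘L z) (Complex.imCLM ∘L z) + wedge (Complex.reCLM ∘L w) (Complex.imCLM ∘L w)

lemma stdForm_apply (v : Fin 2 → E4) : stdForm v =
    cross (planes (v 0)).1 (planes (v 1)).1 + cross (planes (v 0)).2 (planes (v 1)).2 := by
  simp [stdForm, cross]; ring

lemma ambArea_param {x : E4} (h : x ∈ ball4) (v w : E4) :
    ambArea (param x) (fderiv ℝ param x v) (fderiv ℝ param x w) = stdForm ![v, w] := by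
  rw [fderiv_param h, fderiv_param h, stdForm_apply]
  have h := lt_of_mem_ball4 h
  simp only [ambArea, param, area_lambert h.1, area_lambert h.2]
  rfl

lemma stdForm_nondegenerate {v : E4} (h : ∀ w, stdForm ![v, w] = 0) : v = 0 := by
  simp only [stdForm_apply, Matrix.cons_val_zero, Matrix.cons_val_one, cross] at h
  have h1 := h (planes.symm (1, 0))
  have h2 := h (planes.symm (Complex.I, 0))
  have h3 := h (planes.symm (0, 1))
  have h4 := h (planes.symm (0, Complex.I))
  simp at h1 h2 h3 h4
  apply planes.injective
  rw [map_zero]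
  exact Prod.ext (Complex.ext h2 h1) (Complex.ext h4 h3)

lemma unparam_param {x : E4} (h : x ∈ ball4) : unparam (param x) = x := by
  have h := lt_of_mem_ball4 h
  simp [unparam, param, unlambert_lambert h.1, unlambert_lambert h.2]

lemma param_unparam {x : Amb} (h : OnSpheres x) (h1 : -1 < x.1.2) (h2 : -1 < x.2.2) :
    param (unparam x) = x := by
  simp [unparam, param, lambert_unlambert h.1 h1, lambert_unlambert h.2 h2]

lemma along_pi_div_four (x : Amb) : along (Real.pi / 4) x = √2 / 2 * (x.1.2 + x.2.2) := by
  simp [along]; ring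

/-- The half-plane of directions around the diagonal is `h₁ + h₂ > 0`, which in Lambert's
coordinates is precisely the ball of radius two. This is why the charts have that target. -/
lemma good_param {x : E4} (h : x ∈ ball4) : Chain.Good (Real.pi / 4) (param x) := by
  have h' := lt_of_mem_ball4 h
  refine ⟨⟨lambert_onSphere h'.1.le, lambert_onSphere h'.2.le⟩, ?_⟩
  rw [along_pi_div_four]
  have h : nsq (planes x).1 + nsq (planes x).2 < 4 := h
  simp only [param, lambert]
  have : 0 < √2 := by positivity
  apply mul_pos <;> linarith

lemma Chain.Good.heights {x : Amb} (h : Chain.Good (Real.pi / 4) x) :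
    -1 < x.1.2 ∧ -1 < x.2.2 ∧ 0 < x.1.2 + x.2.2 := by
  obtain ⟨h1, h2⟩ := h
  rw [along_pi_div_four] at h2
  have h2 := pos_of_mul_pos_right h2 (by positivity)
  have := h1.1.abs_le
  have := h1.2.abs_le
  exact ⟨by linarith, by linarith, h2⟩

lemma unparam_mem {x : Amb} (h : Chain.Good (Real.pi / 4) x) : unparam x ∈ ball4 := by
  have h' := h.heights
  simp only [ball4, mem_ofPred_eq, unparam, ContinuousLinearEquiv.apply_symm_apply]
  rw [nsq_unlambert h.1.1 h'.1, nsq_unlambert h.1.2 h'.2.1]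
  linarith

/-- The angle of the `n`-th vertex. -/
def center (n : ℤ) : ℝ := Real.pi / 4 + n * (Real.pi / 2)

lemma good_quarter {n : ℤ} {ψ : ℝ} {x : Amb} :
    Chain.Good (ψ + n * (Real.pi / 2)) ((quarter ^ n) x) ↔ Chain.Good ψ x := by
  simp only [Chain.Good, (isSymm_quarter_zpow n).spheres, along_quarter_zpow]

@[simp] lemma quarter_neg_apply (n : ℤ) (x : Amb) : (quarter ^ n) ((quarter ^ (-n)) x) = x := by
  rw [← cle_mul_apply, ← zpow_add]; simp

@[simp] lemma quarter_apply_neg (n : ℤ) (x : Amb) : (quarter ^ (-n)) ((quarter ^ n) x) = x := by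
  rw [← cle_mul_apply, ← zpow_add]; simp

lemma good_quarter_neg {n : ℤ} {y : Chain} (h : |y.angle - center n| < Real.pi / 2) :
    Chain.Good (Real.pi / 4) ((quarter ^ (-n)) y.pt) := by
  rw [← good_quarter (n := n), quarter_neg_apply]
  exact Chain.good_pt h

/-- Lambert's coordinates centered at the `n`-th vertex. -/
def chart (n : ℤ) : OpenPartialHomeomorph Chain E4 where
  toFun y := unparam ((quarter ^ (-n)) y.pt)
  invFun x := Chain.mk (center n) ((quarter ^ n) (param x))
  -- These angular windows have length `π` and centers `π / 2` apart, so they cover everything and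
  -- each contains exactly one corner of the unwound square.
  source := {y | |y.angle - center n| < Real.pi / 2}
  target := ball4
  map_source' y hy := unparam_mem (good_quarter_neg hy)
  map_target' x hx := by
    rw [mem_ofPred_eq, center, Chain.angle_mk (good_quarter.2 (good_param hx))]
    exact lift_mem _ _
  left_inv' y hy := by
    have h := good_quarter_neg hy
    rw [param_unparam h.1 h.heights.1 h.heights.2.1, quarter_neg_apply, Chain.mk_pt hy]
  right_inv' x hx := by
    rw [center, Chain.pt_mk (good_quarter.2 (good_param hx)), quarter_apply_neg, unparam_param hx]
  open_source := isOpen_lt (by fun_prop) continuous_const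
  open_target := isOpen_ball4
  continuousOn_toFun y hy := by
    have h := good_quarter_neg hy
    have h1 : ContinuousAt unparam ((quarter ^ (-n)) y.pt) :=
      (contDiffAt_unparam (n := 0) h.heights.1 h.heights.2.1).continuousAt
    exact (ContinuousAt.comp (f := fun y : Chain => (quarter ^ (-n)) y.pt) h1
      (by fun_prop)).continuousWithinAt
  continuousOn_invFun := by
    refine Chain.continuousOn_mk continuousOn_const ?_ fun x hx => good_quarter.2 (good_param hx)
    intro x hx
    exact ((quarter ^ n).continuous.continuousAt.comp
      (contDiffAt_param (n := 0) hx).continuousAt).continuousWithinAt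

lemma chart_apply (n : ℤ) (y : Chain) : chart n y = unparam ((quarter ^ (-n)) y.pt) := rfl

lemma mem_chart_source {n : ℤ} {y : Chain} :
    y ∈ (chart n).source ↔ |y.angle - center n| < Real.pi / 2 := Iff.rfl

lemma pt_chart_symm (n : ℤ) {x : E4} (h : x ∈ ball4) :
    ((chart n).symm x).pt = (quarter ^ n) (param x) :=
  Chain.pt_mk (good_quarter.2 (good_param h))

/-- The vertex whose chart is used at a given point. -/
def vertex (y : Chain) : ℤ := round ((y.angle - Real.pi / 4) / (Real.pi / 2))

lemma mem_chart_vertex (y : Chain) : y ∈ (chart (vertex y)).source := by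
  rw [mem_chart_source]
  have h := abs_sub_round ((y.angle - Real.pi / 4) / (Real.pi / 2))
  have hpi := Real.pi_pos
  have e : y.angle - center (vertex y) = ((y.angle - Real.pi / 4) / (Real.pi / 2) -
      round ((y.angle - Real.pi / 4) / (Real.pi / 2))) * (Real.pi / 2) := by
    simp only [center, vertex]; field_simp; ring
  rw [e, abs_mul, abs_of_pos (by positivity : 0 < Real.pi / 2)]
  nlinarith

/-! ### The smooth structure of the cover and maps into it -/

namespace Chain

instance : ChartedSpace E4 Chain where
  atlas := range chart
  chartAt y := chart (vertex y)
  mem_chart_source := mem_chart_vertex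
  chart_mem_atlas _ := mem_range_self _

instance : IsManifold (𝓡 4) ∞ Chain := by
  refine isManifold_of_contDiffOn _ _ _ ?_
  rintro _ _ ⟨m, rfl⟩ ⟨n, rfl⟩
  simp only [modelWithCornersSelf_coe, modelWithCornersSelf_coe_symm, Function.comp_id,
    Function.id_comp, range_id, inter_univ, preimage_id]
  rintro x ⟨hx, hx'⟩
  have hx : x ∈ ball4 := hx
  have hx' : (chart m).symm x ∈ (chart n).source := hx'
  refine ContDiffAt.contDiffWithinAt ?_
  have e : chart n ∘ (chart m).symm =ᶠ[𝓝 x]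
      fun x => unparam ((quarter ^ (-n)) ((quarter ^ m) (param x))) := by
    filter_upwards [isOpen_ball4.mem_nhds hx] with x hx
    rw [Function.comp_apply, chart_apply, pt_chart_symm m hx]
  refine ContDiffAt.congr_of_eventuallyEq ?_ e
  have h := (good_quarter_neg hx').heights
  rw [pt_chart_symm m hx] at h
  refine ContDiffAt.comp (g := unparam) x (contDiffAt_unparam h.1 h.2.1) ?_
  exact (quarter ^ (-n)).contDiff.contDiffAt.comp x
    ((quarter ^ m).contDiff.contDiffAt.comp x (contDiffAt_param hx))

lemma chart_mem_maximalAtlas (n : ℤ) : chart n ∈ IsManifold.maximalAtlas (𝓡 4) ∞ Chain :=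
  IsManifold.subset_maximalAtlas (mem_range_self n)

lemma contMDiff_pt : ContMDiff (𝓡 4) 𝓘(ℝ, Amb) ∞ pt := by
  intro y
  have hy := mem_chart_vertex y
  have h1 := contMDiffAt_of_mem_maximalAtlas (chart_mem_maximalAtlas (vertex y)) hy
  have h2 : ContDiffAt ℝ ∞ (fun x => (quarter ^ vertex y) (param x)) (chart (vertex y) y) :=
    (quarter ^ vertex y).contDiff.contDiffAt.comp _
      (contDiffAt_param ((chart (vertex y)).map_source hy))
  refine (h2.contMDiffAt.comp y h1).congr_of_eventuallyEq ?_
  filter_upwards [(chart (vertex y)).open_source.mem_nhds hy] with z hz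
  rw [Function.comp_apply, ← pt_chart_symm _ ((chart (vertex y)).map_source hz),
    (chart (vertex y)).left_inv hz]

lemma mdifferentiableAt_pt (y : Chain) : MDifferentiableAt (𝓡 4) 𝓘(ℝ, Amb) pt y :=
  (contMDiff_pt y).mdifferentiableAt (by simp)

/-- A map into the chain is smooth as soon as it is continuous and smooth into the product of
spheres. -/
lemma contMDiffAt_of_pt {F : Type*} [NormedAddCommGroup F] [NormedSpace ℝ F] {H : Type*}
    [TopologicalSpace H] {I : ModelWithCorners ℝ F H} {M : Type*} [TopologicalSpace M]
    [ChartedSpace H M] {g : M → Chain} {m : M}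
    (h1 : ContMDiffAt I 𝓘(ℝ, Amb) ∞ (pt ∘ g) m) (h2 : ContinuousAt (angle ∘ g) m) :
    ContMDiffAt I (𝓡 4) ∞ g m := by
  have hc : ContinuousAt g m := continuousAt_of_pt_angle h1.continuousAt h2
  have hy := mem_chart_vertex (g m)
  set n := vertex (g m)
  have h := (good_quarter_neg hy).heights
  have h3 : ContDiffAt ℝ ∞ (fun x => unparam ((quarter ^ (-n)) x)) (g m).pt :=
    (contDiffAt_unparam h.1 h.2.1).comp _ (quarter ^ (-n)).contDiff.contDiffAt
  have h4 : ContMDiffAt I 𝓘(ℝ, E4) ∞ (chart n ∘ g) m := ContMDiffAt.comp (f := pt ∘ g) m h3.contMDiffAt h1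
  have h5 := contMDiffAt_symm_of_mem_maximalAtlas (chart_mem_maximalAtlas n)
    ((chart n).map_source hy)
  refine (h5.comp m h4).congr_of_eventuallyEq ?_
  filter_upwards [hc.preimage_mem_nhds ((chart n).open_source.mem_nhds hy)] with z hz
  rw [Function.comp_apply, Function.comp_apply, (chart n).left_inv hz]

/-- The differential of the projection to the product of spheres. -/
def dpt (y : Chain) : TangentSpace (𝓡 4) y →L[ℝ] Amb := mvfderiv (𝓡 4) pt y

/-- The differential of an inverse chart. -/
def dsymm (n : ℤ) (x : E4) : E4 →L[ℝ] TangentSpace (𝓡 4) ((chart n).symm x) :=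
  mfderiv (𝓡 4) (𝓡 4) (chart n).symm x

/-- In the `n`-th chart the projection to `S² × S²` is `param` followed by `quarter ^ n`. This
carries every statement on tangent vectors of the cover to the flat model. -/
lemma dpt_dsymm (n : ℤ) {x : E4} (h : x ∈ ball4) (v : E4) :
    dpt ((chart n).symm x) (dsymm n x v) = (quarter ^ n) (fderiv ℝ param x v) := by
  have h5 := (contMDiffAt_symm_of_mem_maximalAtlas (chart_mem_maximalAtlas n) h).mdifferentiableAt
    (by simp : (∞ : WithTop ℕ∞) ≠ 0)
  have h6 := mfderiv_comp x (mdifferentiableAt_pt ((chart n).symm x)) h5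
  have e : pt ∘ (chart n).symm =ᶠ[𝓝 x] fun x => (quarter ^ n) (param x) := by
    filter_upwards [isOpen_ball4.mem_nhds h] with x hx
    exact pt_chart_symm n hx
  rw [e.mfderiv_eq, mfderiv_eq_fderiv] at h6
  have h7 : HasFDerivAt (fun x => (quarter ^ n) (param x))
      ((quarter ^ n : Amb ≃L[ℝ] Amb).toContinuousLinearMap ∘L fderiv ℝ param x) x :=
    (quarter ^ n).hasFDerivAt.comp x
      ((contDiffAt_param (n := 1) h).differentiableAt one_ne_zero).hasFDerivAt
  rw [h7.fderiv] at h6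
  exact (congrArg (fun L : E4 →L[ℝ] Amb => L v) h6).symm

end Chain

namespace Chain

/-! ### Tangent vectors -/

lemma dsymm_bijective (n : ℤ) {x : E4} (h : x ∈ ball4) : Function.Bijective (dsymm n x) :=
  (mdifferentiable_of_mem_atlas (I := 𝓡 4) (mem_range_self n)).symm.mfderiv_bijective h

/-- Every tangent vector comes from the chart of its base point. -/
lemma exists_chart_vector (y : Chain) : ∃ n, ∃ x ∈ ball4, (chart n).symm x = y := by
  have hy := mem_chart_vertex y
  exact ⟨_, _, (chart (vertex y)).map_source hy, (chart (vertex y)).left_inv hy⟩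

lemma fderiv_param_injective {x : E4} (h : x ∈ ball4) : Function.Injective (fderiv ℝ param x) := by
  rw [injective_iff_map_eq_zero]
  intro v hv
  apply stdForm_nondegenerate
  intro w
  rw [← ambArea_param h, hv]
  simp [ambArea, area, cross]

lemma tangent_fderiv_param {x : E4} (h : x ∈ ball4) (v : E4) :
    Tangent (param x) (fderiv ℝ param x v) := by
  rw [fderiv_param h]
  have h := lt_of_mem_ball4 h
  exact ⟨tangentTo_lambert h.1 _, tangentTo_lambert h.2 _⟩

lemma exists_fderiv_param {x : E4} (h : x ∈ ball4) {a : Amb} (ha : Tangent (param x) a) :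
    ∃ v, fderiv ℝ param x v = a := by
  have h' := lt_of_mem_ball4 h
  obtain ⟨v, hv⟩ := exists_fderiv_lambert h'.1 ha.1
  obtain ⟨w, hw⟩ := exists_fderiv_lambert h'.2 ha.2
  refine ⟨planes.symm (v, w), ?_⟩
  rw [fderiv_param h]
  simp [hv, hw]

lemma tangent_dpt {y : Chain} (v : TangentSpace (𝓡 4) y) : Tangent y.pt (dpt y v) := by
  obtain ⟨n, x, hx, rfl⟩ := exists_chart_vector y
  obtain ⟨v, rfl⟩ := (dsymm_bijective n hx).2 v
  rw [dpt_dsymm n hx, pt_chart_symm n hx, (isSymm_quarter_zpow n).tangent]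
  exact tangent_fderiv_param hx v

lemma exists_dpt {y : Chain} {a : Amb} (ha : Tangent y.pt a) :
    ∃ v : TangentSpace (𝓡 4) y, dpt y v = a := by
  obtain ⟨n, x, hx, rfl⟩ := exists_chart_vector y
  rw [pt_chart_symm n hx, ← quarter_neg_apply n a, (isSymm_quarter_zpow n).tangent] at ha
  obtain ⟨v, hv⟩ := exists_fderiv_param hx ha
  refine ⟨dsymm n x v, ?_⟩
  rw [dpt_dsymm n hx, hv, quarter_neg_apply]

/-! ### The symplectic form -/

/-- The symplectic form: the pullback of the product area form. -/
def form : TwoForm Chain := fun y => (ambForm y.pt).compContinuousLinearMap (dpt y)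

lemma form_apply {y : Chain} (v : Fin 2 → TangentSpace (𝓡 4) y) :
    form y v = ambArea y.pt (dpt y (v 0)) (dpt y (v 1)) := by
  rw [form, ContinuousAlternatingMap.compContinuousLinearMap_apply, ambForm_apply]; rfl

lemma form_vec {y : Chain} (v w : TangentSpace (𝓡 4) y) :
    form y ![v, w] = ambArea y.pt (dpt y v) (dpt y w) := form_apply _

/-- `quarter` preserves the ambient area form and Lambert's coordinates flatten it, so the same
constant form appears in each chart. -/
lemma formInChart_chart (n : ℤ) {x : E4} (h : x ∈ ball4) :
    formInChart form (chart n) x = stdForm := by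
  ext v
  change form ((chart n).symm x) (fun i => dsymm n x (v i)) = _
  rw [form_apply, dpt_dsymm n h, dpt_dsymm n h, pt_chart_symm n h, (isSymm_quarter_zpow n).area,
    ambArea_param h, stdForm_apply, stdForm_apply]
  rfl

lemma isSymplectic_form : IsSymplectic form where
  smooth := by
    rintro _ ⟨n, rfl⟩
    exact contDiffOn_const.congr fun x hx => formInChart_chart n hx
  closed := by
    rintro _ ⟨n, rfl⟩ x hx
    have e : formInChart form (chart n) =ᶠ[𝓝 x] fun _ => stdForm := by
      filter_upwards [isOpen_ball4.mem_nhds hx] with z hz using formInChart_chart n hz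
    rw [e.extDeriv_eq, extDeriv, fderiv_fun_const, Pi.zero_apply]
    exact map_zero (ContinuousAlternatingMap.alternatizeUncurryFinCLM ℝ E4 ℝ)
  nondegenerate := by
    intro y v hv
    obtain ⟨n, x, hx, rfl⟩ := exists_chart_vector y
    obtain ⟨v, rfl⟩ := (dsymm_bijective n hx).2 v
    by_contra! hw
    apply hv
    have : v = 0 := by
      apply stdForm_nondegenerate
      intro w
      have := hw (dsymm n x w)
      rwa [form_vec, dpt_dsymm n hx,
        dpt_dsymm n hx, pt_chart_symm n hx, (isSymm_quarter_zpow n).area,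
        ambArea_param hx] at this
    rw [this, map_zero]

/-! ### The Liouville field -/

/-- The points where both circle actions are free. -/
def freeSet : Set Chain := {y | Free y.pt}

lemma isOpen_freeSet : IsOpen freeSet := by
  have h : IsOpen {x : Amb | Free x} := by
    have h1 : Continuous fun x : Amb => x.1.2 := by fun_prop
    have h2 : Continuous fun x : Amb => x.2.2 := by fun_prop
    exact ((isOpen_lt continuous_const h1).inter (isOpen_lt h1 continuous_const)).inter
      ((isOpen_lt continuous_const h2).inter (isOpen_lt h2 continuous_const))
  exact h.preimage continuous_pt

lemma exists_field {y : Chain} (h : Free y.pt) :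
    ∃ v : TangentSpace (𝓡 4) y, dpt y v = ambField y.pt :=
  exists_dpt ⟨tangentTo_sphereField y.onSpheres.1 h.1.1 h.1.2,
    tangentTo_sphereField y.onSpheres.2 h.2.1 h.2.2⟩

open Classical in
/-- The radial Liouville field. -/
def field (y : Chain) : TangentSpace (𝓡 4) y :=
  if h : Free y.pt then (exists_field h).choose else 0

lemma dpt_field {y : Chain} (h : Free y.pt) : dpt y (field y) = ambField y.pt := by
  rw [field, dif_pos h]
  exact (exists_field h).choose_spec

/-- The radial field in the charts. -/
def stdField (x : E4) : E4 := planes.symm (planeField (planes x).1, planeField (planes x).2)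

lemma planes_ne_zero {x : E4} (h : Free (param x)) : (planes x).1 ≠ 0 ∧ (planes x).2 ≠ 0 := by
  constructor <;> intro h0
  · have := h.1.2; simp [param, lambert, h0, nsq] at this
  · have := h.2.2; simp [param, lambert, h0, nsq] at this

lemma fderiv_param_stdField {x : E4} (hx : x ∈ ball4) (h : Free (param x)) :
    fderiv ℝ param x (stdField x) = ambField (param x) := by
  rw [fderiv_param hx]
  have hx := lt_of_mem_ball4 hx
  have h := planes_ne_zero h
  simp [stdField, fderiv_lambert_planeField hx.1 h.1, fderiv_lambert_planeField hx.2 h.2,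
    ambField, param]

lemma free_chart_symm {n : ℤ} {x : E4} (hx : x ∈ ball4) :
    (chart n).symm x ∈ freeSet ↔ Free (param x) := by
  rw [freeSet, mem_ofPred_eq, pt_chart_symm n hx, (isSymm_quarter_zpow n).free]

/-- A tangent vector is determined by its projection, and the radial field commutes with `quarter`;
so it has the same expression in each chart. -/
lemma fieldInChart_chart {n : ℤ} {x : E4} (hx : x ∈ ball4) (h : Free (param x)) :
    fieldInChart field (chart n) x = stdField x := by
  have he := mdifferentiable_of_mem_atlas (I := 𝓡 4) (mem_range_self (f := chart) n)
  apply fderiv_param_injective hx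
  apply (quarter ^ n).injective
  have h1 := he.symm_comp_deriv (x := (chart n).symm x) ((chart n).map_target hx)
  have h2 := dpt_dsymm n hx (fieldInChart field (chart n) x)
  rw [← h2, fderiv_param_stdField hx h, ← (isSymm_quarter_zpow n).field, ← pt_chart_symm n hx,
    ← dpt_field ((free_chart_symm hx).2 h)]
  congr 1
  rw [(chart n).right_inv hx] at h1
  exact congrArg (fun L => L (field ((chart n).symm x))) h1

/-- In each plane the field is `z / 2 - z / |z|²`: the first term has divergence one and the second
is divergence free away from the origin. The identity on `D` is `d (ι_V ω) = ω` for the constant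
form. -/
lemma hasFDerivAt_stdField {x : E4} (h : Free (param x)) : ∃ D : E4 →L[ℝ] E4,
    HasFDerivAt stdField D x ∧ ∀ v w, stdForm ![D v, w] - stdForm ![D w, v] = stdForm ![v, w] := by
  have h := planes_ne_zero h
  obtain ⟨D1, h1, f1⟩ := hasFDerivAt_planeField h.1
  obtain ⟨D2, h2, f2⟩ := hasFDerivAt_planeField h.2
  have hp := planes.hasFDerivAt (x := x)
  have h3 := HasFDerivAt.comp (g := planeField) (f := fun x => (planes x).1) x h1 hp.fst
  have h4 := HasFDerivAt.comp (g := planeField) (f := fun x => (planes x).2) x h2 hp.snd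
  refine ⟨_, (planes.symm.hasFDerivAt).comp x (h3.prodMk h4), fun v w => ?_⟩
  have key : ∀ z : ℂ, z ≠ 0 → ∀ a b : ℂ,
      cross ((1 / 2 - 1 / nsq z) • a + (2 * dot z a / nsq z ^ 2) • z) b -
      cross ((1 / 2 - 1 / nsq z) • b + (2 * dot z b / nsq z ^ 2) • z) a = cross a b := by
    intro z hz a b
    have hn := (nsq_pos hz).ne'
    simp only [cross, dot, Complex.add_re, Complex.add_im, Complex.smul_re, Complex.smul_im,
      smul_eq_mul]
    field_simp
    simp only [nsq]
    ring
  simp only [stdForm_apply, Matrix.cons_val_zero, Matrix.cons_val_one]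
  rw [← key _ h.1 (planes v).1 (planes w).1, ← key _ h.2 (planes v).2 (planes w).2, ← f1, ← f1,
    ← f2, ← f2]
  simp
  ring

lemma contDiffAt_stdField {n : WithTop ℕ∞} {x : E4} (h : Free (param x)) :
    ContDiffAt ℝ n stdField x := by
  have h := planes_ne_zero h
  have hp := planes.contDiff (n := n) |>.contDiffAt (x := x)
  exact planes.symm.contDiff.contDiffAt.comp x
    ((ContDiffAt.comp (f := fun x => (planes x).1) x (contDiffAt_planeField h.1) hp.fst).prodMk
    (ContDiffAt.comp (f := fun x => (planes x).2) x (contDiffAt_planeField h.2) hp.snd))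

lemma isLiouvilleOn_field : IsLiouvilleOn form field freeSet where
  isOpen := isOpen_freeSet
  smooth := by
    rintro _ ⟨n, rfl⟩ x ⟨hx, hf⟩
    have hc : ContDiffWithinAt ℝ ∞ stdField ((chart n).target ∩ (chart n).symm ⁻¹' freeSet) x :=
      (contDiffAt_stdField ((free_chart_symm hx).1 hf)).contDiffWithinAt
    exact hc.congr (fun z hz => fieldInChart_chart hz.1 ((free_chart_symm hz.1).1 hz.2))
      (fieldInChart_chart hx ((free_chart_symm hx).1 hf))
  liouville := by
    rintro _ ⟨n, rfl⟩ x hx hf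
    have hf' := (free_chart_symm hx).1 hf
    have ho : ∀ᶠ z in 𝓝 x, z ∈ ball4 ∧ Free (param z) := by
      have h := (chart n).continuousOn_symm.isOpen_inter_preimage (chart n).open_target
        isOpen_freeSet
      filter_upwards [h.mem_nhds ⟨hx, hf⟩] with z hz
      exact ⟨hz.1, (free_chart_symm hz.1).1 hz.2⟩
    have e : (fun z => (formInChart form (chart n) z).curryLeft (fieldInChart field (chart n) z))
        =ᶠ[𝓝 x] fun z => stdForm.curryLeft (stdField z) := by
      filter_upwards [ho] with z hz
      rw [formInChart_chart n hz.1, fieldInChart_chart hz.1 hz.2]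
    obtain ⟨D, hD, hf⟩ := hasFDerivAt_stdField hf'
    have hL := (stdForm.curryLeft).hasFDerivAt.comp x hD
    rw [e.extDeriv_eq, formInChart_chart n hx]
    ext v
    change extDeriv (stdForm.curryLeft ∘ stdField) x v = _
    rw [extDeriv, hL.fderiv, ContinuousAlternatingMap.alternatizeUncurryFin_apply]
    have e0 : ∀ a b : E4, (stdForm ![a, b]) = stdForm ![a, b] := fun _ _ => rfl
    have := hf (v 0) (v 1)
    simp only [stdForm_apply, Matrix.cons_val_zero, Matrix.cons_val_one] at this
    rw [stdForm_apply, ← this]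
    simp [Fin.sum_univ_two, ContinuousAlternatingMap.curryLeft_apply_apply, stdForm_apply,
      Fin.removeNth]
    ring

lemma heights_ne_zero (y : Chain) : y.pt.1.2 ≠ 0 ∨ y.pt.2.2 ≠ 0 := by
  by_contra! h
  have := y.along_angle
  simp [along, h.1, h.2] at this

/-- The field changes the heights at a rate equal to the heights, and these never both vanish
because the torus over the origin has been removed. -/
lemma field_ne_zero {y : Chain} (h : y ∈ freeSet) : field y ≠ 0 := by
  intro h0
  have := dpt_field h
  rw [h0, map_zero] at this
  rcases y.heights_ne_zero with h | h
  · exact h (congrArg (fun x : Amb => x.1.2) this).symm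
  · exact h (congrArg (fun x : Amb => x.2.2) this).symm

/-- The primitive `-h / (1 - h²) Im (conj ζ dζ)` of the product area form. -/
def liouvilleForm (x a : Amb) : ℝ :=
  -(x.1.2 / (1 - x.1.2 ^ 2)) * cross x.1.1 a.1.1 + -(x.2.2 / (1 - x.2.2 ^ 2)) * cross x.2.1 a.2.1

lemma form_field {y : Chain} (h : Free y.pt) (v : TangentSpace (𝓡 4) y) :
    form y ![field y, v] = liouvilleForm y.pt (dpt y v) := by
  rw [form_vec, dpt_field h, ambArea, ambField,
    area_sphereField h.1.1 h.1.2, area_sphereField h.2.1 h.2.2, liouvilleForm]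

end Chain

namespace Chain

/-! ### Functions of the heights -/

lemma mvfderiv_comp_pt {P : Amb → ℝ} {y : Chain} (hP : DifferentiableAt ℝ P y.pt)
    (n : TangentSpace (𝓡 4) y) :
    mvfderiv (𝓡 4) (fun z : Chain => P z.pt) y n = fderiv ℝ P y.pt (dpt y n) := by
  have h := mfderiv_comp y hP.mdifferentiableAt (mdifferentiableAt_pt y)
  rw [mfderiv_eq_fderiv] at h
  exact congrArg (fun L : TangentSpace (𝓡 4) y →L[ℝ] ℝ => L n) h

/-- The first height. -/
def fstHeight : Amb →L[ℝ] ℝ :=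
  ContinuousLinearMap.snd ℝ ℂ ℝ ∘L ContinuousLinearMap.fst ℝ (ℂ × ℝ) (ℂ × ℝ)

/-- The second height. -/
def sndHeight : Amb →L[ℝ] ℝ :=
  ContinuousLinearMap.snd ℝ ℂ ℝ ∘L ContinuousLinearMap.snd ℝ (ℂ × ℝ) (ℂ × ℝ)

@[simp] lemma fstHeight_apply (x : Amb) : fstHeight x = x.1.2 := rfl

@[simp] lemma sndHeight_apply (x : Amb) : sndHeight x = x.2.2 := rfl

/-- An affine function of the heights. -/
def aff (α β γ : ℝ) (z : Chain) : ℝ := α * z.pt.1.2 + β * z.pt.2.2 + γ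

lemma contMDiff_comp_pt {P : Amb → ℝ} (hP : ContDiff ℝ ∞ P) :
    ContMDiff (𝓡 4) 𝓘(ℝ, ℝ) ∞ (fun z : Chain => P z.pt) :=
  hP.contMDiff.comp contMDiff_pt

lemma contMDiff_aff (α β γ : ℝ) : ContMDiff (𝓡 4) 𝓘(ℝ, ℝ) ∞ (aff α β γ) :=
  contMDiff_comp_pt (P := fun x => α * x.1.2 + β * x.2.2 + γ) (by fun_prop)

lemma mvfderiv_aff (α β γ : ℝ) {y : Chain} (n : TangentSpace (𝓡 4) y) :
    mvfderiv (𝓡 4) (aff α β γ) y n = α * (dpt y n).1.2 + β * (dpt y n).2.2 := by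
  have h1 : HasFDerivAt (fun x : Amb => x.1.2) fstHeight y.pt := fstHeight.hasFDerivAt
  have h2 : HasFDerivAt (fun x : Amb => x.2.2) sndHeight y.pt := sndHeight.hasFDerivAt
  have h := ((h1.const_mul α).add (h2.const_mul β)).add_const γ
  have e := mvfderiv_comp_pt (y := y) h.differentiableAt n
  rw [h.fderiv] at e
  exact e

/-- The combination of the heights vanishing on the first side. -/
def fstLin (x : Amb) : ℝ := 2 * x.1.2 - x.2.2

/-- The combination of the heights vanishing on the last side. -/
def sndLin (x : Amb) : ℝ := x.1.2 - x.2.2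

/-- The defining function of the bottom. -/
def bottomFn (z : Chain) : ℝ := fstLin z.pt ^ 2 + sndLin z.pt ^ 2 - 1 / 64

lemma contMDiff_bottomFn : ContMDiff (𝓡 4) 𝓘(ℝ, ℝ) ∞ bottomFn :=
  contMDiff_comp_pt (P := fun x => fstLin x ^ 2 + sndLin x ^ 2 - 1 / 64) (by
    unfold fstLin sndLin; fun_prop)

lemma mvfderiv_bottomFn {y : Chain} (n : TangentSpace (𝓡 4) y) :
    mvfderiv (𝓡 4) bottomFn y n =
      2 * fstLin y.pt * fstLin (dpt y n) + 2 * sndLin y.pt * sndLin (dpt y n) := by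
  have h1 : HasFDerivAt (fun x : Amb => x.1.2) fstHeight y.pt := fstHeight.hasFDerivAt
  have h2 : HasFDerivAt (fun x : Amb => x.2.2) sndHeight y.pt := sndHeight.hasFDerivAt
  have h := ((((h1.const_mul 2).sub h2).pow 2).add ((h1.sub h2).pow 2)).sub_const (1 / 64)
  have e := mvfderiv_comp_pt (y := y) h.differentiableAt n
  rw [h.fderiv] at e
  refine e.trans ?_
  simp [fstLin, sndLin]

lemma tangentTo_heightLift {s : ℂ × ℝ} (hs : OnSphere s) (h : -1 < s.2 ∧ s.2 < 1) (α : ℝ) :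
    TangentTo s (-(s.2 * α / (1 - s.2 ^ 2)) • s.1, α) := by
  have : 1 - s.2 ^ 2 ≠ 0 := by nlinarith
  unfold OnSphere at hs
  simp only [TangentTo, dot, Complex.smul_re, Complex.smul_im, smul_eq_mul]
  field_simp
  linear_combination (-s.2 * α) * hs

lemma tangentTo_zero (s : ℂ × ℝ) : TangentTo s 0 := by simp [TangentTo, dot]

/-- The differentials of the heights are independent away from the poles. -/
lemma exists_heights {y : Chain} {α β : ℝ} (h1 : (-1 < y.pt.1.2 ∧ y.pt.1.2 < 1) ∨ α = 0)
    (h2 : (-1 < y.pt.2.2 ∧ y.pt.2.2 < 1) ∨ β = 0) :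
    ∃ n : TangentSpace (𝓡 4) y, (dpt y n).1.2 = α ∧ (dpt y n).2.2 = β := by
  have key : ∀ s : ℂ × ℝ, OnSphere s → ∀ α : ℝ, ((-1 < s.2 ∧ s.2 < 1) ∨ α = 0) →
      ∃ a, TangentTo s a ∧ a.2 = α := by
    rintro s hs α (h | rfl)
    · exact ⟨_, tangentTo_heightLift hs h α, rfl⟩
    · exact ⟨0, tangentTo_zero s, rfl⟩
  obtain ⟨a, ha, ha'⟩ := key _ y.onSpheres.1 α h1
  obtain ⟨b, hb, hb'⟩ := key _ y.onSpheres.2 β h2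
  obtain ⟨n, hn⟩ := exists_dpt (y := y) (a := (a, b)) ⟨ha, hb⟩
  exact ⟨n, by rw [hn]; exact ⟨ha', hb'⟩⟩

/-! ### Angles and signs -/

/-- Polar coordinates in the plane of heights. This converts angular inequalities, within a window
of less than `π`, into the sign of a linear function of the heights, which is smooth on the whole
cover. -/
lemma across_eq (ψ : ℝ) (y : Chain) :
    across ψ y.pt = along y.angle y.pt * Real.sin (y.angle - ψ) := by
  have h := across_add y.angle (ψ - y.angle) y.pt
  rw [add_sub_cancel, y.across_angle, zero_mul, zero_sub, ← mul_neg, ← Real.sin_neg,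
    neg_sub] at h
  exact h

lemma across_nonneg_iff {ψ : ℝ} {y : Chain} (h1 : -Real.pi < y.angle - ψ)
    (h2 : y.angle - ψ < Real.pi) : 0 ≤ across ψ y.pt ↔ ψ ≤ y.angle := by
  rw [across_eq, mul_nonneg_iff_of_pos_left y.along_angle]
  constructor
  · intro h
    by_contra! h3
    have := Real.sin_neg_of_neg_of_neg_pi_lt (by linarith) h1
    linarith
  · intro h
    exact Real.sin_nonneg_of_nonneg_of_le_pi (by linarith) h2.le

lemma across_eq_zero_iff {ψ : ℝ} {y : Chain} (h1 : -Real.pi < y.angle - ψ)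
    (h2 : y.angle - ψ < Real.pi) : across ψ y.pt = 0 ↔ y.angle = ψ := by
  rw [across_eq, mul_eq_zero, or_iff_right y.along_angle.ne', ← sub_eq_zero (a := y.angle)]
  constructor
  · intro h; exact (Real.sin_eq_zero_iff_of_lt_of_lt h1 h2).1 h
  · intro h; rw [h, Real.sin_zero]

/-- The angle of the first side. -/
def firstAngle : ℝ := -(Real.pi / 2) - Real.arctan (1 / 2)

/-- The angle of the last side. -/
def lastAngle (k : ℕ) : ℝ := k * Real.pi + Real.pi / 4

/-- The angle of the core of the last solid torus, up to less than `π / 2`. -/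
def coreAngle (k : ℕ) : ℝ := k * Real.pi - Real.pi / 2

/-- The sign `(-1) ^ k`. -/
def sgn (k : ℕ) : ℝ := (-1) ^ k

lemma sgn_mul_self (k : ℕ) : sgn k * sgn k = 1 := by
  rw [sgn, ← mul_pow]; simp

lemma sgn_cases (k : ℕ) : sgn k = 1 ∨ sgn k = -1 := neg_one_pow_eq_or ℝ k

/-- `firstAngle` is the direction `-(1, 2)`, perpendicular to which the heights are measured by `2h₁
- h₂`; positivity of the factor keeps track of the side of the ray. -/
lemma across_firstAngle (x : Amb) :
    ∃ c : ℝ, 0 < c ∧ across firstAngle x = c * fstLin x := by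
  refine ⟨Real.cos (Real.arctan (1 / 2)) / 2, by have := Real.cos_arctan_pos (1 / 2); linarith, ?_⟩
  have h : Real.sin (Real.arctan (1 / 2)) = Real.cos (Real.arctan (1 / 2)) / 2 := by
    rw [Real.sin_arctan, Real.cos_arctan]; ring
  have e : firstAngle = -(Real.arctan (1 / 2) + Real.pi / 2) := by unfold firstAngle; ring
  rw [across, e, Real.cos_neg, Real.sin_neg, Real.cos_add_pi_div_two, Real.sin_add_pi_div_two, h,
    fstLin]
  ring

lemma across_lastAngle (k : ℕ) (x : Amb) :
    across (lastAngle k) x = -(√2 / 2) * (sgn k * sndLin x) := by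
  rw [across, lastAngle, add_comm, Real.cos_add_nat_mul_pi, Real.sin_add_nat_mul_pi,
    Real.cos_pi_div_four, Real.sin_pi_div_four, sndLin, sgn]
  ring

lemma across_coreAngle (k : ℕ) (x : Amb) : across (coreAngle k) x = sgn k * x.1.2 := by
  rw [across, coreAngle, show k * Real.pi - Real.pi / 2 = -(Real.pi / 2) + k * Real.pi by ring,
    Real.cos_add_nat_mul_pi, Real.sin_add_nat_mul_pi, sgn]
  simp [mul_comm]

lemma across_zero (x : Amb) : across 0 x = x.2.2 := by simp [across]

lemma arctan_half_pos : 0 < Real.arctan (1 / 2) := Real.arctan_pos.2 (by norm_num)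

lemma firstAngle_lt : firstAngle < -(Real.pi / 2) := by
  have := arctan_half_pos; unfold firstAngle; linarith

lemma lt_firstAngle : -Real.pi < firstAngle := by
  have := Real.arctan_lt_pi_div_two (1 / 2); unfold firstAngle; linarith

lemma coreAngle_pos {k : ℕ} (hk : 1 < k) : Real.pi < coreAngle k := by
  have : (2 : ℝ) ≤ k := by exact_mod_cast hk
  have := Real.pi_pos
  unfold coreAngle; nlinarith

lemma lastAngle_eq (k : ℕ) : lastAngle k = coreAngle k + 3 * Real.pi / 4 := by
  unfold lastAngle coreAngle; ring

/-! ### The compact domain and its faces -/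

/-- The underlying domain of the cobordism. -/
def domain (k : ℕ) : Set Chain :=
  {y | 0 ≤ bottomFn y ∧ firstAngle ≤ y.angle ∧ y.angle ≤ lastAngle k ∧
    (0 ≤ y.angle ∨ -(1 / 2) ≤ y.pt.2.2) ∧ (y.angle ≤ coreAngle k ∨ sgn k * y.pt.1.2 ≤ 1 / 2)}

/-- The faces of the domain. -/
def faceSet (k : ℕ) : Face → Set Chain
  | Face.bottom => {y | y ∈ domain k ∧ bottomFn y = 0}
  | Face.side => {y | y ∈ domain k ∧ (y.angle = firstAngle ∨ y.angle = lastAngle k)}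
  | Face.top => {y | y ∈ domain k ∧ (y.angle < 0 ∧ y.pt.2.2 = -(1 / 2) ∨
      coreAngle k < y.angle ∧ sgn k * y.pt.1.2 = 1 / 2)}

open Classical in
/-- Defining functions of the faces near `y`. -/
def faceFn (k : ℕ) (y : Chain) : Face → Chain → ℝ
  | Face.bottom => bottomFn
  | Face.side => if y.angle < 0 then aff 2 (-1) 0 else
      if coreAngle k < y.angle then aff (sgn k) (-sgn k) 0 else aff 0 0 1
  | Face.top => if y.angle < 0 then aff 0 1 (1 / 2) else
      if coreAngle k < y.angle then aff (-sgn k) 0 (1 / 2) else aff 0 0 1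

/-! ### Independence of the differentials of the faces -/

lemma linearIndependent_of_dual {ι E : Type*} [AddCommGroup E] [Module ℝ E] [TopologicalSpace E]
    {L : ι → E →L[ℝ] ℝ} (n : ι → E) (h1 : ∀ i, L i (n i) ≠ 0)
    (h2 : ∀ i j, i ≠ j → L i (n j) = 0) : LinearIndependent ℝ L := by
  rw [linearIndependent_iff']
  intro s g hg i hi
  have h := congrArg (fun L => L (n i)) hg
  simp only [sum_apply, smul_apply, smul_eq_mul, zero_apply] at h
  rw [Finset.sum_eq_single i (fun j _ hj => by rw [h2 j i hj, mul_zero])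
    (fun h => absurd hi h)] at h
  exact (mul_eq_zero.1 h).resolve_right (h1 i)

/-- Bottom and top never meet, so at most two faces pass through a point. A dual vector for the
bottom or the top only has to be tangent to the side, and one for the side only to whichever of the
other two is present. -/
lemma independent_of_dual {f : Face → Chain → ℝ} {y : Chain}
    (hd : ¬(f Face.bottom y = 0 ∧ f Face.top y = 0))
    (hs : f Face.side y = 0 → ∃ n, mvfderiv (𝓡 4) (f Face.side) y n ≠ 0 ∧
      (f Face.bottom y = 0 → mvfderiv (𝓡 4) (f Face.bottom) y n = 0) ∧
      (f Face.top y = 0 → mvfderiv (𝓡 4) (f Face.top) y n = 0))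
    (hb : f Face.bottom y = 0 → ∃ n, mvfderiv (𝓡 4) (f Face.bottom) y n ≠ 0 ∧
      (f Face.side y = 0 → mvfderiv (𝓡 4) (f Face.side) y n = 0))
    (ht : f Face.top y = 0 → ∃ n, mvfderiv (𝓡 4) (f Face.top) y n ≠ 0 ∧
      (f Face.side y = 0 → mvfderiv (𝓡 4) (f Face.side) y n = 0)) :
    LinearIndependent ℝ (fun i : {i : Face // f i y = 0} => mvfderiv (𝓡 4) (f i.1) y) := by
  have h : ∀ i : {i : Face // f i y = 0}, ∃ n, mvfderiv (𝓡 4) (f i.1) y n ≠ 0 ∧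
      ∀ j : {i : Face // f i y = 0}, j ≠ i → mvfderiv (𝓡 4) (f j.1) y n = 0 := by
    rintro ⟨i, hi⟩
    cases i with
    | bottom =>
      obtain ⟨n, h1, h2⟩ := hb hi
      refine ⟨n, h1, ?_⟩
      rintro ⟨j, hj⟩ hij
      cases j with
      | bottom => exact absurd rfl hij
      | side => exact h2 hj
      | top => exact absurd ⟨hi, hj⟩ hd
    | side =>
      obtain ⟨n, h1, h2, h3⟩ := hs hi
      refine ⟨n, h1, ?_⟩
      rintro ⟨j, hj⟩ hij
      cases j with
      | bottom => exact h2 hj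
      | side => exact absurd rfl hij
      | top => exact h3 hj
    | top =>
      obtain ⟨n, h1, h2⟩ := ht hi
      refine ⟨n, h1, ?_⟩
      rintro ⟨j, hj⟩ hij
      cases j with
      | bottom => exact absurd ⟨hj, hi⟩ hd
      | side => exact h2 hj
      | top => exact absurd rfl hij
  choose n h1 h2 using h
  exact linearIndependent_of_dual n h1 fun i j hij => h2 j i hij

/-- The ellipse is small enough to lie in the open square, so the torus action is free over it. -/
lemma free_of_bottom {y : Chain} (h : bottomFn y = 0) : Free y.pt := by
  simp only [bottomFn, fstLin, sndLin] at h
  refine ⟨⟨?_, ?_⟩, ?_, ?_⟩ <;>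
    nlinarith [sq_nonneg (2 * y.pt.1.2 - y.pt.2.2 - (y.pt.1.2 - y.pt.2.2)),
      sq_nonneg (2 * y.pt.1.2 - y.pt.2.2 + (y.pt.1.2 - y.pt.2.2)),
      sq_nonneg (2 * (2 * y.pt.1.2 - y.pt.2.2) + (y.pt.1.2 - y.pt.2.2))]

/-- For a given first height the quadratic form is at least `h₁² / 2`, here `1/8`, which exceeds
`1/64`. This and the next lemma keep the bottom away from the top and from the spheres. -/
lemma bottomFn_pos_of_fst {y : Chain} (h : 1 / 4 ≤ y.pt.1.2 ^ 2) : 0 < bottomFn y := by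
  simp only [bottomFn, fstLin, sndLin]
  nlinarith [sq_nonneg (2 * y.pt.1.2 - y.pt.2.2 + (y.pt.1.2 - y.pt.2.2))]

lemma bottomFn_pos_of_snd {y : Chain} (h : 1 / 4 ≤ y.pt.2.2 ^ 2) : 0 < bottomFn y := by
  simp only [bottomFn, fstLin, sndLin]
  nlinarith [sq_nonneg (2 * (2 * y.pt.1.2 - y.pt.2.2) + (y.pt.1.2 - y.pt.2.2))]

/-- The vector is radial in the heights: by Euler's identity it differentiates the quadratic form to
twice itself, and a linear function to itself, hence to zero on the zero ray of that function. -/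
lemma exists_bottom_normal {y : Chain} (h : bottomFn y = 0) {α β : ℝ} :
    ∃ n : TangentSpace (𝓡 4) y, mvfderiv (𝓡 4) bottomFn y n ≠ 0 ∧
      (aff α β 0 y = 0 → mvfderiv (𝓡 4) (aff α β 0) y n = 0) := by
  have hf := free_of_bottom h
  obtain ⟨n, h1, h2⟩ := exists_heights (y := y) (α := y.pt.1.2) (β := y.pt.2.2) (Or.inl hf.1)
    (Or.inl hf.2)
  refine ⟨n, ?_, ?_⟩
  · rw [mvfderiv_bottomFn]
    simp only [bottomFn, fstLin, sndLin] at h ⊢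
    rw [h1, h2]
    nlinarith
  · rw [mvfderiv_aff, h1, h2, aff, add_zero]; exact id

/-- The direction along the bottom in which the angle varies. -/
lemma exists_bottom_tangent {y : Chain} (h : bottomFn y = 0) :
    ∃ n : TangentSpace (𝓡 4) y, mvfderiv (𝓡 4) bottomFn y n = 0 ∧
      fstLin (dpt y n) = -sndLin y.pt ∧ sndLin (dpt y n) = fstLin y.pt := by
  have hf := free_of_bottom h
  obtain ⟨n, h1, h2⟩ := exists_heights (y := y) (α := -sndLin y.pt - fstLin y.pt)
    (β := -sndLin y.pt - 2 * fstLin y.pt) (Or.inl hf.1) (Or.inl hf.2)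
  have h3 : fstLin (dpt y n) = -sndLin y.pt := by
    rw [fstLin, h1, h2]; ring
  have h4 : sndLin (dpt y n) = fstLin y.pt := by
    rw [sndLin, h1, h2]; ring
  refine ⟨n, ?_, h3, h4⟩
  rw [mvfderiv_bottomFn, h3, h4]; ring

lemma continuous_bottomFn : Continuous bottomFn := contMDiff_bottomFn.continuous

/-! ### Defining functions adapted to the faces -/

lemma faceFn_smooth (k : ℕ) (y : Chain) (i : Face) :
    ContMDiff (𝓡 4) 𝓘(ℝ, ℝ) ∞ (faceFn k y i) := by
  cases i with
  | bottom => exact contMDiff_bottomFn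
  | side => simp only [faceFn]; split_ifs <;> exact contMDiff_aff _ _ _
  | top => simp only [faceFn]; split_ifs <;> exact contMDiff_aff _ _ _

lemma forall_face {p : Face → Prop} :
    (∀ i, p i) ↔ p Face.bottom ∧ p Face.side ∧ p Face.top :=
  ⟨fun h => ⟨h _, h _, h _⟩, fun h i => by cases i; exacts [h.1, h.2.1, h.2.2]⟩

/-- In this window the angle differs from `firstAngle` by less than `π`, so the sine in `across_eq`
has the sign of the difference. -/
lemma first_side_iff {z : Chain} (h1 : -(5 * Real.pi / 4) < z.angle) (h2 : z.angle < 0) :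
    (0 ≤ aff 2 (-1) 0 z ↔ firstAngle ≤ z.angle) ∧
      (aff 2 (-1) 0 z = 0 ↔ z.angle = firstAngle) := by
  obtain ⟨c, hc, h⟩ := across_firstAngle z.pt
  have e : aff 2 (-1) 0 z = fstLin z.pt := by simp only [aff, fstLin]; ring
  have h3 := firstAngle_lt
  have h4 := lt_firstAngle
  have h5 := Real.pi_pos
  rw [e, ← across_nonneg_iff (ψ := firstAngle) (by linarith) (by linarith),
    ← across_eq_zero_iff (ψ := firstAngle) (by linarith) (by linarith), h]
  exact ⟨(mul_nonneg_iff_of_pos_left hc).symm, by simp [hc.ne']⟩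

lemma last_side_iff {k : ℕ} {z : Chain} (h1 : coreAngle k < z.angle)
    (h2 : z.angle < lastAngle k + Real.pi) :
    (0 ≤ aff (sgn k) (-sgn k) 0 z ↔ z.angle ≤ lastAngle k) ∧
      (aff (sgn k) (-sgn k) 0 z = 0 ↔ z.angle = lastAngle k) := by
  have h := across_lastAngle k z.pt
  have e : aff (sgn k) (-sgn k) 0 z = sgn k * sndLin z.pt := by simp only [aff, sndLin]; ring
  have h3 := lastAngle_eq k
  have h5 := Real.pi_pos
  have hs : 0 < √2 / 2 := by positivity
  have h6 := across_eq_zero_iff (ψ := lastAngle k) (y := z) (by linarith) (by linarith)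
  have h7 := across_nonneg_iff (ψ := lastAngle k) (y := z) (by linarith) (by linarith)
  have h8 : aff (sgn k) (-sgn k) 0 z = 0 ↔ z.angle = lastAngle k := by
    rw [← h6, h, e, mul_eq_zero (a := -(√2 / 2)), or_iff_right (by linarith)]
  refine ⟨?_, h8⟩
  constructor
  · intro h9
    rcases h9.lt_or_eq with h9 | h9
    · by_contra! h10
      have := h7.2 h10.le
      rw [h, ← e] at this
      nlinarith
    · exact (h8.1 h9.symm).le
  · intro h9
    rcases h9.lt_or_eq with h9 | h9
    · by_contra! h10
      have : 0 ≤ across (lastAngle k) z.pt := by rw [h, ← e]; nlinarith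
      linarith [h7.1 this]
    · exact (h8.2 h9).ge

/-- The window is an open neighbourhood of the part of the domain with negative angle. The
conditions on the last end hold there automatically, as `coreAngle k` is positive, and what remains
is expressed by smooth functions. -/
lemma domain_first {k : ℕ} (hk : 1 < k) {z : Chain} (h1 : -(5 * Real.pi / 4) < z.angle)
    (h2 : z.angle < 0) :
    z ∈ domain k ↔ 0 ≤ bottomFn z ∧ 0 ≤ aff 2 (-1) 0 z ∧ 0 ≤ aff 0 1 (1 / 2) z := by
  have h3 := coreAngle_pos hk
  have h4 := lastAngle_eq k
  have h5 := Real.pi_pos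
  have e : aff 0 1 (1 / 2) z = z.pt.2.2 + 1 / 2 := by simp only [aff]; ring
  rw [(first_side_iff h1 h2).1, e]
  simp only [domain, mem_ofPred_eq]
  constructor
  · rintro ⟨a, b, c, d | d, e⟩
    · linarith
    · exact ⟨a, b, by linarith⟩
  · rintro ⟨a, b, c⟩
    exact ⟨a, b, by linarith, Or.inr (by linarith), Or.inl (by linarith)⟩

lemma domain_last {k : ℕ} (hk : 1 < k) {z : Chain} (h1 : coreAngle k < z.angle)
    (h2 : z.angle < lastAngle k + Real.pi) :
    z ∈ domain k ↔ 0 ≤ bottomFn z ∧ 0 ≤ aff (sgn k) (-sgn k) 0 z ∧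
      0 ≤ aff (-sgn k) 0 (1 / 2) z := by
  have h3 := coreAngle_pos hk
  have h4 := lastAngle_eq k
  have h5 := Real.pi_pos
  have h6 := firstAngle_lt
  have e : aff (-sgn k) 0 (1 / 2) z = 1 / 2 - sgn k * z.pt.1.2 := by simp only [aff]; ring
  rw [(last_side_iff h1 h2).1, e]
  simp only [domain, mem_ofPred_eq]
  constructor
  · rintro ⟨a, b, c, d, e | e⟩
    · linarith
    · exact ⟨a, c, by linarith⟩
  · rintro ⟨a, b, c⟩
    exact ⟨a, by linarith, b, Or.inl (by linarith), Or.inr (by linarith)⟩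

lemma isAdapted_first {k : ℕ} (hk : 1 < k) {y : Chain} (hy : y ∈ domain k) (h : y.angle < 0) :
    IsAdapted (domain k) (faceSet k) (faceFn k y) y := by
  have hpi := Real.pi_pos
  have hl := lt_firstAngle
  have hc := coreAngle_pos hk
  have hla := lastAngle_eq k
  have h1 : -Real.pi < y.angle := hl.trans_le hy.2.1
  have hs : faceFn k y Face.side = aff 2 (-1) 0 := by simp [faceFn, h]
  have ht : faceFn k y Face.top = aff 0 1 (1 / 2) := by simp [faceFn, h]
  have hb : faceFn k y Face.bottom = bottomFn := rfl
  have hev : ∀ᶠ z in 𝓝 y, -(5 * Real.pi / 4) < z.angle ∧ z.angle < 0 :=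
    (continuous_angle.continuousAt.eventually (lt_mem_nhds (by linarith))).and
      (continuous_angle.continuousAt.eventually (gt_mem_nhds h))
  have hdis : ¬(faceFn k y Face.bottom y = 0 ∧ faceFn k y Face.top y = 0) := by
    rw [hb, ht]
    rintro ⟨h2, h3⟩
    have h3 : y.pt.2.2 = -(1 / 2) := by simp only [aff] at h3; linarith
    have := bottomFn_pos_of_snd (y := y) (by rw [h3]; norm_num)
    linarith
  refine ⟨fun i => Filter.Eventually.of_forall fun z => faceFn_smooth k y i z, ?_, ?_, ?_, hdis⟩
  · filter_upwards [hev] with z hz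
    rw [forall_face, hb, hs, ht, domain_first hk hz.1 hz.2]
  · filter_upwards [hev] with z hz
    rw [forall_face, hb, hs, ht]
    refine ⟨Iff.rfl, ?_, ?_⟩
    · rw [(first_side_iff hz.1 hz.2).2]
      refine and_congr_right fun _ => or_iff_left ?_
      have := hz.2
      linarith
    · refine and_congr_right fun _ => ?_
      have := hz.2
      have e : aff 0 1 (1 / 2) z = z.pt.2.2 + 1 / 2 := by simp only [aff]; ring
      rw [e]
      constructor
      · rintro (h | h) <;> linarith [h.1, h.2]
      · intro h; exact Or.inl ⟨hz.2, by linarith⟩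
  · have htop : -(1 / 2) ≤ y.pt.2.2 := by
      rcases hy.2.2.2.1 with h' | h'
      · linarith
      · exact h'
    have hneg : y.pt.2.2 < 0 := by
      have := across_eq 0 y
      rw [across_zero, sub_zero] at this
      rw [this]
      exact mul_neg_of_pos_of_neg y.along_angle (Real.sin_neg_of_neg_of_neg_pi_lt h h1)
    have hfree : aff 2 (-1) 0 y = 0 → Free y.pt := by
      intro h2
      simp only [aff] at h2
      exact ⟨⟨by linarith, by linarith⟩, by linarith, by linarith⟩
    refine independent_of_dual hdis ?_ ?_ ?_
    · rw [hb, hs, ht]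
      intro h2
      have hf := hfree h2
      by_cases h3 : bottomFn y = 0
      · obtain ⟨n, n1, n2, n3⟩ := exists_bottom_tangent h3
        refine ⟨n, ?_, fun _ => n1, fun h4 => absurd ⟨h3, ht ▸ h4⟩ hdis⟩
        rw [mvfderiv_aff]
        have h5 : sndLin y.pt ≠ 0 := by
          intro h6
          simp only [aff, sndLin] at h2 h6
          linarith
        intro h6
        apply h5
        simp only [fstLin] at n2
        linarith
      · obtain ⟨n, n1, n2⟩ := exists_heights (y := y) (α := 1) (β := 0) (Or.inl hf.1) (Or.inl hf.2)
        refine ⟨n, ?_, fun h4 => absurd h4 h3, fun _ => ?_⟩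
        · rw [mvfderiv_aff, n1, n2]; norm_num
        · rw [mvfderiv_aff, n1, n2]; norm_num
    · rw [hb, hs]
      exact fun h2 => exists_bottom_normal h2
    · rw [hs, ht]
      intro h2
      have h3 : y.pt.2.2 = -(1 / 2) := by simp only [aff] at h2; linarith
      have h4 : -1 < y.pt.2.2 ∧ y.pt.2.2 < 1 := by rw [h3]; norm_num
      -- On the side the radial vector is used. Off the side only the second height is moved,
      -- because the first may be at its pole `h₁ = 1`, the core of the solid torus, where its
      -- differential vanishes.
      by_cases h5 : aff 2 (-1) 0 y = 0
      · obtain ⟨n, n1, n2⟩ := exists_heights (y := y) (α := y.pt.1.2) (β := y.pt.2.2)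
          (Or.inl (hfree h5).1) (Or.inl h4)
        refine ⟨n, ?_, fun _ => ?_⟩
        · rw [mvfderiv_aff, n2, h3]; norm_num
        · rw [mvfderiv_aff, n1, n2]; simp only [aff] at h5; linarith
      · obtain ⟨n, n1, n2⟩ := exists_heights (y := y) (α := 0) (β := y.pt.2.2) (Or.inr rfl)
          (Or.inl h4)
        refine ⟨n, ?_, fun h => absurd h h5⟩
        rw [mvfderiv_aff, n2, h3]; norm_num

lemma isAdapted_last {k : ℕ} (hk : 1 < k) {y : Chain} (hy : y ∈ domain k)
    (h : coreAngle k < y.angle) : IsAdapted (domain k) (faceSet k) (faceFn k y) y := by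
  have hpi := Real.pi_pos
  have hl := firstAngle_lt
  have hc := coreAngle_pos hk
  have hla := lastAngle_eq k
  have h1 : y.angle < lastAngle k + Real.pi := by linarith [hy.2.2.1]
  have h0 : ¬ y.angle < 0 := by linarith
  have hs : faceFn k y Face.side = aff (sgn k) (-sgn k) 0 := by simp [faceFn, h, h0]
  have ht : faceFn k y Face.top = aff (-sgn k) 0 (1 / 2) := by simp [faceFn, h, h0]
  have hb : faceFn k y Face.bottom = bottomFn := rfl
  have hev : ∀ᶠ z in 𝓝 y, coreAngle k < z.angle ∧ z.angle < lastAngle k + Real.pi :=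
    (continuous_angle.continuousAt.eventually (lt_mem_nhds h)).and
      (continuous_angle.continuousAt.eventually (gt_mem_nhds h1))
  have hss := sgn_mul_self k
  have hdis : ¬(faceFn k y Face.bottom y = 0 ∧ faceFn k y Face.top y = 0) := by
    rw [hb, ht]
    rintro ⟨h2, h3⟩
    have h3 : sgn k * y.pt.1.2 = 1 / 2 := by simp only [aff] at h3; linarith
    have := bottomFn_pos_of_fst (y := y) (by
      have : y.pt.1.2 ^ 2 = (sgn k * y.pt.1.2) ^ 2 := by
        linear_combination (-y.pt.1.2 ^ 2) * hss
      rw [this, h3]; norm_num)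
    linarith
  refine ⟨fun i => Filter.Eventually.of_forall fun z => faceFn_smooth k y i z, ?_, ?_, ?_, hdis⟩
  · filter_upwards [hev] with z hz
    rw [forall_face, hb, hs, ht, domain_last hk hz.1 hz.2]
  · filter_upwards [hev] with z hz
    rw [forall_face, hb, hs, ht]
    refine ⟨Iff.rfl, ?_, ?_⟩
    · rw [(last_side_iff hz.1 hz.2).2]
      refine and_congr_right fun _ => or_iff_right ?_
      have := hz.1
      linarith
    · refine and_congr_right fun _ => ?_
      have := hz.1
      have e : aff (-sgn k) 0 (1 / 2) z = 1 / 2 - sgn k * z.pt.1.2 := by simp only [aff]; ring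
      rw [e]
      constructor
      · rintro (h | h) <;> linarith [h.1, h.2]
      · intro h; exact Or.inr ⟨hz.1, by linarith⟩
  · have htop : sgn k * y.pt.1.2 ≤ 1 / 2 := by
      rcases hy.2.2.2.2 with h' | h'
      · linarith
      · exact h'
    have hpos : 0 < sgn k * y.pt.1.2 := by
      rw [← across_coreAngle, across_eq]
      exact mul_pos y.along_angle (Real.sin_pos_of_pos_of_lt_pi (by linarith)
        (by linarith [hy.2.2.1]))
    have hfree1 : -1 < y.pt.1.2 ∧ y.pt.1.2 < 1 := by
      rcases sgn_cases k with h' | h' <;> rw [h'] at htop hpos <;> constructor <;> linarith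
    have hfree : aff (sgn k) (-sgn k) 0 y = 0 → Free y.pt := by
      intro h2
      have h3 : y.pt.1.2 = y.pt.2.2 := by
        simp only [aff] at h2
        rcases sgn_cases k with h' | h' <;> rw [h'] at h2 <;> linarith
      exact ⟨hfree1, h3 ▸ hfree1⟩
    refine independent_of_dual hdis ?_ ?_ ?_
    · rw [hb, hs, ht]
      intro h2
      have hf := hfree h2
      by_cases h3 : bottomFn y = 0
      · obtain ⟨n, n1, n2, n3⟩ := exists_bottom_tangent h3
        refine ⟨n, ?_, fun _ => n1, fun h4 => absurd ⟨h3, ht ▸ h4⟩ hdis⟩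
        rw [mvfderiv_aff]
        simp only [aff, fstLin, sndLin] at h2 n3
        rcases sgn_cases k with h' | h' <;> rw [h'] at h2 hpos ⊢ <;> intro h6 <;> linarith
      · obtain ⟨n, n1, n2⟩ := exists_heights (y := y) (α := 0) (β := 1) (Or.inl hf.1) (Or.inl hf.2)
        refine ⟨n, ?_, fun h4 => absurd h4 h3, fun _ => ?_⟩
        · rw [mvfderiv_aff, n1, n2]
          rcases sgn_cases k with h' | h' <;> rw [h'] <;> norm_num
        · rw [mvfderiv_aff, n1, n2]; norm_num
    · rw [hb, hs]
      exact fun h2 => exists_bottom_normal h2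
    · rw [hs, ht]
      intro h2
      by_cases h5 : aff (sgn k) (-sgn k) 0 y = 0
      · obtain ⟨n, n1, n2⟩ := exists_heights (y := y) (α := y.pt.1.2) (β := y.pt.2.2)
          (Or.inl hfree1) (Or.inl (hfree h5).2)
        refine ⟨n, ?_, fun _ => ?_⟩
        · rw [mvfderiv_aff, n1]; intro h6; linarith
        · rw [mvfderiv_aff, n1, n2]; simp only [aff] at h5; linarith
      · obtain ⟨n, n1, n2⟩ := exists_heights (y := y) (α := y.pt.1.2) (β := 0)
          (Or.inl hfree1) (Or.inr rfl)
        refine ⟨n, ?_, fun h => absurd h h5⟩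
        rw [mvfderiv_aff, n1]; intro h6; linarith

/-- Only the bottom can pass here, and the other two faces get the constant function `1`. At the
extreme angles `0` and `coreAngle k` the height that truncates the domain is zero, so the truncation
stays inactive in a neighbourhood. -/
lemma isAdapted_middle {k : ℕ} (hk : 1 < k) {y : Chain} (h : 0 ≤ y.angle)
    (h' : y.angle ≤ coreAngle k) : IsAdapted (domain k) (faceSet k) (faceFn k y) y := by
  have hpi := Real.pi_pos
  have hl := firstAngle_lt
  have hc := coreAngle_pos hk
  have hla := lastAngle_eq k
  have hs : faceFn k y Face.side = aff 0 0 1 := by simp [faceFn, not_lt.2 h, not_lt.2 h']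
  have ht : faceFn k y Face.top = aff 0 0 1 := by simp [faceFn, not_lt.2 h, not_lt.2 h']
  have hb : faceFn k y Face.bottom = bottomFn := rfl
  have h1 : ∀ z, aff 0 0 1 z = 1 := fun z => by simp [aff]
  have hev1 : ∀ᶠ z in 𝓝 y, firstAngle < z.angle ∧ z.angle < lastAngle k :=
    (continuous_angle.continuousAt.eventually (lt_mem_nhds (by linarith))).and
      (continuous_angle.continuousAt.eventually (gt_mem_nhds (by linarith)))
  have hev2 : ∀ᶠ z in 𝓝 y, 0 ≤ z.angle ∨ -(1 / 2) < z.pt.2.2 := by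
    rcases h.lt_or_eq with h | h
    · filter_upwards [continuous_angle.continuousAt.eventually (lt_mem_nhds h)] with z hz
      exact Or.inl hz.le
    · have h2 : y.pt.2.2 = 0 := by
        rw [← across_zero, across_eq, ← h]; simp
      have h3 : Continuous fun z : Chain => z.pt.2.2 := by fun_prop
      filter_upwards [h3.continuousAt.eventually
        (lt_mem_nhds (show -(1 / 2) < y.pt.2.2 by rw [h2]; norm_num))] with z hz
      exact Or.inr hz
  have hev3 : ∀ᶠ z in 𝓝 y, z.angle ≤ coreAngle k ∨ sgn k * z.pt.1.2 < 1 / 2 := by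
    rcases h'.lt_or_eq with h' | h'
    · filter_upwards [continuous_angle.continuousAt.eventually (gt_mem_nhds h')] with z hz
      exact Or.inl hz.le
    · have h2 : sgn k * y.pt.1.2 = 0 := by
        rw [← across_coreAngle, across_eq, ← h']; simp
      have h3 : Continuous fun z : Chain => sgn k * z.pt.1.2 := by fun_prop
      filter_upwards [h3.continuousAt.eventually
        (gt_mem_nhds (show sgn k * y.pt.1.2 < 1 / 2 by rw [h2]; norm_num))] with z hz
      exact Or.inr hz
  have hdom : ∀ᶠ z in 𝓝 y, (z ∈ domain k ↔ 0 ≤ bottomFn z) := by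
    filter_upwards [hev1, hev2, hev3] with z h4 h5 h6
    exact ⟨fun h => h.1, fun h => ⟨h, h4.1.le, h4.2.le, h5.imp id le_of_lt, h6.imp id le_of_lt⟩⟩
  refine ⟨fun i => Filter.Eventually.of_forall fun z => faceFn_smooth k y i z, ?_, ?_, ?_, ?_⟩
  · filter_upwards [hdom] with z hz
    rw [forall_face, hb, hs, ht, hz, h1]
    simp
  · filter_upwards [hev1, hev2, hev3] with z h4 h5 h6
    rw [forall_face, hb, hs, ht, h1]
    refine ⟨Iff.rfl, ?_, ?_⟩
    · simp only [one_ne_zero, and_false, iff_false]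
      rintro ⟨-, h | h⟩ <;> linarith
    · simp only [one_ne_zero, and_false, iff_false]
      rintro ⟨-, h | h⟩
      · rcases h5 with h5 | h5 <;> linarith [h.1, h.2]
      · rcases h6 with h6 | h6 <;> linarith [h.1, h.2]
  · refine independent_of_dual ?_ ?_ ?_ ?_
    · rw [ht, h1]; simp
    · rw [hs, h1]; simp
    · rw [hb, hs, h1]
      intro h2
      obtain ⟨n, hn, -⟩ := exists_bottom_normal h2 (α := 0) (β := 0)
      exact ⟨n, hn, by simp⟩
    · rw [ht, h1]; simp
  · rw [ht, h1]; simp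

theorem isAdapted_faceFn {k : ℕ} (hk : 1 < k) {y : Chain} (hy : y ∈ domain k) :
    IsAdapted (domain k) (faceSet k) (faceFn k y) y := by
  rcases lt_or_ge y.angle 0 with h | h
  · exact isAdapted_first hk hy h
  rcases lt_or_ge (coreAngle k) y.angle with h' | h'
  · exact isAdapted_last hk hy h'
  · exact isAdapted_middle hk h h'

/-! ### Compactness -/

/-- The set is closed and bounded in the ambient space of points with angle. The strict inequality
defining the cover may be relaxed to a closed one, since `0 ≤ bottomFn` keeps the heights away from
the origin. -/
lemma isCompact_domain (k : ℕ) : IsCompact (domain k) := by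
  set T : Set (Amb × ℝ) := {q | OnSphere q.1.1 ∧ OnSphere q.1.2 ∧ across q.2 q.1 = 0 ∧
    0 ≤ along q.2 q.1 ∧ 0 ≤ fstLin q.1 ^ 2 + sndLin q.1 ^ 2 - 1 / 64 ∧ firstAngle ≤ q.2 ∧
    q.2 ≤ lastAngle k ∧ (0 ≤ q.2 ∨ -(1 / 2) ≤ q.1.2.2) ∧
    (q.2 ≤ coreAngle k ∨ sgn k * q.1.1.2 ≤ 1 / 2)} with hT
  have e : Subtype.val '' (domain k) = T := by
    ext q
    constructor
    · rintro ⟨y, hy, rfl⟩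
      exact ⟨y.2.1.1, y.2.1.2, y.2.2.1, y.2.2.2.le, hy⟩
    · rintro ⟨h1, h2, h3, h4, h5⟩
      have h6 : 0 < along q.2 q.1 := by
        refine h4.lt_of_ne fun h => ?_
        have h7 : along q.2 q.1 ^ 2 + across q.2 q.1 ^ 2 = q.1.1.2 ^ 2 + q.1.2.2 ^ 2 := by
          simp only [along, across]
          linear_combination (q.1.1.2 ^ 2 + q.1.2.2 ^ 2) * Real.sin_sq_add_cos_sq q.2
        rw [h3, ← h] at h7
        have h8 : q.1.1.2 = 0 := by nlinarith
        have h9 : q.1.2.2 = 0 := by nlinarith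
        have := h5.1
        simp only [fstLin, sndLin, h8, h9] at this
        norm_num at this
      exact ⟨ofMem q ⟨⟨h1, h2⟩, h3, h6⟩, h5, rfl⟩
  refine Topology.IsEmbedding.subtypeVal.isCompact_iff.2 ?_
  rw [e]
  refine Metric.isCompact_of_isClosed_isBounded ?_ ?_
  · have r1 : Continuous fun q : Amb × ℝ => q.1.1.1.re := Complex.continuous_re.comp (by fun_prop)
    have i1 : Continuous fun q : Amb × ℝ => q.1.1.1.im := Complex.continuous_im.comp (by fun_prop)
    have r2 : Continuous fun q : Amb × ℝ => q.1.2.1.re := Complex.continuous_re.comp (by fun_prop)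
    have i2 : Continuous fun q : Amb × ℝ => q.1.2.1.im := Complex.continuous_im.comp (by fun_prop)
    have c1 : IsClosed {q : Amb × ℝ | OnSphere q.1.1} :=
      isClosed_eq (by fun_prop) continuous_const
    have c2 : IsClosed {q : Amb × ℝ | OnSphere q.1.2} :=
      isClosed_eq (by fun_prop) continuous_const
    have c3 : IsClosed {q : Amb × ℝ | across q.2 q.1 = 0} :=
      isClosed_eq (by unfold across; fun_prop) continuous_const
    have c4 : IsClosed {q : Amb × ℝ | 0 ≤ along q.2 q.1} :=
      isClosed_le continuous_const (by unfold along; fun_prop)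
    have c5 : IsClosed {q : Amb × ℝ | 0 ≤ fstLin q.1 ^ 2 + sndLin q.1 ^ 2 - 1 / 64} :=
      isClosed_le continuous_const (by unfold fstLin sndLin; fun_prop)
    have c6 : IsClosed {q : Amb × ℝ | firstAngle ≤ q.2} := isClosed_le continuous_const (by fun_prop)
    have c7 : IsClosed {q : Amb × ℝ | q.2 ≤ lastAngle k} :=
      isClosed_le (by fun_prop) continuous_const
    have c8 : IsClosed {q : Amb × ℝ | 0 ≤ q.2 ∨ -(1 / 2) ≤ q.1.2.2} :=
      IsClosed.union (s₁ := {q : Amb × ℝ | 0 ≤ q.2}) (s₂ := {q : Amb × ℝ | -(1 / 2) ≤ q.1.2.2})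
        (isClosed_le continuous_const (by fun_prop)) (isClosed_le continuous_const (by fun_prop))
    have c9 : IsClosed {q : Amb × ℝ | q.2 ≤ coreAngle k ∨ sgn k * q.1.1.2 ≤ 1 / 2} :=
      IsClosed.union (s₁ := {q : Amb × ℝ | q.2 ≤ coreAngle k})
        (s₂ := {q : Amb × ℝ | sgn k * q.1.1.2 ≤ 1 / 2})
        (isClosed_le (by fun_prop) continuous_const) (isClosed_le (by fun_prop) continuous_const)
    exact c1.inter (c2.inter (c3.inter (c4.inter (c5.inter (c6.inter (c7.inter (c8.inter c9)))))))
  · have hb : ∀ s : ℂ × ℝ, OnSphere s → ‖s‖ ≤ 1 := by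
      intro s hs
      have h := hs.abs_le
      unfold OnSphere at hs
      rw [Prod.norm_def, max_le_iff]
      constructor
      · rw [Complex.norm_def, Real.sqrt_le_left (by norm_num), Complex.normSq_apply]
        nlinarith [sq_nonneg s.2]
      · rw [Real.norm_eq_abs, abs_le]; exact h
    have hsub : T ⊆ (Metric.closedBall 0 1) ×ˢ (Icc firstAngle (lastAngle k)) := by
      rintro q ⟨h1, h2, -, -, -, h6, h7, -⟩
      refine ⟨?_, h6, h7⟩
      rw [mem_closedBall_zero_iff, Prod.norm_def, max_le_iff]
      exact ⟨hb _ h1, hb _ h2⟩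
    exact (Metric.isBounded_closedBall.prod (Metric.isBounded_Icc _ _)).subset hsub

end Chain

/-! ### Polar coordinates -/

/-- The planar point with given radius and angle. -/
def polar (R φ : ℝ) : ℂ := R • (Circle.exp φ : ℂ)

lemma nsq_circle (c : Circle) : nsq (c : ℂ) = 1 := by
  have : nsq (c : ℂ) = Complex.normSq c := by rw [Complex.normSq_apply]; unfold nsq; ring
  rw [this, Circle.normSq_coe]

lemma contDiff_circleExp {n : WithTop ℕ∞} : ContDiff ℝ n (fun φ : ℝ => (Circle.exp φ : ℂ)) := by
  have : (fun φ : ℝ => (Circle.exp φ : ℂ)) = fun φ : ℝ => Complex.exp (Complex.ofRealCLM φ * Complex.I) := by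
    ext φ; simp
  rw [this]
  exact Complex.contDiff_exp.comp (Complex.ofRealCLM.contDiff.mul contDiff_const)

lemma hasDerivAt_circleExp (φ : ℝ) :
    HasDerivAt (fun φ : ℝ => (Circle.exp φ : ℂ)) (Circle.exp φ * Complex.I) φ := by
  have h : HasDerivAt (fun φ : ℝ => (φ : ℂ) * Complex.I) Complex.I φ := by
    simpa using (Complex.ofRealCLM.hasDerivAt (x := φ)).mul_const Complex.I
  simpa using h.cexp

/-- The radial part of the derivative is parallel to the point and drops out of the cross product,
leaving the change of angle. -/
lemma hasFDerivAt_polar {E : Type*} [NormedAddCommGroup E] [NormedSpace ℝ E] {R φ : E → ℝ}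
    {R' φ' : E →L[ℝ] ℝ} {z : E} (hR : HasFDerivAt R R' z) (hφ : HasFDerivAt φ φ' z) :
    ∃ D : E →L[ℝ] ℂ, HasFDerivAt (fun z => polar (R z) (φ z)) D z ∧
      ∀ v, cross (polar (R z) (φ z)) (D v) = R z ^ 2 * φ' v := by
  have h := hR.smul ((hasDerivAt_circleExp (φ z)).hasFDerivAt.comp z hφ)
  refine ⟨_, h, fun v => ?_⟩
  have hn := nsq_circle (Circle.exp (φ z))
  simp only [Function.comp_apply, add_apply, smul_apply, ContinuousLinearMap.smulRight_apply,
    ContinuousLinearMap.comp_apply, ContinuousLinearMap.toSpanSingleton_apply, cross, polar, Complex.add_re, Complex.add_im, Complex.smul_re, Complex.smul_im, smul_eq_mul,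
    Complex.mul_re, Complex.mul_im, Complex.I_re, Complex.I_im]
  unfold nsq at hn
  linear_combination R z ^ 2 * φ' v * hn

lemma exists_circle {s : ℂ × ℝ} (hs : OnSphere s) : ∃ c : Circle, s.1 = √(1 - s.2 ^ 2) • (c : ℂ) := by
  have hn : ‖s.1‖ = √(1 - s.2 ^ 2) := by
    rw [Complex.norm_def, Complex.normSq_apply]
    unfold OnSphere at hs
    congr 1; linarith
  rw [← hn]
  by_cases h : s.1 = 0
  · exact ⟨1, by simp [h]⟩
  · refine ⟨⟨(‖s.1‖⁻¹ : ℝ) • s.1, ?_⟩, ?_⟩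
    · rw [Submonoid.unitSphere, Submonoid.mem_mk]
      simp [h]
    · have : ‖s.1‖ ≠ 0 := by simpa using h
      rw [smul_smul, mul_inv_cancel₀ this, one_smul]

namespace Chain

/-! ### Rates of change of action-angle coordinates -/

/-- The tangent vector `v` at a free point has rates `p` of the heights and `φ` of the angles. -/
structure Rates (y : Chain) (v : TangentSpace (𝓡 4) y) (p₁ p₂ φ₁ φ₂ : ℝ) : Prop where
  fst_height : (dpt y v).1.2 = p₁
  snd_height : (dpt y v).2.2 = p₂
  fst_angle : cross y.pt.1.1 (dpt y v).1.1 = (1 - y.pt.1.2 ^ 2) * φ₁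
  snd_angle : cross y.pt.2.1 (dpt y v).2.1 = (1 - y.pt.2.2 ^ 2) * φ₂

lemma area_of_rates {s a b : ℂ × ℝ} (hs : OnSphere s) (h : -1 < s.2 ∧ s.2 < 1)
    (ha : TangentTo s a) (hb : TangentTo s b) {φ φ' : ℝ} (h1 : cross s.1 a.1 = (1 - s.2 ^ 2) * φ)
    (h2 : cross s.1 b.1 = (1 - s.2 ^ 2) * φ') : area s a b = -(a.2 * φ' - b.2 * φ) := by
  have hn : 1 - s.2 ^ 2 ≠ 0 := by nlinarith
  apply mul_left_cancel₀ hn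
  rw [area_action_angle hs ha hb, h1, h2]; ring

variable {y : Chain} {v w : TangentSpace (𝓡 4) y} {p₁ p₂ φ₁ φ₂ p₁' p₂' φ₁' φ₂' : ℝ}

lemma Rates.form (hf : Free y.pt) (hv : Rates y v p₁ p₂ φ₁ φ₂) (hw : Rates y w p₁' p₂' φ₁' φ₂') :
    form y ![v, w] = -(p₁ * φ₁' - p₁' * φ₁) - (p₂ * φ₂' - p₂' * φ₂) := by
  rw [form_vec, ambArea, area_of_rates y.onSpheres.1 hf.1 (tangent_dpt v).1 (tangent_dpt w).1
    hv.fst_angle hw.fst_angle, area_of_rates y.onSpheres.2 hf.2 (tangent_dpt v).2 (tangent_dpt w).2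
    hv.snd_angle hw.snd_angle, hv.fst_height, hv.snd_height, hw.fst_height, hw.snd_height]
  ring

lemma exists_rates (hf : Free y.pt) (v : TangentSpace (𝓡 4) y) :
    ∃ φ₁ φ₂, Rates y v (dpt y v).1.2 (dpt y v).2.2 φ₁ φ₂ := by
  have h1 : 1 - y.pt.1.2 ^ 2 ≠ 0 := by nlinarith [hf.1.1, hf.1.2]
  have h2 : 1 - y.pt.2.2 ^ 2 ≠ 0 := by nlinarith [hf.2.1, hf.2.2]
  exact ⟨cross y.pt.1.1 (dpt y v).1.1 / (1 - y.pt.1.2 ^ 2),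
    cross y.pt.2.1 (dpt y v).2.1 / (1 - y.pt.2.2 ^ 2), rfl, rfl, by field_simp, by field_simp⟩

lemma Rates.form_field (hf : Free y.pt) (hv : Rates y v p₁ p₂ φ₁ φ₂) :
    Chain.form y ![field y, v] = -(y.pt.1.2 * φ₁) - y.pt.2.2 * φ₂ := by
  rw [Chain.form_field hf, liouvilleForm, hv.fst_angle, hv.snd_angle]
  have h1 : 1 - y.pt.1.2 ^ 2 ≠ 0 := by nlinarith [hf.1.1, hf.1.2]
  have h2 : 1 - y.pt.2.2 ^ 2 ≠ 0 := by nlinarith [hf.2.1, hf.2.2]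
  field_simp
  ring

/-! ### Maps of thickened tori -/

lemma smooth_of_ambient {Q : Type} {κ : ℝ × ℝ × ℝ → Q} {g : Q → Chain} {z : ℝ × ℝ × ℝ}
    {G : ℝ × ℝ × ℝ → Amb} (hG : ContDiffAt ℝ ∞ G z) (e : (fun z => (g (κ z)).pt) =ᶠ[𝓝 z] G)
    (ha : ContinuousAt (fun z => (g (κ z)).angle) z) :
    ContMDiffAt 𝓘(ℝ, ℝ × ℝ × ℝ) (𝓡 4) ∞ (g ∘ κ) z :=
  contMDiffAt_of_pt (g := g ∘ κ) (hG.contMDiffAt.congr_of_eventuallyEq e) ha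

lemma dpt_coordDeriv {Q : Type} {κ : ℝ × ℝ × ℝ → Q} {g : Q → Chain} {z : ℝ × ℝ × ℝ}
    (hg : ContMDiffAt 𝓘(ℝ, ℝ × ℝ × ℝ) (𝓡 4) ∞ (g ∘ κ) z)
    {G : ℝ × ℝ × ℝ → Amb} (e : (fun z => (g (κ z)).pt) =ᶠ[𝓝 z] G)
    {D : ℝ × ℝ × ℝ →L[ℝ] Amb} (hD : HasFDerivAt G D z) (v : ℝ × ℝ × ℝ) :
    dpt (g (κ z)) (coordDeriv κ g z v) = D v := by
  have h := mfderiv_comp z (mdifferentiableAt_pt ((g ∘ κ) z))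
    (hg.mdifferentiableAt (by simp : (∞ : WithTop ℕ∞) ≠ 0))
  have e' : pt ∘ (g ∘ κ) =ᶠ[𝓝 z] G := e
  rw [e'.mfderiv_eq, mfderiv_eq_fderiv, hD.fderiv] at h
  exact (congrArg (fun L : ℝ × ℝ × ℝ →L[ℝ] Amb => L v) h).symm

/-- The point of `S² × S²` with given heights and angles. -/
def torusPt (p₁ p₂ : ℝ) (X Y : Circle) : Amb :=
  ((√(1 - p₁ ^ 2) • ((X⁻¹ ^ 2 * Y⁻¹ : Circle) : ℂ), p₁), (√(1 - p₂ ^ 2) • ((X * Y : Circle) : ℂ), p₂))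

lemma onSphere_circle {p : ℝ} (h : p ^ 2 ≤ 1) (c : Circle) :
    OnSphere (√(1 - p ^ 2) • (c : ℂ), p) := by
  have h1 := nsq_circle c
  have h2 := Real.sq_sqrt (show 0 ≤ 1 - p ^ 2 by linarith)
  unfold nsq at h1
  simp only [OnSphere, Complex.smul_re, Complex.smul_im, smul_eq_mul]
  linear_combination (√(1 - p ^ 2)) ^ 2 * h1 + h2

/-- The condition on heights under which a torus of points exists with angle near `ψ`. -/
structure TorusOK (p₁ p₂ ψ : ℝ) : Prop where
  fst : -1 < p₁ ∧ p₁ < 1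
  snd : -1 < p₂ ∧ p₂ < 1
  pos : 0 < p₁ * Real.cos ψ + p₂ * Real.sin ψ

lemma TorusOK.good {p₁ p₂ ψ : ℝ} (h : TorusOK p₁ p₂ ψ) (X Y : Circle) :
    Good ψ (torusPt p₁ p₂ X Y) :=
  ⟨⟨onSphere_circle (by nlinarith [h.fst.1, h.fst.2]) _,
    onSphere_circle (by nlinarith [h.snd.1, h.snd.2]) _⟩, h.pos⟩

lemma TorusOK.free {p₁ p₂ ψ : ℝ} (h : TorusOK p₁ p₂ ψ) (X Y : Circle) :
    Free (torusPt p₁ p₂ X Y) := ⟨h.fst, h.snd⟩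

/-- A one-parameter family of tori of constant heights. -/
def torusMap (P₁ P₂ ψ : ℝ → ℝ) (m : ℝ × Circle × Circle) : Chain :=
  mk (ψ m.1) (torusPt (P₁ m.1) (P₂ m.1) m.2.1 m.2.2)

/-- The angles `-(2x + y)` and `x + y` are a unimodular change of `x` and `y`, for which the
primitive becomes `(2h₁ - h₂) dx + (h₁ - h₂) dy`. -/
lemma torusPt_exp (p₁ p₂ x y : ℝ) : torusPt p₁ p₂ (Circle.exp x) (Circle.exp y) =
    ((polar (√(1 - p₁ ^ 2)) (-(2 * x + y)), p₁), (polar (√(1 - p₂ ^ 2)) (x + y), p₂)) := by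
  have h : (Circle.exp x)⁻¹ ^ 2 * (Circle.exp y)⁻¹ = Circle.exp (-(2 * x + y)) := by
    rw [Circle.exp_neg, Circle.exp_add, two_mul, Circle.exp_add, mul_inv, mul_inv, pow_two]
  rw [torusPt, polar, polar, h, Circle.exp_add]

section TorusMap

variable {P₁ P₂ ψ : ℝ → ℝ}

lemma pt_torusMap {m : ℝ × Circle × Circle} (h : TorusOK (P₁ m.1) (P₂ m.1) (ψ m.1)) :
    (torusMap P₁ P₂ ψ m).pt = torusPt (P₁ m.1) (P₂ m.1) m.2.1 m.2.2 := pt_mk (h.good _ _)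

lemma angle_torusMap {m : ℝ × Circle × Circle} (h : TorusOK (P₁ m.1) (P₂ m.1) (ψ m.1)) :
    (torusMap P₁ P₂ ψ m).angle = lift (ψ m.1) (torusPt (P₁ m.1) (P₂ m.1) 1 1) :=
  angle_mk (h.good _ _)

lemma free_torusMap {m : ℝ × Circle × Circle} (h : TorusOK (P₁ m.1) (P₂ m.1) (ψ m.1)) :
    Free (torusMap P₁ P₂ ψ m).pt := by
  rw [pt_torusMap h]; exact h.free _ _

lemma isOpen_torusOK (h₁ : Continuous P₁) (h₂ : Continuous P₂) (hψ : Continuous ψ) :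
    IsOpen {t | TorusOK (P₁ t) (P₂ t) (ψ t)} := by
  have e : {t | TorusOK (P₁ t) (P₂ t) (ψ t)} =
      ({t | -1 < P₁ t} ∩ {t | P₁ t < 1}) ∩ (({t | -1 < P₂ t} ∩ {t | P₂ t < 1}) ∩
        {t | 0 < P₁ t * Real.cos (ψ t) + P₂ t * Real.sin (ψ t)}) := by
    ext t
    exact ⟨fun h => ⟨h.fst, h.snd, h.pos⟩, fun h => ⟨h.1, h.2.1, h.2.2⟩⟩
  rw [e]
  exact ((isOpen_lt continuous_const h₁).inter (isOpen_lt h₁ continuous_const)).inter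
    (((isOpen_lt continuous_const h₂).inter (isOpen_lt h₂ continuous_const)).inter
      (isOpen_lt continuous_const (by fun_prop)))

/-- The expression of `torusMap` in angular coordinates. -/
def torusCoordMap (P₁ P₂ : ℝ → ℝ) (z : ℝ × ℝ × ℝ) : Amb :=
  ((polar (√(1 - P₁ z.1 ^ 2)) (-(2 * z.2.1 + z.2.2)), P₁ z.1),
    (polar (√(1 - P₂ z.1 ^ 2)) (z.2.1 + z.2.2), P₂ z.1))

lemma contDiffAt_polar {E : Type*} [NormedAddCommGroup E] [NormedSpace ℝ E] {n : WithTop ℕ∞}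
    {R φ : E → ℝ} {z : E} (hR : ContDiffAt ℝ n R z) (hφ : ContDiffAt ℝ n φ z) :
    ContDiffAt ℝ n (fun z => polar (R z) (φ z)) z :=
  hR.smul (contDiff_circleExp.contDiffAt.comp z hφ)

lemma torusCoordMap_eventuallyEq (h₁ : Continuous P₁) (h₂ : Continuous P₂) (hψ : Continuous ψ)
    {z : ℝ × ℝ × ℝ} (h : TorusOK (P₁ z.1) (P₂ z.1) (ψ z.1)) :
    (fun z => (torusMap P₁ P₂ ψ (torusCoord z)).pt) =ᶠ[𝓝 z] torusCoordMap P₁ P₂ := by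
  have ho : IsOpen {z : ℝ × ℝ × ℝ | TorusOK (P₁ z.1) (P₂ z.1) (ψ z.1)} :=
    (isOpen_torusOK h₁ h₂ hψ).preimage continuous_fst
  filter_upwards [ho.mem_nhds h] with w hw
  rw [pt_torusMap (m := torusCoord w) hw, torusCoord, torusPt_exp, torusCoordMap]

lemma contDiffAt_torusCoordMap (h₁ : ContDiff ℝ ∞ P₁) (h₂ : ContDiff ℝ ∞ P₂) {z : ℝ × ℝ × ℝ}
    (hz₁ : -1 < P₁ z.1 ∧ P₁ z.1 < 1) (hz₂ : -1 < P₂ z.1 ∧ P₂ z.1 < 1) :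
    ContDiffAt ℝ ∞ (torusCoordMap P₁ P₂) z := by
  have c1 : ContDiff ℝ ∞ fun z : ℝ × ℝ × ℝ => P₁ z.1 := h₁.comp contDiff_fst
  have c2 : ContDiff ℝ ∞ fun z : ℝ × ℝ × ℝ => P₂ z.1 := h₂.comp contDiff_fst
  refine ((contDiffAt_polar (ContDiffAt.sqrt (by fun_prop) ?_) (by fun_prop)).prodMk
    c1.contDiffAt).prodMk ((contDiffAt_polar (ContDiffAt.sqrt (by fun_prop) ?_)
      (by fun_prop)).prodMk c2.contDiffAt) <;> nlinarith

lemma contMDiffAt_torusMap (h₁ : ContDiff ℝ ∞ P₁) (h₂ : ContDiff ℝ ∞ P₂) (hψ : Continuous ψ)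
    {z : ℝ × ℝ × ℝ} (h : TorusOK (P₁ z.1) (P₂ z.1) (ψ z.1)) :
    ContMDiffAt 𝓘(ℝ, ℝ × ℝ × ℝ) (𝓡 4) ∞ (torusMap P₁ P₂ ψ ∘ torusCoord) z := by
  refine smooth_of_ambient (contDiffAt_torusCoordMap h₁ h₂ h.fst h.snd)
    (torusCoordMap_eventuallyEq h₁.continuous h₂.continuous hψ h) ?_
  set O := {z : ℝ × ℝ × ℝ | TorusOK (P₁ z.1) (P₂ z.1) (ψ z.1)} with hO
  have ho : IsOpen O :=
    (isOpen_torusOK h₁.continuous h₂.continuous hψ).preimage continuous_fst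
  have hc := h₁.continuous
  have hc' := h₂.continuous
  have hl : ContinuousOn (fun z : ℝ × ℝ × ℝ => lift (ψ z.1) (torusPt (P₁ z.1) (P₂ z.1) 1 1)) O :=
    continuousOn_lift (by fun_prop) (by unfold torusPt; fun_prop) fun z hz => TorusOK.good hz 1 1
  refine (hl.continuousAt (ho.mem_nhds h)).congr ?_
  filter_upwards [ho.mem_nhds h] with w hw
  rw [angle_torusMap (m := torusCoord w) hw, torusCoord]

lemma rates_torusMap (h₁ : ContDiff ℝ ∞ P₁) (h₂ : ContDiff ℝ ∞ P₂) (hψ : Continuous ψ)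
    {z : ℝ × ℝ × ℝ} (h : TorusOK (P₁ z.1) (P₂ z.1) (ψ z.1)) (v : ℝ × ℝ × ℝ) :
    Rates (torusMap P₁ P₂ ψ (torusCoord z)) (coordDeriv torusCoord (torusMap P₁ P₂ ψ) z v)
      (v.1 * deriv P₁ z.1) (v.1 * deriv P₂ z.1) (-(2 * v.2.1 + v.2.2)) (v.2.1 + v.2.2) := by
  have c : HasFDerivAt (fun z : ℝ × ℝ × ℝ => z.1) (ContinuousLinearMap.fst ℝ ℝ (ℝ × ℝ)) z :=
    hasFDerivAt_fst
  have d1 : HasFDerivAt (fun z : ℝ × ℝ × ℝ => P₁ z.1) _ z :=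
    ((h₁.differentiable (by simp)) z.1).hasDerivAt.comp_hasFDerivAt z c
  have d2 : HasFDerivAt (fun z : ℝ × ℝ × ℝ => P₂ z.1) _ z :=
    ((h₂.differentiable (by simp)) z.1).hasDerivAt.comp_hasFDerivAt z c
  let x' := ContinuousLinearMap.fst ℝ ℝ ℝ ∘L ContinuousLinearMap.snd ℝ ℝ (ℝ × ℝ)
  let y' := ContinuousLinearMap.snd ℝ ℝ ℝ ∘L ContinuousLinearMap.snd ℝ ℝ (ℝ × ℝ)
  have f1 : HasFDerivAt (fun z : ℝ × ℝ × ℝ => -(2 * z.2.1 + z.2.2)) (-((2 : ℝ) • x' + y')) z :=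
    (-((2 : ℝ) • x' + y')).hasFDerivAt
  have f2 : HasFDerivAt (fun z : ℝ × ℝ × ℝ => z.2.1 + z.2.2) (x' + y') z := (x' + y').hasFDerivAt
  have n1 : 0 < 1 - P₁ z.1 ^ 2 := by nlinarith [h.fst.1, h.fst.2]
  have n2 : 0 < 1 - P₂ z.1 ^ 2 := by nlinarith [h.snd.1, h.snd.2]
  obtain ⟨D1, e1, g1⟩ := hasFDerivAt_polar (((d1.pow 2).const_sub 1).sqrt n1.ne') f1
  obtain ⟨D2, e2, g2⟩ := hasFDerivAt_polar (((d2.pow 2).const_sub 1).sqrt n2.ne') f2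
  have hD : HasFDerivAt (torusCoordMap P₁ P₂) _ z := (e1.prodMk d1).prodMk (e2.prodMk d2)
  have hd := dpt_coordDeriv (contMDiffAt_torusMap h₁ h₂ hψ h)
    (torusCoordMap_eventuallyEq h₁.continuous h₂.continuous hψ h) hD v
  have hp : (torusMap P₁ P₂ ψ (torusCoord z)).pt = torusCoordMap P₁ P₂ z :=
    (torusCoordMap_eventuallyEq h₁.continuous h₂.continuous hψ h).self_of_nhds
  constructor
  · rw [hd]; simp [mul_comm]
  · rw [hd]; simp [mul_comm]
  · rw [hd, hp]
    refine (g1 v).trans ?_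
    rw [Real.sq_sqrt n1.le]
    simp [torusCoordMap, x', y']
  · rw [hd, hp]
    refine (g2 v).trans ?_
    rw [Real.sq_sqrt n2.le]
    simp [torusCoordMap, x', y']

lemma injective_coordDeriv_torusMap (h₁ : ContDiff ℝ ∞ P₁) (h₂ : ContDiff ℝ ∞ P₂)
    (hψ : Continuous ψ) {z : ℝ × ℝ × ℝ} (h : TorusOK (P₁ z.1) (P₂ z.1) (ψ z.1))
    (hne : deriv P₁ z.1 ≠ 0 ∨ deriv P₂ z.1 ≠ 0) :
    Function.Injective (coordDeriv torusCoord (torusMap P₁ P₂ ψ) z) := by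
  rw [injective_iff_map_eq_zero]
  intro v hv
  have hr := rates_torusMap h₁ h₂ hψ h v
  rw [hv] at hr
  have hf := free_torusMap (m := torusCoord z) h
  have n1 : 1 - (torusMap P₁ P₂ ψ (torusCoord z)).pt.1.2 ^ 2 ≠ 0 := by nlinarith [hf.1.1, hf.1.2]
  have n2 : 1 - (torusMap P₁ P₂ ψ (torusCoord z)).pt.2.2 ^ 2 ≠ 0 := by nlinarith [hf.2.1, hf.2.2]
  obtain ⟨r1, r2, r3, r4⟩ := hr
  rw [map_zero] at r1 r2 r3 r4
  have hz : ∀ c : ℂ, cross c (0 : Amb).1.1 = 0 := fun c => by simp [cross]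
  have hz' : ∀ c : ℂ, cross c (0 : Amb).2.1 = 0 := fun c => by simp [cross]
  rw [hz] at r3
  rw [hz'] at r4
  have q3 := (mul_eq_zero.1 r3.symm).resolve_left n1
  have q4 := (mul_eq_zero.1 r4.symm).resolve_left n2
  have q1 : v.1 = 0 := by
    rcases hne with hne | hne
    · exact (mul_eq_zero.1 r1.symm).resolve_right hne
    · exact (mul_eq_zero.1 r2.symm).resolve_right hne
  exact Prod.ext q1 (Prod.ext (by simp; linarith) (by simp; linarith))

/-- Unimodularity: with `A = X⁻² Y⁻¹` and `B = X Y` one recovers `X = (A B)⁻¹` and `Y = X⁻¹ B`. -/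
lemma torusMap_injective_angles {m m' : ℝ × Circle × Circle}
    (h : TorusOK (P₁ m.1) (P₂ m.1) (ψ m.1)) (ht : m.1 = m'.1)
    (e : torusMap P₁ P₂ ψ m = torusMap P₁ P₂ ψ m') : m = m' := by
  have h' := h
  rw [ht] at h'
  have e' := congrArg pt e
  rw [pt_torusMap h, pt_torusMap h', ← ht] at e'
  have n1 : 0 < 1 - P₁ m.1 ^ 2 := by nlinarith [h.fst.1, h.fst.2]
  have n2 : 0 < 1 - P₂ m.1 ^ 2 := by nlinarith [h.snd.1, h.snd.2]
  have e1 := congrArg (fun x : Amb => x.1.1) e'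
  have e2 := congrArg (fun x : Amb => x.2.1) e'
  simp only [torusPt] at e1 e2
  have e1 := Circle.ext (smul_right_injective ℂ (Real.sqrt_pos.2 n1).ne' e1)
  have e2 := Circle.ext (smul_right_injective ℂ (Real.sqrt_pos.2 n2).ne' e2)
  have k1 : ∀ X Y : Circle, X = (X⁻¹ ^ 2 * Y⁻¹ * (X * Y))⁻¹ := by
    intro X Y
    rw [pow_two, mul_assoc X⁻¹, ← mul_inv X Y, inv_mul_cancel_right, inv_inv]
  have k2 : ∀ X Y : Circle, Y = X⁻¹ * (X * Y) := by intro X Y; group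
  have x1 : m.2.1 = m'.2.1 := by rw [k1 m.2.1 m.2.2, e1, e2, ← k1]
  refine Prod.ext ht (Prod.ext x1 ?_)
  rw [k2 m.2.1 m.2.2, e2, x1, ← k2]

lemma exists_torusMap {y : Chain} {t : ℝ} (h1 : y.pt.1.2 = P₁ t) (h2 : y.pt.2.2 = P₂ t) (h3 : |y.angle - ψ t| < Real.pi / 2) :
    ∃ X Y : Circle, torusMap P₁ P₂ ψ (t, X, Y) = y := by
  obtain ⟨A, hA⟩ := exists_circle y.onSpheres.1
  obtain ⟨B, hB⟩ := exists_circle y.onSpheres.2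
  -- The inverse of `(X, Y) ↦ (X⁻² Y⁻¹, X Y)`.
  refine ⟨(A * B)⁻¹, A * B * B, ?_⟩
  have e1 : ((A * B)⁻¹)⁻¹ ^ 2 * (A * B * B)⁻¹ = A := by
    rw [inv_inv, pow_two, mul_inv, mul_inv, ← mul_inv]
    calc A * B * (A * B) * ((A * B)⁻¹ * B⁻¹) = A * B * B⁻¹ := by
          rw [← mul_assoc, mul_assoc (A * B), mul_inv_cancel, mul_one]
      _ = A := by rw [mul_inv_cancel_right]
  have e2 : (A * B)⁻¹ * (A * B * B) = B := by rw [inv_mul_cancel_left]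
  have e : torusPt (P₁ t) (P₂ t) (A * B)⁻¹ (A * B * B) = y.pt := by
    rw [torusPt, e1, e2, ← h1, ← h2, ← hA, ← hB]
  simp only [torusMap]
  rw [e, mk_pt h3]

end TorusMap

end Chain

namespace Chain

/-! ### Embedded families of tori -/

section TorusFamily

variable {P₁ P₂ ψ : ℝ → ℝ}

lemma lift_torusMap_mem {m : ℝ × Circle × Circle} (h : TorusOK (P₁ m.1) (P₂ m.1) (ψ m.1)) :
    |(torusMap P₁ P₂ ψ m).angle - ψ m.1| < Real.pi / 2 := by
  rw [angle_torusMap h]; exact lift_mem _ _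

lemma fst_height_torusMap {m : ℝ × Circle × Circle} (h : TorusOK (P₁ m.1) (P₂ m.1) (ψ m.1)) :
    (torusMap P₁ P₂ ψ m).pt.1.2 = P₁ m.1 := by rw [pt_torusMap h]; rfl

lemma snd_height_torusMap {m : ℝ × Circle × Circle} (h : TorusOK (P₁ m.1) (P₂ m.1) (ψ m.1)) :
    (torusMap P₁ P₂ ψ m).pt.2.2 = P₂ m.1 := by rw [pt_torusMap h]; rfl

lemma isSmoothEmbeddingOn_torusMap {a b : ℝ} (h₁ : ContDiff ℝ ∞ P₁) (h₂ : ContDiff ℝ ∞ P₂)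
    (hψ : Continuous ψ) (hok : ∀ t ∈ Icc a b, TorusOK (P₁ t) (P₂ t) (ψ t))
    (hne : ∀ t ∈ Icc a b, deriv P₁ t ≠ 0 ∨ deriv P₂ t ≠ 0)
    (hinj : ∀ t ∈ Icc a b, ∀ t' ∈ Icc a b, P₁ t = P₁ t' → P₂ t = P₂ t' →
      |ψ t - ψ t'| < Real.pi → t = t') :
    IsSmoothEmbeddingOn torusCoord (thickTorus a b) (torusMap P₁ P₂ ψ) where
  smooth := ⟨{z : ℝ × ℝ × ℝ | TorusOK (P₁ z.1) (P₂ z.1) (ψ z.1)},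
    (isOpen_torusOK h₁.continuous h₂.continuous hψ).preimage continuous_fst,
    fun z hz => hok z.1 hz, fun _ hz => (contMDiffAt_torusMap h₁ h₂ hψ hz).contMDiffWithinAt⟩
  injOn := by
    intro m hm m' hm' e
    have h := hok _ hm
    have h' := hok _ hm'
    refine torusMap_injective_angles h (hinj _ hm _ hm' ?_ ?_ ?_) e
    · rw [← fst_height_torusMap h, e, fst_height_torusMap h']
    · rw [← snd_height_torusMap h, e, snd_height_torusMap h']
    -- Both approximate angles are within `π / 2` of the common true angle, so they are less than
    -- `π` apart and cannot belong to different turns.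
    · have k := lift_torusMap_mem h
      have k' := lift_torusMap_mem h'
      rw [e] at k
      rw [abs_lt] at k k' ⊢
      constructor <;> linarith [k.1, k.2, k'.1, k'.2]
  immersion z hz := injective_coordDeriv_torusMap h₁ h₂ hψ (hok _ hz) (hne _ hz)

lemma continuousOn_torusMap {s : Set ℝ} (h₁ : Continuous P₁) (h₂ : Continuous P₂)
    (hψ : Continuous ψ) (hok : ∀ t ∈ s, TorusOK (P₁ t) (P₂ t) (ψ t)) :
    ContinuousOn (torusMap P₁ P₂ ψ) {m | m.1 ∈ s} :=
  continuousOn_mk (by fun_prop) (by unfold torusPt; fun_prop) fun m hm => (hok _ hm).good _ _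

lemma continuousOn_lift_torusPt {s : Set ℝ} (h₁ : Continuous P₁) (h₂ : Continuous P₂)
    (hψ : Continuous ψ) (hok : ∀ t ∈ s, TorusOK (P₁ t) (P₂ t) (ψ t)) :
    ContinuousOn (fun t => lift (ψ t) (torusPt (P₁ t) (P₂ t) 1 1)) s :=
  continuousOn_lift (by fun_prop) (by unfold torusPt; fun_prop) fun m hm => (hok _ hm).good _ _

end TorusFamily

lemma fst_height_eq (y : Chain) : y.pt.1.2 = along y.angle y.pt * Real.cos y.angle := by
  have h := y.across_angle
  simp only [along, across] at h ⊢
  linear_combination (-y.pt.1.2) * Real.sin_sq_add_cos_sq y.angle - Real.sin y.angle * h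

lemma snd_height_eq (y : Chain) : y.pt.2.2 = along y.angle y.pt * Real.sin y.angle := by
  have h := y.across_angle
  simp only [along, across] at h ⊢
  linear_combination (-y.pt.2.2) * Real.sin_sq_add_cos_sq y.angle + Real.cos y.angle * h

/-- Points of the bottom hypersurface with equal angles have equal heights. -/
lemma heights_eq_of_bottom {y z : Chain} (hy : bottomFn y = 0) (hz : bottomFn z = 0)
    (h : y.angle = z.angle) : y.pt.1.2 = z.pt.1.2 ∧ y.pt.2.2 = z.pt.2.2 := by
  have a1 := y.along_angle
  have a2 := z.along_angle
  have e1 := fst_height_eq y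
  have e2 := snd_height_eq y
  have e3 := fst_height_eq z
  have e4 := snd_height_eq z
  rw [← h] at e3 e4 a2
  simp only [bottomFn, fstLin, sndLin] at hy hz
  set c := Real.cos y.angle
  set s := Real.sin y.angle
  set ρ := along y.angle y.pt
  set ρ' := along y.angle z.pt
  rw [e1, e2] at hy
  rw [e3, e4] at hz
  have hQ : ((2 * c - s) ^ 2 + (c - s) ^ 2) ≠ 0 := by
    intro h0
    have : ρ ^ 2 * ((2 * c - s) ^ 2 + (c - s) ^ 2) = 1 / 64 := by linarith
    rw [h0] at this
    norm_num at this
  have h3 : ρ ^ 2 = ρ' ^ 2 := by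
    apply mul_right_cancel₀ hQ
    linarith
  have h4 : ρ = ρ' := (sq_eq_sq₀ a1.le a2.le).1 h3
  rw [e1, e2, e3, e4, h4]
  exact ⟨rfl, rfl⟩

/-! ### The bottom -/

/-- The first height along the bottom. -/
def bottomFst (t : ℝ) : ℝ := 1 / 8 * (Real.sin (Real.pi * t) - Real.cos (Real.pi * t))

/-- The second height along the bottom. -/
def bottomSnd (t : ℝ) : ℝ := 1 / 8 * (Real.sin (Real.pi * t) - 2 * Real.cos (Real.pi * t))

/-- An approximation of the angle along the bottom. -/
def bottomAngle (t : ℝ) : ℝ := Real.pi * t - Real.pi / 2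

/-- The parametrization of the bottom. -/
def bottomMap : ℝ × Circle × Circle → Chain := torusMap bottomFst bottomSnd bottomAngle

lemma contDiff_bottomFst : ContDiff ℝ ∞ bottomFst := by unfold bottomFst; fun_prop
lemma contDiff_bottomSnd : ContDiff ℝ ∞ bottomSnd := by unfold bottomSnd; fun_prop
lemma continuous_bottomAngle : Continuous bottomAngle := by unfold bottomAngle; fun_prop

lemma hasDerivAt_sin_pi (t : ℝ) :
    HasDerivAt (fun t => Real.sin (Real.pi * t)) (Real.pi * Real.cos (Real.pi * t)) t := by
  simpa [mul_comm] using ((hasDerivAt_id t).const_mul Real.pi).sin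

lemma hasDerivAt_cos_pi (t : ℝ) :
    HasDerivAt (fun t => Real.cos (Real.pi * t)) (-(Real.pi * Real.sin (Real.pi * t))) t := by
  simpa [mul_comm] using ((hasDerivAt_id t).const_mul Real.pi).cos

lemma deriv_bottomFst (t : ℝ) : deriv bottomFst t =
    Real.pi / 8 * (Real.cos (Real.pi * t) + Real.sin (Real.pi * t)) := by
  have h := (((hasDerivAt_sin_pi t).sub (hasDerivAt_cos_pi t)).const_mul (1 / 8)).deriv
  exact h.trans (by ring)

lemma deriv_bottomSnd (t : ℝ) : deriv bottomSnd t =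
    Real.pi / 8 * (Real.cos (Real.pi * t) + 2 * Real.sin (Real.pi * t)) := by
  have h := (((hasDerivAt_sin_pi t).sub ((hasDerivAt_cos_pi t).const_mul 2)).const_mul
    (1 / 8)).deriv
  exact h.trans (by ring)

lemma bottomFst_bound (t : ℝ) : -(1 / 2) < bottomFst t ∧ bottomFst t < 1 / 2 := by
  unfold bottomFst
  constructor <;> linarith [Real.sin_le_one (Real.pi * t), Real.neg_one_le_sin (Real.pi * t),
    Real.cos_le_one (Real.pi * t), Real.neg_one_le_cos (Real.pi * t)]

lemma bottomSnd_bound (t : ℝ) : -(1 / 2) < bottomSnd t ∧ bottomSnd t < 1 / 2 := by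
  unfold bottomSnd
  constructor <;> linarith [Real.sin_le_one (Real.pi * t), Real.neg_one_le_sin (Real.pi * t),
    Real.cos_le_one (Real.pi * t), Real.neg_one_le_cos (Real.pi * t)]

/-- Write `s = sin (π t)` and `c = cos (π t)`. In the direction `bottomAngle t` the heights have
component `((s - c)² + c²) / 8`, which is positive; so the true angle stays within `π / 2` of this
linear function of `t` through all turns. -/
lemma torusOK_bottom (t : ℝ) : TorusOK (bottomFst t) (bottomSnd t) (bottomAngle t) where
  fst := by have := bottomFst_bound t; constructor <;> linarith [this.1, this.2]
  snd := by have := bottomSnd_bound t; constructor <;> linarith [this.1, this.2]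
  pos := by
    rw [bottomAngle, Real.cos_sub_pi_div_two, Real.sin_sub_pi_div_two, bottomFst, bottomSnd]
    have := Real.sin_sq_add_cos_sq (Real.pi * t)
    set s := Real.sin (Real.pi * t)
    set c := Real.cos (Real.pi * t)
    nlinarith [sq_nonneg (2 * s - 3 * c), sq_nonneg (s - c)]

lemma fstLin_bottomMap (m : ℝ × Circle × Circle) :
    fstLin (bottomMap m).pt = 1 / 8 * Real.sin (Real.pi * m.1) := by
  rw [fstLin, bottomMap, fst_height_torusMap (torusOK_bottom _),
    snd_height_torusMap (torusOK_bottom _), bottomFst, bottomSnd]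
  ring

lemma sndLin_bottomMap (m : ℝ × Circle × Circle) :
    sndLin (bottomMap m).pt = 1 / 8 * Real.cos (Real.pi * m.1) := by
  rw [sndLin, bottomMap, fst_height_torusMap (torusOK_bottom _),
    snd_height_torusMap (torusOK_bottom _), bottomFst, bottomSnd]
  ring

lemma bottomFn_bottomMap (m : ℝ × Circle × Circle) : bottomFn (bottomMap m) = 0 := by
  rw [bottomFn, fstLin_bottomMap, sndLin_bottomMap]
  linear_combination 1 / 64 * Real.sin_sq_add_cos_sq (Real.pi * m.1)

lemma isSmoothEmbeddingOn_bottomMap (a b : ℝ) :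
    IsSmoothEmbeddingOn torusCoord (thickTorus a b) bottomMap := by
  have hpi := Real.pi_pos
  refine isSmoothEmbeddingOn_torusMap contDiff_bottomFst contDiff_bottomSnd
    continuous_bottomAngle (fun t _ => torusOK_bottom t) (fun t _ => ?_)
    (fun t _ t' _ h1 h2 h3 => ?_)
  · rw [deriv_bottomFst, deriv_bottomSnd]
    by_contra! h
    have h1 := (mul_eq_zero.1 h.1).resolve_left (by positivity)
    have h2 := (mul_eq_zero.1 h.2).resolve_left (by positivity)
    have h3 : Real.sin (Real.pi * t) = 0 := by linarith
    have h4 : Real.cos (Real.pi * t) = 0 := by linarith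
    have := Real.sin_sq_add_cos_sq (Real.pi * t)
    rw [h3, h4] at this
    norm_num at this
  · simp only [bottomFst, bottomSnd] at h1 h2
    have hs : Real.sin (Real.pi * t) = Real.sin (Real.pi * t') := by linarith
    have hc : Real.cos (Real.pi * t) = Real.cos (Real.pi * t') := by linarith
    have h4 : Real.cos (Real.pi * t - Real.pi * t') = 1 := by
      rw [Real.cos_sub, hs, hc]
      linear_combination Real.sin_sq_add_cos_sq (Real.pi * t')
    rw [bottomAngle, bottomAngle, abs_lt] at h3
    have h5 := (Real.cos_eq_one_iff_of_lt_of_lt (by linarith) (by linarith)).1 h4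
    apply mul_left_cancel₀ hpi.ne'
    linarith

lemma rates_bottomMap (z v : ℝ × ℝ × ℝ) :
    Rates (bottomMap (torusCoord z)) (coordDeriv torusCoord bottomMap z v)
      (v.1 * deriv bottomFst z.1) (v.1 * deriv bottomSnd z.1) (-(2 * v.2.1 + v.2.2))
      (v.2.1 + v.2.2) :=
  rates_torusMap contDiff_bottomFst contDiff_bottomSnd continuous_bottomAngle
    (torusOK_bottom z.1) v

lemma form_field_bottomMap (z v : ℝ × ℝ × ℝ) :
    form (bottomMap (torusCoord z)) ![field (bottomMap (torusCoord z)),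
      coordDeriv torusCoord bottomMap z v] = 1 / 8 * xiForm z v := by
  rw [(rates_bottomMap z v).form_field (free_of_bottom (bottomFn_bottomMap _)), xiForm]
  have h1 := fstLin_bottomMap (torusCoord z)
  have h2 := sndLin_bottomMap (torusCoord z)
  have e : (torusCoord z).1 = z.1 := rfl
  simp only [fstLin, sndLin, e] at h1 h2
  linear_combination v.2.1 * h1 + v.2.2 * h2

/-- In action-angle coordinates this is a determinant. Only its sign matters: an outward vector
decreases `bottomFn`, so the boundary orientation of the bottom is that of `-M`. -/
lemma omegaSq_bottomMap (z v₁ v₂ v₃ : ℝ × ℝ × ℝ)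
    (n : TangentSpace (𝓡 4) (bottomMap (torusCoord z))) :
    omegaSq form (bottomMap (torusCoord z)) n (coordDeriv torusCoord bottomMap z v₁)
      (coordDeriv torusCoord bottomMap z v₂) (coordDeriv torusCoord bottomMap z v₃) =
      Real.pi / 2 * mvfderiv (𝓡 4) bottomFn (bottomMap (torusCoord z)) n * vol3 v₁ v₂ v₃ := by
  have hf := free_of_bottom (bottomFn_bottomMap (torusCoord z))
  obtain ⟨φ₁, φ₂, hn⟩ := exists_rates hf n
  have h1 := rates_bottomMap z v₁
  have h2 := rates_bottomMap z v₂
  have h3 := rates_bottomMap z v₃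
  rw [omegaSq, hn.form hf h1, hn.form hf h2, hn.form hf h3, h1.form hf h2, h1.form hf h3,
    h2.form hf h3, mvfderiv_bottomFn, fstLin_bottomMap, sndLin_bottomMap, fstLin, sndLin, vol3,
    Matrix.det_fin_three, deriv_bottomFst, deriv_bottomSnd]
  simp [torusCoord]
  ring

/-- Knowing the angle within `π / 2` suffices once `t` is at least `1/2`. For smaller `t` the sign
of `2h₁ - h₂ = sin (π t) / 8` excludes the wrong side of the first ray. -/
lemma firstAngle_le_bottom {m : ℝ × Circle × Circle} (h : 0 ≤ m.1) :
    firstAngle ≤ (bottomMap m).angle := by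
  have hpi := Real.pi_pos
  have k := lift_torusMap_mem (torusOK_bottom m.1) (m := m)
  rw [abs_lt, bottomAngle] at k
  have hf := firstAngle_lt
  have hf' := lt_firstAngle
  rcases le_or_gt (1 / 2) m.1 with h' | h'
  · have : (bottomMap m).angle = (torusMap bottomFst bottomSnd bottomAngle m).angle := rfl
    nlinarith [k.1]
  · by_contra! hc
    obtain ⟨c, hc0, e⟩ := across_firstAngle (bottomMap m).pt
    rw [fstLin_bottomMap, across_eq] at e
    have h1 : 0 ≤ Real.sin (Real.pi * m.1) :=
      Real.sin_nonneg_of_nonneg_of_le_pi (by positivity) (by nlinarith)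
    have h2 : Real.sin ((bottomMap m).angle - firstAngle) < 0 := by
      apply Real.sin_neg_of_neg_of_neg_pi_lt (by linarith)
      have : (bottomMap m).angle = (torusMap bottomFst bottomSnd bottomAngle m).angle := rfl
      nlinarith [k.1]
    have h3 := mul_neg_of_pos_of_neg (bottomMap m).along_angle h2
    have h4 : 0 ≤ c * (1 / 8 * Real.sin (Real.pi * m.1)) := by positivity
    linarith

lemma cos_shift (k : ℕ) (t : ℝ) :
    Real.cos (Real.pi * t) = sgn k * Real.cos (Real.pi * (t - k)) := by
  rw [show Real.pi * t = Real.pi * (t - k) + k * Real.pi by ring, Real.cos_add_nat_mul_pi, sgn]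

lemma sin_shift (k : ℕ) (t : ℝ) :
    Real.sin (Real.pi * t) = sgn k * Real.sin (Real.pi * (t - k)) := by
  rw [show Real.pi * t = Real.pi * (t - k) + k * Real.pi by ring, Real.sin_add_nat_mul_pi, sgn]

/-- As at the first end: the crude bound works for `t ≤ k`, and on the last half unit the sign of
`cos (π (t - k))` decides, after removal of the factor `(-1)^k`. -/
lemma bottom_le_lastAngle {k : ℕ} {m : ℝ × Circle × Circle} (h : m.1 ≤ k + 1 / 2) :
    (bottomMap m).angle ≤ lastAngle k := by
  have hpi := Real.pi_pos
  have k' : |(bottomMap m).angle - bottomAngle m.1| < Real.pi / 2 :=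
    lift_torusMap_mem (torusOK_bottom m.1) (m := m)
  rw [abs_lt, bottomAngle] at k'
  rcases le_or_gt m.1 k with h' | h'
  · unfold lastAngle; nlinarith [k'.2]
  · by_contra! hc
    have e := across_lastAngle k (bottomMap m).pt
    rw [sndLin_bottomMap, across_eq, cos_shift k] at e
    have h1 : 0 ≤ Real.cos (Real.pi * (m.1 - k)) :=
      Real.cos_nonneg_of_mem_Icc ⟨by nlinarith, by nlinarith⟩
    have h2 : 0 < Real.sin ((bottomMap m).angle - lastAngle k) := by
      apply Real.sin_pos_of_pos_of_lt_pi (by linarith)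
      unfold lastAngle
      nlinarith [k'.2]
    have h3 := mul_pos (bottomMap m).along_angle h2
    have h4 : 0 ≤ √2 / 2 * (1 / 8 * Real.cos (Real.pi * (m.1 - k))) := by positivity
    have := sgn_mul_self k
    have h5 : -(√2 / 2) * (sgn k * (1 / 8 * (sgn k * Real.cos (Real.pi * (m.1 - k))))) =
      -(√2 / 2 * (1 / 8 * Real.cos (Real.pi * (m.1 - k)))) := by
      linear_combination (-(√2 / 2 * (1 / 8 * Real.cos (Real.pi * (m.1 - k))))) * this
    linarith

lemma bottomFst_zero : bottomFst 0 = -(1 / 8) := by simp [bottomFst]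
lemma bottomSnd_zero : bottomSnd 0 = -(1 / 4) := by simp [bottomSnd]; norm_num

lemma sin_cos_last (k : ℕ) : Real.sin (Real.pi * (k + 1 / 2)) = sgn k ∧
    Real.cos (Real.pi * (k + 1 / 2)) = 0 := by
  rw [sin_shift k, cos_shift k, add_sub_cancel_left, mul_one_div, Real.sin_pi_div_two,
    Real.cos_pi_div_two]
  simp

lemma bottomFst_last (k : ℕ) : bottomFst (k + 1 / 2) = 1 / 8 * sgn k := by
  rw [bottomFst, (sin_cos_last k).1, (sin_cos_last k).2]; ring

lemma bottomSnd_last (k : ℕ) : bottomSnd (k + 1 / 2) = 1 / 8 * sgn k := by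
  rw [bottomSnd, (sin_cos_last k).1, (sin_cos_last k).2]; ring

/-- The angle of the first side in terms of heights. -/
lemma lift_firstAngle {x : Amb} (h : fstLin x = 0) (h' : x.2.2 < 0) :
    lift (-(Real.pi / 2)) x = firstAngle := by
  obtain ⟨c, hc, e⟩ := across_firstAngle x
  refine lift_eq ?_ (by rw [e, h, mul_zero]) ?_
  · have hC := Real.cos_arctan_pos (1 / 2)
    have hs : Real.sin (Real.arctan (1 / 2)) = Real.cos (Real.arctan (1 / 2)) / 2 := by
      rw [Real.sin_arctan, Real.cos_arctan]; ring
    have e : firstAngle = -(Real.arctan (1 / 2) + Real.pi / 2) := by unfold firstAngle; ring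
    rw [along, e, Real.cos_neg, Real.sin_neg, Real.cos_add_pi_div_two, Real.sin_add_pi_div_two, hs]
    simp only [fstLin] at h
    nlinarith
  · have := arctan_half_pos
    have := Real.arctan_lt_pi_div_two (1 / 2)
    rw [firstAngle, abs_lt]
    constructor <;> linarith

/-- The angle of the last side in terms of heights. -/
lemma lift_lastAngle {k : ℕ} {x : Amb} (h : x.1.2 = x.2.2) (h' : 0 < sgn k * x.1.2) :
    lift (k * Real.pi) x = lastAngle k := by
  have hpi := Real.pi_pos
  refine lift_eq ?_ ?_ ?_
  · rw [along, lastAngle, add_comm (k * Real.pi), Real.cos_add_nat_mul_pi, Real.sin_add_nat_mul_pi,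
      Real.cos_pi_div_four, Real.sin_pi_div_four, ← h]
    have : 0 < √2 * (sgn k * x.1.2) := by positivity
    unfold sgn at this
    linarith
  · rw [across_lastAngle, sndLin, h]; ring
  · rw [lastAngle, add_sub_cancel_left, abs_of_pos] <;> linarith

/-- The angle runs continuously from `firstAngle` to `lastAngle k`, so by the intermediate value
theorem it takes each value between; and a ray meets the ellipse only once, so the angle determines
the heights. -/
lemma bottom_image {k : ℕ} :
    bottomMap '' thickTorus 0 (k + 1 / 2) = faceSet k Face.bottom := by
  have hpi := Real.pi_pos
  ext y
  constructor
  · rintro ⟨m, hm, rfl⟩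
    have h0 := bottomFn_bottomMap m
    refine ⟨⟨h0.ge, firstAngle_le_bottom hm.1, bottom_le_lastAngle hm.2, Or.inr ?_, Or.inr ?_⟩, h0⟩
    · rw [bottomMap, snd_height_torusMap (torusOK_bottom _)]
      exact (bottomSnd_bound _).1.le
    · rw [bottomMap, fst_height_torusMap (torusOK_bottom _)]
      have := bottomFst_bound m.1
      rcases sgn_cases k with h | h <;> rw [h] <;> linarith [this.1, this.2]
  · rintro ⟨hy, h0⟩
    have hc := continuousOn_lift_torusPt (s := Icc (0 : ℝ) (k + 1 / 2))
      contDiff_bottomFst.continuous contDiff_bottomSnd.continuous continuous_bottomAngle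
      fun t _ => torusOK_bottom t
    have e0 : lift (bottomAngle 0) (torusPt (bottomFst 0) (bottomSnd 0) 1 1) = firstAngle := by
      rw [bottomAngle, mul_zero, zero_sub]
      refine lift_firstAngle ?_ ?_
      · simp only [fstLin, torusPt, bottomFst_zero, bottomSnd_zero]; norm_num
      · simp only [torusPt, bottomSnd_zero]; norm_num
    have e1 : lift (bottomAngle (k + 1 / 2))
        (torusPt (bottomFst (k + 1 / 2)) (bottomSnd (k + 1 / 2)) 1 1) = lastAngle k := by
      rw [bottomAngle, show Real.pi * (k + 1 / 2) - Real.pi / 2 = k * Real.pi by ring]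
      refine lift_lastAngle ?_ ?_
      · simp only [torusPt, bottomFst_last, bottomSnd_last]
      · simp only [torusPt, bottomFst_last]
        linarith [sgn_mul_self k]
    obtain ⟨t, ht, e⟩ := intermediate_value_Icc (by positivity) hc
      (show y.angle ∈ _ by simp only [e0, e1]; exact ⟨hy.2.1, hy.2.2.1⟩)
    have h1 : (bottomMap (t, 1, 1)).angle = y.angle := by
      rw [bottomMap, angle_torusMap (torusOK_bottom _)]; exact e
    have h2 := heights_eq_of_bottom h0 (bottomFn_bottomMap (t, 1, 1)) h1.symm
    rw [bottomMap, fst_height_torusMap (torusOK_bottom _),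
      snd_height_torusMap (torusOK_bottom _)] at h2
    obtain ⟨X, Z, h3⟩ := exists_torusMap (ψ := bottomAngle) h2.1 h2.2
      (by rw [← e]; exact lift_mem _ _)
    exact ⟨(t, X, Z), ht, h3⟩

/-! ### The sides -/

/-- The first height along the first side. -/
def firstSideFst (s : ℝ) : ℝ := -(1 / 8) * (1 + s)

/-- The second height along the first side. -/
def firstSideSnd (s : ℝ) : ℝ := -(1 / 4) * (1 + s)

/-- The heights along the last side. -/
def lastSideHeight (k : ℕ) (s : ℝ) : ℝ := sgn k * (1 / 8 * (1 + 3 * s))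

/-- The parametrizations of the two sides. -/
def sideMap (k : ℕ) : Fin 2 → ℝ × Circle × Circle → Chain :=
  ![torusMap firstSideFst firstSideSnd fun _ => -(Real.pi / 2),
    torusMap (lastSideHeight k) (lastSideHeight k) fun _ => k * Real.pi]

lemma sideMap_zero (k : ℕ) :
    sideMap k 0 = torusMap firstSideFst firstSideSnd fun _ => -(Real.pi / 2) := rfl

lemma sideMap_one (k : ℕ) :
    sideMap k 1 = torusMap (lastSideHeight k) (lastSideHeight k) fun _ => k * Real.pi := rfl

lemma contDiff_firstSideFst : ContDiff ℝ ∞ firstSideFst := by unfold firstSideFst; fun_prop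
lemma contDiff_firstSideSnd : ContDiff ℝ ∞ firstSideSnd := by unfold firstSideSnd; fun_prop
lemma contDiff_lastSideHeight (k : ℕ) : ContDiff ℝ ∞ (lastSideHeight k) := by
  unfold lastSideHeight; fun_prop

lemma deriv_firstSideFst (s : ℝ) : deriv firstSideFst s = -(1 / 8) := by
  have h := (((hasDerivAt_id s).const_add 1).const_mul (-(1 / 8) : ℝ)).deriv
  exact h.trans (by ring)

lemma deriv_lastSideHeight (k : ℕ) (s : ℝ) : deriv (lastSideHeight k) s = sgn k * (3 / 8) := by
  have h := (((((hasDerivAt_id s).const_mul 3).const_add 1).const_mul (1 / 8 : ℝ)).const_mul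
    (sgn k)).deriv
  exact h.trans (by ring)

lemma torusOK_first {s : ℝ} (h : s ∈ Icc (0 : ℝ) 1) :
    TorusOK (firstSideFst s) (firstSideSnd s) (-(Real.pi / 2)) where
  fst := by unfold firstSideFst; constructor <;> linarith [h.1, h.2]
  snd := by unfold firstSideSnd; constructor <;> linarith [h.1, h.2]
  pos := by simp [firstSideSnd]; linarith [h.1]

lemma torusOK_last {k : ℕ} {s : ℝ} (h : s ∈ Icc (0 : ℝ) 1) :
    TorusOK (lastSideHeight k s) (lastSideHeight k s) (k * Real.pi) where
  fst := by
    unfold lastSideHeight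
    rcases sgn_cases k with h' | h' <;> rw [h'] <;> constructor <;> linarith [h.1, h.2]
  snd := by
    unfold lastSideHeight
    rcases sgn_cases k with h' | h' <;> rw [h'] <;> constructor <;> linarith [h.1, h.2]
  pos := by
    rw [Real.cos_nat_mul_pi, Real.sin_nat_mul_pi, lastSideHeight]
    have h2 : (-1 : ℝ) ^ k = sgn k := rfl
    rw [h2]
    have : sgn k * (1 / 8 * (1 + 3 * s)) * sgn k = 1 / 8 * (1 + 3 * s) := by
      linear_combination (1 / 8 * (1 + 3 * s)) * sgn_mul_self k
    rw [this]
    linarith [h.1]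

lemma sgn_ne_zero (k : ℕ) : sgn k ≠ 0 := by
  rcases sgn_cases k with h | h <;> rw [h] <;> norm_num

lemma isSmoothEmbeddingOn_sideMap (k : ℕ) (i : Fin 2) :
    IsSmoothEmbeddingOn torusCoord (thickTorus 0 1) (sideMap k i) := by
  rcases Fin.exists_fin_two.1 ⟨i, rfl⟩ with h | h <;> rw [h]
  · rw [sideMap_zero]
    refine isSmoothEmbeddingOn_torusMap contDiff_firstSideFst contDiff_firstSideSnd
      continuous_const (fun t ht => torusOK_first ht) (fun t _ => Or.inl ?_)
      (fun t _ t' _ h1 _ _ => by unfold firstSideFst at h1; linarith)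
    rw [deriv_firstSideFst]; norm_num
  · rw [sideMap_one]
    refine isSmoothEmbeddingOn_torusMap (contDiff_lastSideHeight k) (contDiff_lastSideHeight k)
      continuous_const (fun t ht => torusOK_last ht) (fun t _ => Or.inl ?_)
      (fun t _ t' _ h1 _ _ => ?_)
    · rw [deriv_lastSideHeight]
      exact mul_ne_zero (sgn_ne_zero k) (by norm_num)
    · have := mul_left_cancel₀ (sgn_ne_zero k) h1
      linarith

lemma heights_side_first {k : ℕ} {m : ℝ × Circle × Circle} (h : m.1 ∈ Icc (0 : ℝ) 1) :
    (sideMap k 0 m).pt.1.2 = -(1 / 8) * (1 + m.1) ∧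
      (sideMap k 0 m).pt.2.2 = -(1 / 4) * (1 + m.1) := by
  rw [sideMap_zero, pt_torusMap (torusOK_first h)]
  exact ⟨rfl, rfl⟩

lemma heights_side_last {k : ℕ} {m : ℝ × Circle × Circle} (h : m.1 ∈ Icc (0 : ℝ) 1) :
    (sideMap k 1 m).pt.1.2 = sgn k * (1 / 8 * (1 + 3 * m.1)) ∧
      (sideMap k 1 m).pt.2.2 = sgn k * (1 / 8 * (1 + 3 * m.1)) := by
  rw [sideMap_one, pt_torusMap (torusOK_last h)]
  exact ⟨rfl, rfl⟩

lemma angle_side_first {k : ℕ} {m : ℝ × Circle × Circle} (h : m.1 ∈ Icc (0 : ℝ) 1) :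
    (sideMap k 0 m).angle = firstAngle := by
  rw [sideMap_zero, angle_torusMap (torusOK_first h)]
  refine lift_firstAngle ?_ ?_
  · simp only [fstLin, torusPt, firstSideFst, firstSideSnd]; ring
  · simp only [torusPt, firstSideSnd]; linarith [h.1]

lemma angle_side_last {k : ℕ} {m : ℝ × Circle × Circle} (h : m.1 ∈ Icc (0 : ℝ) 1) :
    (sideMap k 1 m).angle = lastAngle k := by
  rw [sideMap_one, angle_torusMap (torusOK_last h)]
  refine lift_lastAngle rfl ?_
  simp only [torusPt, lastSideHeight]
  have : sgn k * (sgn k * (1 / 8 * (1 + 3 * m.1))) = 1 / 8 * (1 + 3 * m.1) := by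
    linear_combination (1 / 8 * (1 + 3 * m.1)) * sgn_mul_self k
  rw [this]
  linarith [h.1]

lemma fstLin_of_firstAngle {y : Chain} (h : y.angle = firstAngle) : fstLin y.pt = 0 := by
  obtain ⟨c, hc, e⟩ := across_firstAngle y.pt
  rw [← h, y.across_angle] at e
  exact (mul_eq_zero.1 e.symm).resolve_left hc.ne'

lemma sndLin_of_lastAngle {k : ℕ} {y : Chain} (h : y.angle = lastAngle k) : sndLin y.pt = 0 := by
  have e := across_lastAngle k y.pt
  rw [← h, y.across_angle] at e
  have h2 : -(√2 / 2) ≠ 0 := by simp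
  have hs : sgn k ≠ 0 := by rcases sgn_cases k with h | h <;> rw [h] <;> norm_num
  exact ((mul_eq_zero.1 ((mul_eq_zero.1 e.symm).resolve_left h2))).resolve_left hs

lemma side_image_first {k : ℕ} (hk : 1 < k) :
    sideMap k 0 '' thickTorus 0 1 = {y | y ∈ domain k ∧ y.angle = firstAngle} := by
  have hpi := Real.pi_pos
  have h1 := coreAngle_pos hk
  have h2 := lastAngle_eq k
  have h3 := firstAngle_lt
  ext y
  constructor
  · rintro ⟨m, hm, rfl⟩
    have ha := angle_side_first (k := k) hm
    have hm' : m.1 ∈ Icc (0 : ℝ) 1 := hm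
    obtain ⟨p1, p2⟩ := heights_side_first (k := k) hm'
    refine ⟨⟨?_, ha.ge, ?_, Or.inr ?_, Or.inl ?_⟩, ha⟩
    · rw [bottomFn, fstLin, sndLin, p1, p2]
      nlinarith [hm'.1, hm'.2]
    · rw [ha]; linarith
    · rw [p2]; linarith [hm'.2]
    · rw [ha]; linarith
  · rintro ⟨hy, ha⟩
    have hf := fstLin_of_firstAngle ha
    have hb := hy.1
    have ht : -(1 / 2) ≤ y.pt.2.2 := hy.2.2.2.1.resolve_left (by linarith)
    have hneg : y.pt.2.2 < 0 := by
      rw [snd_height_eq]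
      exact mul_neg_of_pos_of_neg y.along_angle
        (Real.sin_neg_of_neg_of_neg_pi_lt (by linarith) (by rw [ha]; exact lt_firstAngle))
    simp only [bottomFn, fstLin, sndLin] at hf hb
    have hp : y.pt.2.2 = 2 * y.pt.1.2 := by linarith
    -- The parameter solves `firstSideFst t = h₁`; the bottom and top inequalities then become `0 ≤
    -- t` and `t ≤ 1`.
    obtain ⟨X, Z, e⟩ := exists_torusMap (y := y) (t := -8 * y.pt.1.2 - 1)
      (P₁ := firstSideFst) (P₂ := firstSideSnd)
      (ψ := fun _ => -(Real.pi / 2)) (by unfold firstSideFst; ring)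
      (by unfold firstSideSnd; rw [hp]; ring) (by
        have := arctan_half_pos
        have := Real.arctan_lt_pi_div_two (1 / 2)
        rw [ha, firstAngle, abs_lt]
        constructor <;> linarith)
    refine ⟨_, ⟨?_, ?_⟩, e⟩
    · change 0 ≤ -8 * y.pt.1.2 - 1
      nlinarith
    · change -8 * y.pt.1.2 - 1 ≤ 1
      linarith

lemma side_image_last {k : ℕ} (hk : 1 < k) :
    sideMap k 1 '' thickTorus 0 1 = {y | y ∈ domain k ∧ y.angle = lastAngle k} := by
  have hpi := Real.pi_pos
  have h1 := coreAngle_pos hk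
  have h2 := lastAngle_eq k
  have h3 := firstAngle_lt
  have hss := sgn_mul_self k
  ext y
  constructor
  · rintro ⟨m, hm, rfl⟩
    have ha := angle_side_last (k := k) hm
    have hm' : m.1 ∈ Icc (0 : ℝ) 1 := hm
    obtain ⟨p1, p2⟩ := heights_side_last (k := k) hm'
    refine ⟨⟨?_, ?_, ha.le, Or.inl ?_, Or.inr ?_⟩, ha⟩
    · rw [bottomFn, fstLin, sndLin, p1, p2]
      rcases sgn_cases k with h | h <;> rw [h] <;> nlinarith [hm'.1, hm'.2]
    · rw [ha]; linarith
    · rw [ha]; linarith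
    · rw [p1, ← mul_assoc, hss]; linarith [hm'.2]
  · rintro ⟨hy, ha⟩
    have hf := sndLin_of_lastAngle ha
    have hb := hy.1
    have ht : sgn k * y.pt.1.2 ≤ 1 / 2 := hy.2.2.2.2.resolve_left (by linarith)
    have hpos : 0 < sgn k * y.pt.1.2 := by
      rw [← across_coreAngle, across_eq]
      exact mul_pos y.along_angle (Real.sin_pos_of_pos_of_lt_pi (by linarith) (by linarith))
    simp only [bottomFn, fstLin, sndLin] at hf hb
    have hp : y.pt.2.2 = y.pt.1.2 := by linarith
    have hq : y.pt.1.2 = sgn k * (sgn k * y.pt.1.2) := by rw [← mul_assoc, hss, one_mul]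
    have hsq : (sgn k * y.pt.1.2) ^ 2 = y.pt.1.2 ^ 2 := by
      linear_combination y.pt.1.2 ^ 2 * hss
    obtain ⟨X, Z, e⟩ := exists_torusMap (y := y) (t := (8 * (sgn k * y.pt.1.2) - 1) / 3)
      (P₁ := lastSideHeight k) (P₂ := lastSideHeight k)
      (ψ := fun _ => k * Real.pi) (by unfold lastSideHeight; linear_combination hq)
      (by unfold lastSideHeight; linear_combination hq + hp) (by
        rw [ha, lastAngle, add_sub_cancel_left, abs_of_pos] <;> linarith)
    refine ⟨_, ⟨?_, ?_⟩, e⟩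
    · change 0 ≤ (8 * (sgn k * y.pt.1.2) - 1) / 3
      rw [hp] at hb
      nlinarith
    · change (8 * (sgn k * y.pt.1.2) - 1) / 3 ≤ 1
      linarith

lemma side_image {k : ℕ} (hk : 1 < k) :
    ⋃ i, sideMap k i '' thickTorus 0 1 = faceSet k Face.side := by
  ext y
  simp only [mem_iUnion, Fin.exists_fin_two, side_image_first hk, side_image_last hk]
  exact and_or_left.symm

lemma side_disjoint {k : ℕ} (hk : 1 < k) :
    Disjoint (sideMap k 0 '' thickTorus 0 1) (sideMap k 1 '' thickTorus 0 1) := by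
  rw [side_image_first hk, side_image_last hk, Set.disjoint_left]
  rintro y ⟨_, h⟩ ⟨_, h'⟩
  linarith [coreAngle_pos hk, lastAngle_eq k, firstAngle_lt, Real.pi_pos]

lemma torusMap_congr {P₁ P₂ ψ Q₁ Q₂ φ : ℝ → ℝ} {s t : ℝ} (X Z : Circle) (h1 : P₁ s = Q₁ t)
    (h2 : P₂ s = Q₂ t) (h3 : ψ s = φ t) :
    torusMap P₁ P₂ ψ (s, X, Z) = torusMap Q₁ Q₂ φ (t, X, Z) := by
  simp only [torusMap, h1, h2, h3]

lemma side_bottom_first (k : ℕ) (X Z : Circle) : sideMap k 0 (0, X, Z) = bottomMap (0, X, Z) := by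
  rw [sideMap_zero, bottomMap]
  exact torusMap_congr X Z (by rw [bottomFst_zero, firstSideFst]; norm_num)
    (by rw [bottomSnd_zero, firstSideSnd]; norm_num) (by rw [bottomAngle]; ring)

lemma side_bottom_last (k : ℕ) (X Z : Circle) :
    sideMap k 1 (0, X, Z) = bottomMap (k + 1 / 2, X, Z) := by
  rw [sideMap_one, bottomMap]
  exact torusMap_congr X Z (by rw [bottomFst_last, lastSideHeight]; ring)
    (by rw [bottomSnd_last, lastSideHeight]; ring) (by rw [bottomAngle]; ring)

/-! ### Connectedness -/

lemma isPreconnected_bottom (k : ℕ) : IsPreconnected (faceSet k Face.bottom) := by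
  rw [← bottom_image]
  refine IsPreconnected.image ?_ _ (continuousOn_torusMap contDiff_bottomFst.continuous
    contDiff_bottomSnd.continuous continuous_bottomAngle fun t _ => torusOK_bottom t)
  have e : thickTorus 0 (k + 1 / 2) = Icc (0 : ℝ) (k + 1 / 2) ×ˢ (univ : Set (Circle × Circle)) := by
    ext m; simp [thickTorus]
  rw [e]
  have hC : PreconnectedSpace Circle := by
    refine ⟨?_⟩
    have h : range (Circle.exp : ℝ → Circle) = univ := Circle.exp_surjective.range_eq
    rw [← h]
    exact isPreconnected_range Circle.exp.continuous
  exact isPreconnected_Icc.prod isPreconnected_univ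

/-- Shrinking the heights connects a point of the domain to the bottom. -/
lemma exists_path_to_bottom {k : ℕ} {y : Chain} (hy : y ∈ domain k) :
    ∃ t ⊆ domain k, y ∈ t ∧ IsPreconnected t ∧ (t ∩ faceSet k Face.bottom).Nonempty := by
  obtain ⟨A, hA⟩ := exists_circle y.onSpheres.1
  obtain ⟨B, hB⟩ := exists_circle y.onSpheres.2
  set p := y.pt.1.2 with hp
  set q := y.pt.2.2 with hq
  set Q := fstLin y.pt ^ 2 + sndLin y.pt ^ 2 with hQ
  have hQ1 : 1 / 64 ≤ Q := by have := hy.1; unfold bottomFn at this; linarith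
  have hQ0 : 0 < √Q := Real.sqrt_pos.2 (by linarith)
  have hQs : √Q ^ 2 = Q := Real.sq_sqrt (by linarith)
  have hQ8 : 1 / 8 ≤ √Q := by
    apply Real.le_sqrt_of_sq_le; linarith
  -- Scaling the heights by `s₀` brings the quadratic form to `1/64`, i.e. takes the point to the
  -- bottom.
  set s₀ := 1 / 8 / √Q with hs0
  have h0 : 0 < s₀ := by positivity
  have h1 : s₀ ≤ 1 := by rw [hs0, div_le_one hQ0]; exact hQ8
  have h2 : s₀ ^ 2 * Q = 1 / 64 := by
    rw [hs0, div_pow, hQs]; field_simp; norm_num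
  let f : ℝ → Amb := fun s =>
    ((√(1 - (s * p) ^ 2) • (A : ℂ), s * p), (√(1 - (s * q) ^ 2) • (B : ℂ), s * q))
  have hpa := y.onSpheres.1.abs_le
  have hqa := y.onSpheres.2.abs_le
  have hsq : ∀ s ∈ Icc s₀ 1, ∀ r : ℝ, -1 ≤ r → r ≤ 1 → (s * r) ^ 2 ≤ 1 := by
    intro s hs r hr hr'
    have : s ^ 2 ≤ 1 := by nlinarith [hs.1, hs.2]
    rw [mul_pow]
    nlinarith [sq_nonneg s, sq_nonneg r]
  have hal : ∀ s, along y.angle (f s) = s * along y.angle y.pt := fun s => by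
    simp only [along, f]; ring
  have hac : ∀ s, across y.angle (f s) = 0 := fun s => by
    have := y.across_angle
    simp only [across, f] at this ⊢
    linear_combination s * this
  have hgood : ∀ s ∈ Icc s₀ 1, Good y.angle (f s) := fun s hs =>
    ⟨⟨onSphere_circle (hsq s hs _ hpa.1 hpa.2) A, onSphere_circle (hsq s hs _ hqa.1 hqa.2) B⟩,
      by rw [hal]; exact mul_pos (h0.trans_le hs.1) y.along_angle⟩
  have hang : ∀ s ∈ Icc s₀ 1, (mk y.angle (f s)).angle = y.angle := fun s hs => by
    rw [angle_mk (hgood s hs)]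
    exact lift_eq (hgood s hs).2 (hac s) (by simpa using Real.pi_pos)
  have hbot : ∀ s ∈ Icc s₀ 1, bottomFn (mk y.angle (f s)) = s ^ 2 * Q - 1 / 64 := fun s hs => by
    rw [bottomFn, pt_mk (hgood s hs), hQ]
    simp only [fstLin, sndLin, f]
    ring
  have hc : ContinuousOn (fun s => mk y.angle (f s)) (Icc s₀ 1) :=
    continuousOn_mk continuousOn_const (by simp only [f]; fun_prop) hgood
  -- Scaling by a factor in `(0, 1]` keeps the angle, and moves the truncating heights towards zero,
  -- so all conditions except the one at the bottom persist trivially.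
  have hdom : ∀ s ∈ Icc s₀ 1, mk y.angle (f s) ∈ domain k := by
    intro s hs
    have hs1 := hs.2
    have hs0 := h0.trans_le hs.1
    refine ⟨?_, ?_, ?_, ?_, ?_⟩
    · rw [hbot s hs, ← h2]
      have : s₀ ^ 2 ≤ s ^ 2 := by nlinarith [hs.1]
      nlinarith
    · rw [hang s hs]; exact hy.2.1
    · rw [hang s hs]; exact hy.2.2.1
    · rw [hang s hs, pt_mk (hgood s hs)]
      refine hy.2.2.2.1.imp id fun h => ?_
      simp only [f]
      nlinarith
    · rw [hang s hs, pt_mk (hgood s hs)]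
      refine hy.2.2.2.2.imp id fun h => ?_
      simp only [f]
      nlinarith
  refine ⟨(fun s => mk y.angle (f s)) '' Icc s₀ 1, ?_, ⟨1, ⟨h1, le_rfl⟩, ?_⟩,
    isPreconnected_Icc.image _ hc, ⟨mk y.angle (f s₀), ⟨s₀, ⟨le_rfl, h1⟩, rfl⟩,
    hdom s₀ ⟨le_rfl, h1⟩, ?_⟩⟩
  · rintro _ ⟨s, hs, rfl⟩
    exact hdom s hs
  · have : f 1 = y.pt := by
      simp only [f, one_mul]
      rw [hp, hq, ← hA, ← hB]
    simp only [this]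
    exact mk_pt (by simpa using Real.pi_pos)
  · rw [hbot s₀ ⟨le_rfl, h1⟩, h2, sub_self]

lemma isConnected_domain (k : ℕ) : IsConnected (domain k) := by
  have hb : bottomMap (0, 1, 1) ∈ faceSet k Face.bottom := by
    rw [← bottom_image]
    exact ⟨_, ⟨le_rfl, by positivity⟩, rfl⟩
  refine ⟨⟨_, hb.1⟩, isPreconnected_of_forall (bottomMap (0, 1, 1)) fun y hy => ?_⟩
  obtain ⟨t, ht, hyt, hp, z, hz, hz'⟩ := exists_path_to_bottom hy
  exact ⟨faceSet k Face.bottom ∪ t, union_subset (fun z hz => hz.1) ht, Or.inl hb, Or.inr hyt,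
    (isPreconnected_bottom k).union z hz' hz hp⟩

end Chain

/-! ### The profile of the top -/

/-- The function `cos (π p) + m sin (π p)`. -/
def den (m : ℕ) (p : ℝ) : ℝ := Real.cos (Real.pi * p) + m * Real.sin (Real.pi * p)

/-- The profile for which the Liouville field induces the standard structure. -/
def outer (m : ℕ) (p : ℝ) : ℝ := -(1 / 2) * Real.sin (Real.pi * p) / den m p

/-- A cutoff that is zero near the core and one near the boundary. -/
def cut (p : ℝ) : ℝ := Real.smoothTransition (4 * p - 1 / 2)

/-- The height of the top as a function of the toric coordinate. -/
def prof (m : ℕ) (p : ℝ) : ℝ := (1 - cut p) * (1 - p) + cut p * outer m p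

/-- The square of the stretching factor of the planar coordinate. -/
def stretch (m : ℕ) (p : ℝ) : ℝ := 1 + cut p * ((1 - outer m p) / p - 1)

/-- The range of the toric coordinate in which the top extends. -/
structure ProfOK (m : ℕ) (p : ℝ) : Prop where
  nonneg : 0 ≤ p
  lt_one : p < 1
  pos : 0 < Real.cos (Real.pi * p) + (m - 1 / 2) * Real.sin (Real.pi * p)

lemma cut_of_le {p : ℝ} (h : p ≤ 1 / 8) : cut p = 0 :=
  Real.smoothTransition.zero_of_nonpos (by linarith)

lemma cut_of_ge {p : ℝ} (h : 3 / 8 ≤ p) : cut p = 1 :=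
  Real.smoothTransition.one_of_one_le (by linarith)

lemma cut_nonneg (p : ℝ) : 0 ≤ cut p := Real.smoothTransition.nonneg _
lemma cut_le_one (p : ℝ) : cut p ≤ 1 := Real.smoothTransition.le_one _

lemma contDiff_cut : ContDiff ℝ ∞ cut :=
  Real.smoothTransition.contDiff.comp (f := fun p : ℝ => 4 * p - 1 / 2) (by fun_prop)

lemma cut_monotone : Monotone cut := fun p q h =>
  Real.smoothTransition.monotone (by linarith)

/-- A planar coordinate stretched by `√(stretch m p)` has Lambert height `prof m p`. Writing
`stretch` with the cutoff in front of the quotient by `p` makes it smooth at the core, where the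
cutoff vanishes identically. -/
lemma mul_stretch (m : ℕ) (p : ℝ) : p * stretch m p = 1 - prof m p := by
  by_cases h : p = 0
  · simp [h, prof, cut_of_le (show (0 : ℝ) ≤ 1 / 8 by norm_num)]
  · unfold stretch prof
    field_simp
    ring

namespace ProfOK

variable {m : ℕ} {p : ℝ}

lemma sin_nonneg (h : ProfOK m p) : 0 ≤ Real.sin (Real.pi * p) :=
  Real.sin_nonneg_of_nonneg_of_le_pi (mul_nonneg Real.pi_pos.le h.nonneg)
    (by nlinarith [Real.pi_pos, h.lt_one])

lemma den_pos (h : ProfOK m p) : 0 < den m p := by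
  have := h.sin_nonneg
  have := h.pos
  unfold den
  linarith

lemma outer_nonpos (h : ProfOK m p) : outer m p ≤ 0 :=
  div_nonpos_of_nonpos_of_nonneg (by linarith [h.sin_nonneg]) h.den_pos.le

/-- After clearing the denominator this is exactly the `pos` field of `ProfOK`. That condition is
open apart from `0 ≤ p`, so the parametrization extends smoothly past `p = 1/2`. -/
lemma lt_outer (h : ProfOK m p) : -1 < outer m p := by
  have := h.pos
  rw [outer, lt_div_iff₀ h.den_pos, den]
  linarith

lemma lt_prof (h : ProfOK m p) : -1 < prof m p := by
  have h1 := cut_nonneg p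
  have h2 := cut_le_one p
  have h3 := h.lt_outer
  have h4 := h.lt_one
  have h5 : 0 ≤ cut p * (1 + outer m p) := mul_nonneg h1 (by linarith)
  unfold prof
  rcases h2.lt_or_eq with h2 | h2
  · nlinarith [mul_pos (sub_pos.2 h2) (show 0 < 2 - p by linarith)]
  · rw [h2]; linarith

lemma stretch_pos (h : ProfOK m p) : 0 < stretch m p := by
  rcases le_or_gt p (1 / 8) with hp | hp
  · simp [stretch, cut_of_le hp]
  · have h1 := cut_nonneg p
    have h2 := cut_le_one p
    have h3 : 0 < (1 - outer m p) / p := div_pos (by linarith [h.outer_nonpos]) (by linarith)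
    unfold stretch
    rcases h1.lt_or_eq with h1 | h1
    · nlinarith
    · rw [← h1]; norm_num

lemma contDiffAt_outer (h : ProfOK m p) : ContDiffAt ℝ ∞ (outer m) p := by
  have hd := h.den_pos.ne'
  unfold outer
  refine ContDiffAt.div (by fun_prop) ?_ hd
  unfold den; fun_prop

lemma contDiffAt_prof (h : ProfOK m p) : ContDiffAt ℝ ∞ (prof m) p := by
  have h1 := h.contDiffAt_outer
  have h2 := contDiff_cut.contDiffAt (x := p)
  unfold prof
  fun_prop

lemma contDiffAt_stretch (h : ProfOK m p) : ContDiffAt ℝ ∞ (stretch m) p := by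
  rcases lt_or_ge p (1 / 8) with hp | hp
  · refine (contDiffAt_const (c := (1 : ℝ))).congr_of_eventuallyEq ?_
    filter_upwards [gt_mem_nhds hp] with q hq
    simp [stretch, cut_of_le hq.le]
  · have h1 := h.contDiffAt_outer
    have h2 := contDiff_cut.contDiffAt (x := p)
    have h3 : p ≠ 0 := by linarith
    unfold stretch
    exact contDiffAt_const.add (h2.mul (((contDiffAt_const.sub h1).div contDiffAt_id h3).sub
      contDiffAt_const))

/-- The derivative of `p ↦ p * stretch m p`. -/
lemma stretch_deriv (h : ProfOK m p) :
    stretch m p + p * deriv (stretch m) p = -deriv (prof m) p := by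
  have h1 := (h.contDiffAt_stretch.differentiableAt (by simp)).hasDerivAt
  have h2 := (h.contDiffAt_prof.differentiableAt (by simp)).hasDerivAt
  have h3 := (hasDerivAt_id p).mul h1
  have e : (id * stretch m) = fun p => 1 - prof m p := by
    ext q; exact mul_stretch m q
  rw [e] at h3
  have h4 := h3.unique (h2.const_sub 1)
  simpa using h4

/-- The Wronskian of `sin (π p)` and the denominator is the constant `π`, independently of `m`. -/
lemma hasDerivAt_outer (h : ProfOK m p) :
    HasDerivAt (outer m) (-(Real.pi / 2) / den m p ^ 2) p := by
  have hd := h.den_pos.ne'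
  have h1 := (Chain.hasDerivAt_sin_pi p).const_mul (-(1 / 2))
  have h2 : HasDerivAt (den m) _ p :=
    (Chain.hasDerivAt_cos_pi p).add ((Chain.hasDerivAt_sin_pi p).const_mul (m : ℝ))
  refine (h1.div h2 hd).congr_deriv ?_
  congr 1
  unfold den
  linear_combination (-(Real.pi / 2)) * Real.sin_sq_add_cos_sq (Real.pi * p)

/-- The derivative is the convex combination of `-1` and the negative slope of `outer`, minus `cut'
* (1 - p - outer)`. The last product is nonnegative, as the cutoff increases from the upper profile
`1 - p` to the nonpositive profile `outer`. -/
lemma deriv_prof_neg (h : ProfOK m p) : deriv (prof m) p < 0 := by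
  have hc := (contDiff_cut.differentiable (by simp) p).hasDerivAt
  have ho := h.hasDerivAt_outer
  have hd := h.den_pos
  have h1 : HasDerivAt (prof m) _ p :=
    ((hc.const_sub 1).mul ((hasDerivAt_id p).const_sub 1)).add (hc.mul ho)
  rw [h1.deriv]
  have h2 : 0 ≤ deriv cut p := cut_monotone.deriv_nonneg
  have h3 := cut_nonneg p
  have h4 := cut_le_one p
  have h5 := h.outer_nonpos
  have h6 := h.lt_one
  have h7 : 0 < Real.pi / 2 / den m p ^ 2 := by positivity
  have h8 : -(Real.pi / 2) / den m p ^ 2 = -(Real.pi / 2 / den m p ^ 2) := by ring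
  rw [h8]
  set d := Real.pi / 2 / den m p ^ 2
  simp only [id]
  have h9 : 0 ≤ deriv cut p * (1 - p - outer m p) := mul_nonneg h2 (by linarith)
  have h10 : 0 < (1 - cut p) + cut p * d := by
    rcases h4.lt_or_eq with h4 | h4
    · have : 0 ≤ cut p * d := by positivity
      linarith
    · rw [h4]; linarith
  nlinarith

/-- For `p` in `[0, 1/2]` sine and cosine are both nonnegative, and `m - 1/2` is at least `1/2`;
vanishing of the sum would force both to be zero. -/
lemma of_mem (hm : 1 ≤ m) (hp : p ∈ Icc (0 : ℝ) (1 / 2)) : ProfOK m p where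
  nonneg := hp.1
  lt_one := by linarith [hp.2]
  pos := by
    have hpi := Real.pi_pos
    have h1 : 0 ≤ Real.sin (Real.pi * p) :=
      Real.sin_nonneg_of_nonneg_of_le_pi (mul_nonneg hpi.le hp.1) (by nlinarith [hp.2])
    have h2 : 0 ≤ Real.cos (Real.pi * p) :=
      Real.cos_nonneg_of_mem_Icc ⟨by nlinarith [hp.1], by nlinarith [hp.2]⟩
    have h3 : (1 : ℝ) ≤ m := by exact_mod_cast hm
    have h4 := Real.sin_sq_add_cos_sq (Real.pi * p)
    by_contra! h5
    have h6 : 1 / 2 * Real.sin (Real.pi * p) ≤ (m - 1 / 2) * Real.sin (Real.pi * p) := by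
      apply mul_le_mul_of_nonneg_right _ h1
      linarith
    have h7 : Real.sin (Real.pi * p) = 0 := by linarith
    have h8 : Real.cos (Real.pi * p) = 0 := by linarith
    rw [h7, h8] at h4
    norm_num at h4

end ProfOK

lemma isOpen_profOK (m : ℕ) :
    IsOpen {p : ℝ | p < 1 ∧ 0 < Real.cos (Real.pi * p) + (m - 1 / 2) * Real.sin (Real.pi * p)} :=
  have h1 : IsOpen {p : ℝ | p < 1} := isOpen_Iio
  have h2 : IsOpen {p : ℝ | 0 < Real.cos (Real.pi * p) + (m - 1 / 2) * Real.sin (Real.pi * p)} :=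
    isOpen_lt continuous_const (by fun_prop)
  h1.inter h2

lemma continuousOn_prof {m : ℕ} (hm : 1 ≤ m) : ContinuousOn (prof m) (Icc 0 (1 / 2)) :=
  fun _ hp => (ProfOK.of_mem hm hp).contDiffAt_prof.continuousAt.continuousWithinAt

lemma strictAntiOn_prof {m : ℕ} (hm : 1 ≤ m) : StrictAntiOn (prof m) (Icc 0 (1 / 2)) := by
  refine strictAntiOn_of_deriv_neg (convex_Icc _ _) (continuousOn_prof hm) fun p hp => ?_
  rw [interior_Icc] at hp
  exact (ProfOK.of_mem hm ⟨hp.1.le, hp.2.le⟩).deriv_prof_neg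

lemma prof_zero (m : ℕ) : prof m 0 = 1 := by
  simp [prof, cut_of_le (show (0 : ℝ) ≤ 1 / 8 by norm_num)]

lemma prof_half (m : ℕ) : prof m (1 / 2) = -(1 / 2) / m := by
  have e : Real.pi * (1 / 2) = Real.pi / 2 := by ring
  rw [prof, cut_of_ge (show (3 : ℝ) / 8 ≤ 1 / 2 by norm_num), outer, den, e, Real.sin_pi_div_two,
    Real.cos_pi_div_two]
  ring

lemma prof_mem {m : ℕ} (hm : 1 ≤ m) {p : ℝ} (hp : p ∈ Icc (0 : ℝ) (1 / 2)) :
    -(1 / 2) / m ≤ prof m p ∧ prof m p ≤ 1 := by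
  have h := (strictAntiOn_prof hm).antitoneOn
  have h1 := h hp ⟨by norm_num, le_rfl⟩ hp.2
  have h2 := h ⟨le_rfl, by norm_num⟩ hp hp.1
  rw [prof_half] at h1
  rw [prof_zero] at h2
  exact ⟨h1, h2⟩

lemma exists_prof {m : ℕ} (hm : 1 ≤ m) {h : ℝ} (h1 : -(1 / 2) / m ≤ h) (h2 : h ≤ 1) :
    ∃ p ∈ Icc (0 : ℝ) (1 / 2), prof m p = h := by
  have := intermediate_value_Icc' (by norm_num) (continuousOn_prof hm)
  rw [prof_half, prof_zero] at this
  exact this ⟨h1, h2⟩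

/-- The coefficient of the angular part of `etaForm`. -/
lemma two_mul_sinc (p : ℝ) :
    2 * p * (Real.pi / 2 * Real.sinc (Real.pi * p)) = Real.sin (Real.pi * p) := by
  by_cases h : p = 0
  · simp [h]
  · have hpi := Real.pi_ne_zero
    rw [Real.sinc_of_ne_zero (mul_ne_zero hpi h)]
    field_simp

/-! ### The model of the top in the product of spheres -/

lemma nsq_mul (a b : ℂ) : nsq (a * b) = nsq a * nsq b := by simp [nsq]; ring

lemma cross_mul_left (e a b : ℂ) : cross (e * a) (e * b) = nsq e * cross a b := by
  simp [cross, nsq]; ring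

/-- The planar coordinate of the top. -/
def topPlane (m : ℕ) (q : Circle × ℝ × ℝ) : ℂ :=
  √(stretch m (toricP q.2)) • (((q.1⁻¹ ^ m : Circle) : ℂ) * ⟨q.2.1, q.2.2⟩)

/-- The point of `S² × S²` corresponding to a point of the solid torus. -/
def topPt (m : ℕ) (q : Circle × ℝ × ℝ) : Amb :=
  (lambert (topPlane m q), (√(1 - (-(1 / 2)) ^ 2) • (q.1 : ℂ), -(1 / 2)))

lemma toricP_nonneg (q : ℝ × ℝ) : 0 ≤ toricP q := by unfold toricP; positivity

lemma nsq_topPlane {m : ℕ} {q : Circle × ℝ × ℝ} (h : ProfOK m (toricP q.2)) :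
    nsq (topPlane m q) = 2 * (1 - prof m (toricP q.2)) := by
  rw [topPlane, nsq_smul, nsq_mul, nsq_circle, Real.sq_sqrt h.stretch_pos.le, ← mul_stretch]
  simp only [nsq, toricP]
  ring

lemma nsq_topPlane_lt {m : ℕ} {q : Circle × ℝ × ℝ} (h : ProfOK m (toricP q.2)) :
    nsq (topPlane m q) < 4 := by
  rw [nsq_topPlane h]; linarith [h.lt_prof]

lemma topPt_fst_height {m : ℕ} {q : Circle × ℝ × ℝ} (h : ProfOK m (toricP q.2)) :
    (topPt m q).1.2 = prof m (toricP q.2) := by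
  simp only [topPt, lambert]
  rw [nsq_topPlane h]; ring

lemma onSpheres_topPt {m : ℕ} {q : Circle × ℝ × ℝ} (h : ProfOK m (toricP q.2)) :
    OnSpheres (topPt m q) :=
  ⟨lambert_onSphere (nsq_topPlane_lt h).le, Chain.onSphere_circle (by norm_num) _⟩

/-- The first height determines `p` because the profile is strictly decreasing, and the second
sphere determines the circle coordinate; the stretching and the rotation of the plane can then be
undone. -/
lemma topPt_injective {m : ℕ} (hm : 1 ≤ m) {q q' : Circle × ℝ × ℝ}
    (h : q ∈ solidTorus (1 / 2)) (h' : q' ∈ solidTorus (1 / 2)) (e : topPt m q = topPt m q') :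
    q = q' := by
  have k : toricP q.2 ∈ Icc (0 : ℝ) (1 / 2) := ⟨toricP_nonneg _, h⟩
  have k' : toricP q'.2 ∈ Icc (0 : ℝ) (1 / 2) := ⟨toricP_nonneg _, h'⟩
  have o := ProfOK.of_mem hm k
  have o' := ProfOK.of_mem hm k'
  have e0 := congrArg (fun x : Amb => x.1.2) e
  simp only [topPt_fst_height o, topPt_fst_height o'] at e0
  have ep := (strictAntiOn_prof hm).injOn k k' e0
  have e1 := congrArg (fun x : Amb => unlambert x.1) e
  have e2 := congrArg (fun x : Amb => x.2.1) e
  simp only [topPt] at e1 e2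
  rw [unlambert_lambert (nsq_topPlane_lt o), unlambert_lambert (nsq_topPlane_lt o')] at e1
  have hs : √(1 - (-(1 / 2)) ^ 2) ≠ (0 : ℝ) := (Real.sqrt_pos.2 (by norm_num)).ne'
  have ec := Circle.ext (smul_right_injective ℂ hs e2)
  rw [topPlane, topPlane, ← ep, ← ec] at e1
  have e3 := smul_right_injective ℂ (Real.sqrt_pos.2 o.stretch_pos).ne' e1
  have e4 := mul_left_cancel₀ (Circle.coe_ne_zero _) e3
  rw [Complex.mk.injEq] at e4
  exact Prod.ext ec (Prod.ext e4.1 e4.2)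

lemma exists_topPt {m : ℕ} (hm : 1 ≤ m) {x : Amb} (hx : OnSpheres x) (h1 : -(1 / 2) / m ≤ x.1.2)
    (h2 : x.2.2 = -(1 / 2)) :
    ∃ q ∈ solidTorus (1 / 2), topPt m q = x := by
  obtain ⟨p, hp, e⟩ := exists_prof hm h1 hx.1.abs_le.2
  obtain ⟨c, hc⟩ := exists_circle hx.2
  have o := ProfOK.of_mem hm hp
  have hK := Real.sqrt_pos.2 o.stretch_pos
  set Z := unlambert x.1 with hZ
  have hx1 : -1 < x.1.2 := by rw [← e]; exact o.lt_prof
  have hn : nsq Z = 2 * (1 - x.1.2) := nsq_unlambert hx.1 hx1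
  set ζ : ℂ := (√(stretch m p))⁻¹ • (((c ^ m : Circle) : ℂ) * Z) with hζ
  have hp2 : toricP (ζ.re, ζ.im) = p := by
    have : toricP (ζ.re, ζ.im) = nsq ζ / 2 := rfl
    rw [this, hζ, nsq_smul, nsq_mul, nsq_circle, hn, ← e, ← mul_stretch, inv_pow,
      Real.sq_sqrt o.stretch_pos.le]
    have := o.stretch_pos.ne'
    field_simp
  refine ⟨(c, ζ.re, ζ.im), hp2.le.trans hp.2, ?_⟩
  have e1 : topPlane m (c, ζ.re, ζ.im) = Z := by
    simp only [topPlane]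
    rw [hp2]
    change √(stretch m p) • (((c⁻¹ ^ m : Circle) : ℂ) * ζ) = Z
    rw [hζ, mul_smul_comm, smul_smul, mul_inv_cancel₀ hK.ne', one_smul, ← mul_assoc,
      ← Circle.coe_mul, inv_pow, inv_mul_cancel, Circle.coe_one, one_mul]
  refine Prod.ext ?_ (Prod.ext ?_ h2.symm)
  · rw [topPt, e1, hZ, lambert_unlambert hx.1 hx1]
  · rw [hc, h2]; rfl

/-! ### The differential of the model -/

/-- The pulled back symplectic form, up to a positive factor: `du ∧ dw - m dp ∧ dα`. -/
def topForm (m : ℕ) (z v w : ℝ × ℝ × ℝ) : ℝ :=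
  (v.2.1 * w.2.2 - v.2.2 * w.2.1) - m * ((z.2.1 * v.2.1 + z.2.2 * v.2.2) * w.1 -
    (z.2.1 * w.2.1 + z.2.2 * w.2.2) * v.1)

/-- The wedge of the contact form with the restricted symplectic form, up to the factor from the
profile. Positivity of `den` is the whole content of domination. -/
lemma eta_topForm (m : ℕ) (z n v w : ℝ × ℝ × ℝ) :
    etaForm z n * topForm m z v w - etaForm z v * topForm m z n w +
      etaForm z w * topForm m z n v = den m (toricP z.2) * vol3 n v w := by
  have h := two_mul_sinc (toricP z.2)
  rw [den, ← h, vol3, Matrix.det_fin_three]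
  simp only [etaForm, topForm, toricP]
  simp
  ring

lemma hasFDerivAt_toricP (z : ℝ × ℝ × ℝ) : ∃ D : ℝ × ℝ × ℝ →L[ℝ] ℝ,
    HasFDerivAt (fun z : ℝ × ℝ × ℝ => toricP z.2) D z ∧
      ∀ v, D v = z.2.1 * v.2.1 + z.2.2 * v.2.2 := by
  let x := ContinuousLinearMap.fst ℝ ℝ ℝ ∘L ContinuousLinearMap.snd ℝ ℝ (ℝ × ℝ)
  let y := ContinuousLinearMap.snd ℝ ℝ ℝ ∘L ContinuousLinearMap.snd ℝ ℝ (ℝ × ℝ)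
  have hx : HasFDerivAt (fun z : ℝ × ℝ × ℝ => z.2.1) x z := x.hasFDerivAt
  have hy : HasFDerivAt (fun z : ℝ × ℝ × ℝ => z.2.2) y z := y.hasFDerivAt
  refine ⟨_, ((hx.pow 2).add (hy.pow 2)).mul_const (1 / 2) |>.congr_of_eventuallyEq
    (Filter.Eventually.of_forall fun z => ?_), fun v => ?_⟩
  · simp only [toricP, Pi.add_apply]; ring
  · simp [x, y]; ring

lemma topPlane_solidCoord (m : ℕ) (z : ℝ × ℝ × ℝ) : topPlane m (solidCoord z) =
    √(stretch m (toricP z.2)) • ((Circle.exp (-(m * z.1)) : ℂ) * ⟨z.2.1, z.2.2⟩) := by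
  have h : (Circle.exp z.1)⁻¹ ^ m = Circle.exp (-(m * z.1)) := by
    rw [Circle.exp_neg, inv_pow, ← nsmul_eq_mul, Circle.exp_nsmul]
  simp only [topPlane, solidCoord, h]

lemma hasFDerivAt_topPlane {m : ℕ} {z : ℝ × ℝ × ℝ} (h : ProfOK m (toricP z.2)) :
    ∃ D : ℝ × ℝ × ℝ →L[ℝ] ℂ,
      HasFDerivAt (fun z => topPlane m (solidCoord z)) D z ∧
      (∀ v w, cross (D v) (D w) = -deriv (prof m) (toricP z.2) * topForm m z v w) ∧
      ∀ v, cross (topPlane m (solidCoord z)) (D v) = stretch m (toricP z.2) *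
        (z.2.1 * v.2.2 - z.2.2 * v.2.1 - 2 * toricP z.2 * (m * v.1)) := by
  obtain ⟨P, hP, eP⟩ := hasFDerivAt_toricP z
  have hK := (h.contDiffAt_stretch.differentiableAt (by simp)).hasDerivAt
  have hS : HasFDerivAt (fun z : ℝ × ℝ × ℝ => stretch m (toricP z.2)) _ z :=
    HasDerivAt.comp_hasFDerivAt (h₂ := stretch m) (f := fun z : ℝ × ℝ × ℝ => toricP z.2) z hK hP
  have hR := hS.sqrt h.stretch_pos.ne'
  have hα : HasFDerivAt (fun z : ℝ × ℝ × ℝ => -(m * z.1))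
      (-((m : ℝ) • ContinuousLinearMap.fst ℝ ℝ (ℝ × ℝ))) z :=
    (-((m : ℝ) • ContinuousLinearMap.fst ℝ ℝ (ℝ × ℝ))).hasFDerivAt
  have hE := (hasDerivAt_circleExp (-(m * z.1))).hasFDerivAt.comp z hα
  let L : ℝ × ℝ × ℝ →L[ℝ] ℂ :=
    (Complex.equivRealProdCLM.symm : ℝ × ℝ →L[ℝ] ℂ) ∘L ContinuousLinearMap.snd ℝ ℝ (ℝ × ℝ)
  have hL : HasFDerivAt (fun z : ℝ × ℝ × ℝ => (⟨z.2.1, z.2.2⟩ : ℂ)) L z := by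
    have e : (fun z : ℝ × ℝ × ℝ => (⟨z.2.1, z.2.2⟩ : ℂ)) = L := by
      ext z
      apply Complex.ext <;> simp [L]
    rw [e]; exact L.hasFDerivAt
  have hD := hR.smul (hE.mul hL)
  have e0 : (fun z => topPlane m (solidCoord z)) = fun z => √(stretch m (toricP z.2)) •
      ((Circle.exp (-(m * z.1)) : ℂ) * ⟨z.2.1, z.2.2⟩) := funext (topPlane_solidCoord m)
  set r := √(stretch m (toricP z.2)) with hr
  set s := deriv (stretch m) (toricP z.2) / (2 * r) with hs
  have hr0 : r ≠ 0 := (Real.sqrt_pos.2 h.stretch_pos).ne'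
  have hr2 : r ^ 2 = stretch m (toricP z.2) := Real.sq_sqrt h.stretch_pos.le
  have hrs : 2 * r * s = deriv (stretch m) (toricP z.2) := by rw [hs]; field_simp
  have hd := h.stretch_deriv
  rw [← hr2, ← hrs] at hd
  set e : ℂ := (Circle.exp (-(m * z.1)) : ℂ) with he
  have hn : nsq e = 1 := nsq_circle _
  -- The derivative with the unit rotation factor `e` stripped off; cross products do not see that
  -- factor.
  let A : ℝ × ℝ × ℝ → ℂ := fun v =>
    ⟨r * v.2.1 + s * (z.2.1 * v.2.1 + z.2.2 * v.2.2) * z.2.1 + r * (m * v.1) * z.2.2,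
      r * v.2.2 + s * (z.2.1 * v.2.1 + z.2.2 * v.2.2) * z.2.2 - r * (m * v.1) * z.2.1⟩
  obtain ⟨D, hD', key⟩ : ∃ D : ℝ × ℝ × ℝ →L[ℝ] ℂ,
      HasFDerivAt (fun z => topPlane m (solidCoord z)) D z ∧ ∀ v, D v = e * A v := by
    refine ⟨_, by rw [e0]; exact hD, fun v => ?_⟩
    have hs' : 1 / (2 * r) * deriv (stretch m) (toricP z.2) = s := by rw [hs]; ring
    apply Complex.ext
    · simp [A, L, eP, ← he, -Circle.coe_exp, -Circle.exp_neg,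
        -Complex.real_smul, Complex.smul_re]
      rw [← hs']
      ring
    · simp [A, L, eP, ← he, -Circle.coe_exp, -Circle.exp_neg,
        -Complex.real_smul, Complex.smul_im]
      rw [← hs']
      ring
  refine ⟨D, hD', fun v w => ?_, fun v => ?_⟩
  · rw [key, key, cross_mul_left, hn, one_mul, ← hd]
    simp only [A, cross, topForm, toricP]
    ring
  · have e1 : topPlane m (solidCoord z) = e * (r • ⟨z.2.1, z.2.2⟩) := by
      rw [topPlane_solidCoord, mul_smul_comm]
    rw [key, e1, cross_mul_left, hn, one_mul, ← hr2]
    simp only [A, cross, toricP, Complex.smul_re, Complex.smul_im, smul_eq_mul]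
    ring

/-! ### Solid tori in the chain -/

lemma contDiff_toricP : ContDiff ℝ ∞ toricP := by unfold toricP; fun_prop

lemma contDiffAt_topPlane {m : ℕ} {z : ℝ × ℝ × ℝ} (h : ProfOK m (toricP z.2)) :
    ContDiffAt ℝ ∞ (fun z => topPlane m (solidCoord z)) z := by
  have h1 : ContDiffAt ℝ ∞ (fun z : ℝ × ℝ × ℝ => toricP z.2) z :=
    (contDiff_toricP.comp contDiff_snd).contDiffAt
  have h2 : ContDiffAt ℝ ∞ (fun z : ℝ × ℝ × ℝ => √(stretch m (toricP z.2))) z :=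
    (ContDiffAt.comp (g := stretch m) (f := fun z : ℝ × ℝ × ℝ => toricP z.2) z
      h.contDiffAt_stretch h1).sqrt h.stretch_pos.ne'
  have h3 : ContDiffAt ℝ ∞ (fun z : ℝ × ℝ × ℝ => (Circle.exp (-(m * z.1)) : ℂ)) z :=
    ContDiffAt.comp (g := fun φ : ℝ => (Circle.exp φ : ℂ))
      (f := fun z : ℝ × ℝ × ℝ => -(m * z.1)) z contDiff_circleExp.contDiffAt (by fun_prop)
  have h4 : ContDiffAt ℝ ∞ (fun z : ℝ × ℝ × ℝ => (⟨z.2.1, z.2.2⟩ : ℂ)) z :=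
    Complex.equivRealProdCLM.symm.contDiff.contDiffAt.comp z contDiffAt_snd
  rw [funext (topPlane_solidCoord m)]
  exact h2.smul (h3.mul h4)

lemma contDiffAt_topPt {m : ℕ} {z : ℝ × ℝ × ℝ} (h : ProfOK m (toricP z.2)) :
    ContDiffAt ℝ ∞ (fun z => topPt m (solidCoord z)) z := by
  have h1 : ContDiffAt ℝ ∞ (fun z => lambert (topPlane m (solidCoord z))) z :=
    ContDiffAt.comp (g := lambert) z (contDiffAt_lambert (nsq_topPlane_lt (q := solidCoord z) h))
      (contDiffAt_topPlane h)
  have h2 : ContDiffAt ℝ ∞ (fun z : ℝ × ℝ × ℝ => polar (√(1 - (-(1 / 2)) ^ 2)) z.1) z :=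
    Chain.contDiffAt_polar contDiffAt_const contDiffAt_fst
  exact h1.prodMk (h2.prodMk contDiffAt_const)

/-- The data of a solid torus in the chain. -/
structure TopData where
  /-- The slope of its meridian. -/
  slope : ℕ
  /-- An approximation of its angle. -/
  angle : ℝ
  /-- The symmetry which places it. -/
  sym : Amb ≃L[ℝ] Amb
  one_le : 1 ≤ slope
  isSymm : IsSymm sym
  along_sym : ∀ x, along angle (sym x) = -x.2.2

namespace TopData

open Chain

variable (T : TopData)

/-- The parametrization of the solid torus. -/
def map (q : Circle × ℝ × ℝ) : Chain := Chain.mk T.angle (T.sym (topPt T.slope q))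

variable {T}

lemma good {q : Circle × ℝ × ℝ} (h : ProfOK T.slope (toricP q.2)) :
    Good T.angle (T.sym (topPt T.slope q)) :=
  ⟨(T.isSymm.spheres _).2 (onSpheres_topPt h), by rw [T.along_sym]; norm_num [topPt]⟩

lemma pt_map {q : Circle × ℝ × ℝ} (h : ProfOK T.slope (toricP q.2)) :
    (T.map q).pt = T.sym (topPt T.slope q) := pt_mk (good h)

lemma angle_map_mem {q : Circle × ℝ × ℝ} (h : ProfOK T.slope (toricP q.2)) :
    |(T.map q).angle - T.angle| < Real.pi / 2 := by
  rw [map, angle_mk (good h)]; exact lift_mem _ _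

variable (T) in
/-- The domain of definition of the parametrization in coordinates. -/
def range : Set (ℝ × ℝ × ℝ) := {z | ProfOK T.slope (toricP z.2)}

lemma isOpen_range : IsOpen T.range := by
  have h : Continuous fun z : ℝ × ℝ × ℝ => toricP z.2 := by unfold toricP; fun_prop
  have e : T.range = (fun z : ℝ × ℝ × ℝ => toricP z.2) ⁻¹' {p : ℝ | p < 1 ∧
      0 < Real.cos (Real.pi * p) + (T.slope - 1 / 2) * Real.sin (Real.pi * p)} := by
    ext z
    exact ⟨fun h => ⟨h.lt_one, h.pos⟩, fun h => ⟨toricP_nonneg _, h.1, h.2⟩⟩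
  rw [e]
  exact (isOpen_profOK _).preimage h

lemma profOK {q : Circle × ℝ × ℝ} (h : q ∈ solidTorus (1 / 2)) : ProfOK T.slope (toricP q.2) :=
  ProfOK.of_mem T.one_le ⟨toricP_nonneg _, h⟩

lemma pt_map_eventuallyEq {z : ℝ × ℝ × ℝ} (h : z ∈ T.range) :
    (fun z => (T.map (solidCoord z)).pt) =ᶠ[𝓝 z] fun z => T.sym (topPt T.slope (solidCoord z)) := by
  filter_upwards [isOpen_range.mem_nhds h] with w hw
  exact pt_map (q := solidCoord w) hw

lemma contMDiffAt_map {z : ℝ × ℝ × ℝ} (h : z ∈ T.range) :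
    ContMDiffAt 𝓘(ℝ, ℝ × ℝ × ℝ) (𝓡 4) ∞ (T.map ∘ solidCoord) z := by
  refine smooth_of_ambient (T.sym.contDiff.contDiffAt.comp z (contDiffAt_topPt h))
    (pt_map_eventuallyEq h) ?_
  have hl : ContinuousOn (fun z => lift T.angle (T.sym (topPt T.slope (solidCoord z)))) T.range :=
    continuousOn_lift continuousOn_const
      (fun w hw => (T.sym.continuous.continuousAt.comp
        (contDiffAt_topPt hw).continuousAt).continuousWithinAt)
      fun w hw => good (q := solidCoord w) hw
  refine (hl.continuousAt (isOpen_range.mem_nhds h)).congr ?_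
  filter_upwards [isOpen_range.mem_nhds h] with w hw
  rw [map, angle_mk (good (q := solidCoord w) hw)]

/-- The differential of the parametrization. -/
lemma exists_deriv {z : ℝ × ℝ × ℝ} (h : z ∈ T.range) : ∃ D E : ℝ × ℝ × ℝ → ℂ,
    (∀ v, dpt (T.map (solidCoord z)) (coordDeriv solidCoord T.map z v) =
      T.sym (fderiv ℝ lambert (topPlane T.slope (solidCoord z)) (D v), (E v, 0))) ∧
    (∀ v w, cross (D v) (D w) =
      -deriv (prof T.slope) (toricP z.2) * topForm T.slope z v w) ∧
    (∀ v, cross (topPlane T.slope (solidCoord z)) (D v) = stretch T.slope (toricP z.2) *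
      (z.2.1 * v.2.2 - z.2.2 * v.2.1 - 2 * toricP z.2 * (T.slope * v.1))) ∧
    ∀ v, cross (topPt T.slope (solidCoord z)).2.1 (E v) = 3 / 4 * v.1 := by
  obtain ⟨D, hD, h1, h2⟩ := hasFDerivAt_topPlane h
  have hl : HasFDerivAt lambert (fderiv ℝ lambert (topPlane T.slope (solidCoord z)))
      (topPlane T.slope (solidCoord z)) :=
    ((contDiffAt_lambert (n := 1) (nsq_topPlane_lt (q := solidCoord z) h)).differentiableAt
      one_ne_zero).hasFDerivAt
  obtain ⟨E, hE, h3⟩ := hasFDerivAt_polar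
    (hasFDerivAt_const (√(1 - (-(1 / 2)) ^ 2) : ℝ) z)
    (hasFDerivAt_fst (𝕜 := ℝ) (E := ℝ) (F := ℝ × ℝ) (p := z))
  have hG := T.sym.hasFDerivAt.comp z ((HasFDerivAt.comp (g := lambert) z hl hD).prodMk
    (hE.prodMk (hasFDerivAt_const (-(1 / 2) : ℝ) z)))
  refine ⟨D, E, fun v => ?_, h1, h2, fun v => ?_⟩
  · exact dpt_coordDeriv (contMDiffAt_map h) (pt_map_eventuallyEq h) hG v
  · refine (h3 v).trans ?_
    rw [Real.sq_sqrt (by norm_num)]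
    norm_num

/-- The second height is constant on the solid torus, so the second sphere contributes nothing. The
first contributes the area of the stretched and rotated disc, whose radial density is `d/dp (p *
stretch) = -prof'`. -/
lemma form_map {z : ℝ × ℝ × ℝ} (h : z ∈ T.range) (v w : ℝ × ℝ × ℝ) :
    form (T.map (solidCoord z)) ![coordDeriv solidCoord T.map z v, coordDeriv solidCoord T.map z w] =
      -deriv (prof T.slope) (toricP z.2) * topForm T.slope z v w := by
  obtain ⟨D, E, h0, h1, h2, h3⟩ := exists_deriv h
  have ho := onSpheres_topPt (q := solidCoord z) h
  have tv := tangent_dpt (coordDeriv solidCoord T.map z v)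
  have tw := tangent_dpt (coordDeriv solidCoord T.map z w)
  rw [h0, pt_map (q := solidCoord z) h, T.isSymm.tangent] at tv tw
  rw [form_vec, h0, h0, pt_map (q := solidCoord z) h, T.isSymm.area, ambArea,
    area_of_rates ho.2 (by norm_num [topPt]) tv.2 tw.2 (φ := v.1) (φ' := w.1)
      (by rw [h3]; norm_num [topPt]) (by rw [h3]; norm_num [topPt])]
  have := area_lambert (nsq_topPlane_lt (q := solidCoord z) h) (D v) (D w)
  simp only [topPt]
  rw [this, h1]
  ring

lemma omegaSq_map {z : ℝ × ℝ × ℝ} (h : z ∈ T.range)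
    {n : TangentSpace (𝓡 4) (T.map (solidCoord z))} {a : Amb}
    (ha : dpt (T.map (solidCoord z)) n = T.sym a) (v₁ v₂ v₃ : ℝ × ℝ × ℝ) :
    omegaSq form (T.map (solidCoord z)) n (coordDeriv solidCoord T.map z v₁)
      (coordDeriv solidCoord T.map z v₂) (coordDeriv solidCoord T.map z v₃) =
      deriv (prof T.slope) (toricP z.2) * a.2.2 * vol3 v₁ v₂ v₃ := by
  have hz := nsq_topPlane_lt (q := solidCoord z) h
  have hf := fun v w => form_map h v w
  obtain ⟨D, E, h0, h1, h2, h3⟩ := exists_deriv h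
  have ho := onSpheres_topPt (q := solidCoord z) h
  have tn := tangent_dpt n
  rw [ha, pt_map (q := solidCoord z) h, T.isSymm.tangent] at tn
  obtain ⟨b, hb⟩ := exists_fderiv_lambert hz tn.1
  have hn : ∀ v, form (T.map (solidCoord z)) ![n, coordDeriv solidCoord T.map z v] =
      cross b (D v) - a.2.2 * v.1 := by
    intro v
    have tv := tangent_dpt (coordDeriv solidCoord T.map z v)
    rw [h0, pt_map (q := solidCoord z) h, T.isSymm.tangent] at tv
    have hc : (1 - (topPt T.slope (solidCoord z)).2.2 ^ 2) ≠ 0 := by norm_num [topPt]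
    rw [form_vec, h0, ha, pt_map (q := solidCoord z) h, T.isSymm.area, ambArea,
      area_of_rates ho.2 (by norm_num [topPt]) tn.2 tv.2
        (φ := cross (topPt T.slope (solidCoord z)).2.1 a.2.1 /
          (1 - (topPt T.slope (solidCoord z)).2.2 ^ 2)) (φ' := v.1)
        (by field_simp) (by rw [h3]; norm_num [topPt])]
    have := area_lambert hz b (D v)
    simp only [topPt] at hb ⊢
    rw [← hb, this]
    ring
  -- The terms lying in the first plane would be a volume of four vectors in dimension two, hence
  -- cancel. Only the component of `n` across the wall, `a.2.2`, survives.
  have pl : cross b (D v₁) * cross (D v₂) (D v₃) - cross b (D v₂) * cross (D v₁) (D v₃) +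
      cross b (D v₃) * cross (D v₁) (D v₂) = 0 := by
    simp only [cross]; ring
  rw [h1, h1, h1] at pl
  rw [omegaSq, hn, hn, hn, hf, hf, hf, vol3, Matrix.det_fin_three]
  simp only [topForm] at pl ⊢
  simp
  linear_combination pl

lemma free_map_iff {q : Circle × ℝ × ℝ} (h : ProfOK T.slope (toricP q.2)) :
    Free (T.map q).pt ↔ prof T.slope (toricP q.2) < 1 := by
  rw [pt_map h, T.isSymm.free, Free, topPt_fst_height h]
  have := h.lt_prof
  simp only [topPt]
  constructor
  · exact fun h => h.1.2
  · exact fun h => ⟨⟨this, h⟩, by norm_num, by norm_num⟩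

lemma prof_outer {m : ℕ} {p : ℝ} (h : 3 / 8 ≤ p) : prof m p = outer m p := by
  simp [prof, cut_of_ge h]

lemma free_map {q : Circle × ℝ × ℝ} (h : ProfOK T.slope (toricP q.2)) (h' : 3 / 8 ≤ toricP q.2) :
    Free (T.map q).pt := by
  rw [free_map_iff h, prof_outer h']
  linarith [h.outer_nonpos]

/-- Near the boundary, the Liouville field induces the standard contact structure. -/
lemma form_field_map {z : ℝ × ℝ × ℝ} (h : z ∈ T.range) (h' : 3 / 8 ≤ toricP z.2)
    (v : ℝ × ℝ × ℝ) :
    form (T.map (solidCoord z)) ![field (T.map (solidCoord z)), coordDeriv solidCoord T.map z v] =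
      1 / 2 / den T.slope (toricP z.2) * etaForm z v := by
  have hz := nsq_topPlane_lt (q := solidCoord z) h
  have hfree := free_map (q := solidCoord z) h h'
  obtain ⟨D, E, h0, h1, h2, h3⟩ := exists_deriv h
  have hn := nsq_topPlane (q := solidCoord z) h
  have hm := mul_stretch T.slope (toricP z.2)
  have ho : prof T.slope (toricP z.2) = outer T.slope (toricP z.2) := prof_outer h'
  have hpr : prof T.slope (toricP z.2) < 1 := by
    rw [ho]; linarith [ProfOK.outer_nonpos h]
  have hne : topPlane T.slope (solidCoord z) ≠ 0 := by
    intro h4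
    rw [h4] at hn
    simp [nsq, solidCoord] at hn
    linarith
  have hd : den T.slope (toricP z.2) ≠ 0 := (ProfOK.den_pos h).ne'
  rw [form_vec, dpt_field hfree, pt_map (q := solidCoord z) h, h0, T.isSymm.field, T.isSymm.area,
    ambArea, ambField, area_sphereField (s := (topPt T.slope (solidCoord z)).2)
      (by norm_num [topPt]) (by norm_num [topPt]), h3]
  have e1 := area_lambert hz (planeField (topPlane T.slope (solidCoord z))) (D v)
  rw [fderiv_lambert_planeField hz hne] at e1
  simp only [topPt]
  rw [e1]
  have e2 : cross (planeField (topPlane T.slope (solidCoord z))) (D v) =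
      (1 / 2 - 1 / nsq (topPlane T.slope (solidCoord z))) *
        cross (topPlane T.slope (solidCoord z)) (D v) := by
    simp only [planeField, cross, Complex.smul_re, Complex.smul_im, smul_eq_mul]; ring
  have e3 : nsq (topPlane T.slope (solidCoord z)) =
      2 * (toricP z.2 * stretch T.slope (toricP z.2)) := by rw [hm]; exact hn
  have hK := (ProfOK.stretch_pos h).ne'
  have hp : toricP z.2 ≠ 0 := by linarith
  have e4 : (1 / 2 - 1 / (2 * (toricP z.2 * stretch T.slope (toricP z.2)))) *
      stretch T.slope (toricP z.2) = -prof T.slope (toricP z.2) / (2 * toricP z.2) := by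
    field_simp
    linarith
  rw [e2, h2, e3, ← mul_assoc, e4, ho, outer, etaForm]
  have hs := two_mul_sinc (toricP z.2)
  -- Eliminating the cosine in favour of `den` makes the terms with the framing cancel, which is the
  -- defining property of `outer`.
  have hc : Real.cos (Real.pi * toricP z.2) = den T.slope (toricP z.2) - T.slope *
      (2 * toricP z.2 * (Real.pi / 2 * Real.sinc (Real.pi * toricP z.2))) := by
    rw [hs, den]; ring
  rw [← hs, hc]
  generalize den T.slope (toricP z.2) = d at hd ⊢
  generalize Real.pi / 2 * Real.sinc (Real.pi * toricP z.2) = s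
  field_simp
  ring

lemma injective_coordDeriv {z : ℝ × ℝ × ℝ} (h : z ∈ T.range) :
    Function.Injective (coordDeriv solidCoord T.map z) := by
  rw [injective_iff_map_eq_zero]
  intro v hv
  have hf := fun w => form_map h v w
  obtain ⟨D, E, h0, h1, h2, h3⟩ := exists_deriv h
  have e0 := h0 v
  rw [hv, map_zero] at e0
  have e1 := T.sym.injective ((map_zero T.sym).trans e0)
  have e2 : E v = 0 := (congrArg (fun x : Amb => x.2.1) e1).symm
  have e3 := h3 v
  rw [e2] at e3
  have q1 : v.1 = 0 := by
    have : cross (topPt T.slope (solidCoord z)).2.1 0 = 0 := by simp [cross]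
    linarith
  have hd := (ProfOK.deriv_prof_neg h).ne
  have hB : ∀ w, topForm T.slope z v w = 0 := by
    intro w
    have := hf w
    rw [hv, form_vec, map_zero] at this
    have e : ∀ x a, ambArea x 0 a = 0 := fun x a => by simp [ambArea, area, cross]
    rw [e] at this
    exact (mul_eq_zero.1 this.symm).resolve_left (neg_ne_zero.2 hd)
  have b1 := hB (0, 0, 1)
  have b2 := hB (0, 1, 0)
  simp [topForm, q1] at b1 b2
  exact Prod.ext q1 (Prod.ext b1 b2)

lemma isSmoothEmbeddingOn_map (T : TopData) :
    IsSmoothEmbeddingOn solidCoord (solidTorus (1 / 2)) T.map where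
  smooth := ⟨T.range, isOpen_range, fun z hz => profOK (q := solidCoord z) hz,
    fun z hz => (contMDiffAt_map hz).contMDiffWithinAt⟩
  injOn := by
    intro q hq q' hq' e
    apply topPt_injective T.one_le hq hq'
    apply T.sym.injective
    rw [← pt_map (profOK hq), e, pt_map (profOK hq')]
  immersion z hz := injective_coordDeriv (profOK (q := solidCoord z) hz)

/-- The symplectic form dominates the contact structure of the solid torus. -/
lemma dominates {z n v w : ℝ × ℝ × ℝ} (h : z ∈ T.range) (hn : 0 < etaForm z n)
    (hv : etaForm z v = 0) (hw : etaForm z w = 0) (hvol : 0 < vol3 n v w) :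
    0 < form (T.map (solidCoord z))
      ![coordDeriv solidCoord T.map z v, coordDeriv solidCoord T.map z w] := by
  have e := eta_topForm T.slope z n v w
  rw [hv, hw, zero_mul, zero_mul, sub_zero, add_zero] at e
  have h1 : 0 < etaForm z n * topForm T.slope z v w := by
    rw [e]; exact mul_pos (ProfOK.den_pos h) hvol
  rw [form_map h]
  exact mul_pos (neg_pos.2 (ProfOK.deriv_prof_neg h)) (pos_of_mul_pos_right h1 hn.le)

lemma exists_map {y : Chain} {x : Amb} (hx : T.sym x = y.pt) (ha : |y.angle - T.angle| < Real.pi / 2)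
    (h1 : -(1 / 2) / T.slope ≤ x.1.2) (h2 : x.2.2 = -(1 / 2)) :
    ∃ q ∈ solidTorus (1 / 2), T.map q = y ∧ prof T.slope (toricP q.2) = x.1.2 := by
  have ho : OnSpheres x := by rw [← T.isSymm.spheres, hx]; exact y.onSpheres
  obtain ⟨q, hq, e⟩ := exists_topPt T.one_le ho h1 h2
  refine ⟨q, hq, ?_, ?_⟩
  · rw [map, e, hx, mk_pt ha]
  · rw [← topPt_fst_height (profOK hq), e]

lemma mem_boundary_iff {q : Circle × ℝ × ℝ} (h : q ∈ solidTorus (1 / 2)) :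
    q ∈ solidTorusBoundary (1 / 2) ↔ prof T.slope (toricP q.2) = -(1 / 2) / T.slope := by
  rw [← prof_half, (strictAntiOn_prof T.one_le).injOn.eq_iff ⟨toricP_nonneg _, h⟩
    ⟨by norm_num, le_rfl⟩]
  rfl

end TopData

/-! ### The two components of the top -/

/-- The first component of the top. -/
def firstTop : TopData where
  slope := 2
  angle := -(Real.pi / 2)
  sym := 1
  one_le := by norm_num
  isSymm := IsSymm.one
  along_sym x := by simp [along]

/-- The symmetry which places the last component of the top. -/
def lastSym (k : ℕ) : Amb ≃L[ℝ] Amb := quarter ^ ((2 * (k + 1) : ℕ) : ℤ) * exchange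

lemma heights_quarter_pow (n : ℕ) (x : Amb) :
    ((quarter ^ (2 * n)) x).1.2 = (-1) ^ n * x.1.2 ∧
      ((quarter ^ (2 * n)) x).2.2 = (-1) ^ n * x.2.2 := by
  induction n with
  | zero => simp
  | succ n ih =>
    rw [mul_add, mul_one, add_comm, pow_add, pow_two, cle_mul_apply, cle_mul_apply, quarter_fst,
      quarter_snd, quarter_snd, flip_snd, quarter_fst, flip_snd, ih.1, ih.2]
    constructor <;> ring

/-- An even number `2 (k + 1)` of quarter turns is the sign `(-1)^(k+1)`. After the exchange of
factors it carries the model wall `h₂ = -1/2` to `(-1)^k h₁ = 1/2`. -/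
lemma lastSym_heights (k : ℕ) (x : Amb) : (lastSym k x).1.2 = -(Chain.sgn k * x.2.2) ∧
    (lastSym k x).2.2 = -(Chain.sgn k * x.1.2) := by
  rw [lastSym, zpow_natCast, cle_mul_apply, (heights_quarter_pow _ _).1,
    (heights_quarter_pow _ _).2, exchange_fst, exchange_snd, Chain.sgn, pow_succ]
  constructor <;> ring

/-- The last component of the top. -/
def lastTop (k : ℕ) : TopData where
  slope := 1
  angle := k * Real.pi
  sym := lastSym k
  one_le := le_rfl
  isSymm := (isSymm_quarter_zpow _).mul isSymm_exchange
  along_sym x := by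
    rw [along, (lastSym_heights k x).1, Real.cos_nat_mul_pi, Real.sin_nat_mul_pi]
    have h : (-1 : ℝ) ^ k = Chain.sgn k := rfl
    rw [h]
    linear_combination (-x.2.2) * Chain.sgn_mul_self k

/-- The two components of the top. -/
def topData (k : ℕ) : Fin 2 → TopData := ![firstTop, lastTop k]

lemma topData_zero (k : ℕ) : topData k 0 = firstTop := rfl
lemma topData_one (k : ℕ) : topData k 1 = lastTop k := rfl

/-! ### The solid tori as the top face -/

namespace Chain

variable {k : ℕ}

lemma angle_firstTop {q : Circle × ℝ × ℝ} (h : q ∈ solidTorus (1 / 2)) :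
    -Real.pi < (firstTop.map q).angle ∧ (firstTop.map q).angle < 0 := by
  have h1 := TopData.angle_map_mem (T := firstTop) (TopData.profOK h)
  rw [abs_lt] at h1
  have e : firstTop.angle = -(Real.pi / 2) := rfl
  rw [e] at h1
  constructor <;> linarith [h1.1, h1.2]

lemma heights_firstTop {q : Circle × ℝ × ℝ} (h : q ∈ solidTorus (1 / 2)) :
    (firstTop.map q).pt.1.2 = prof 2 (toricP q.2) ∧ (firstTop.map q).pt.2.2 = -(1 / 2) := by
  have ho : ProfOK firstTop.slope (toricP q.2) := TopData.profOK h
  rw [TopData.pt_map ho]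
  exact ⟨topPt_fst_height ho, rfl⟩

lemma angle_lastTop {q : Circle × ℝ × ℝ} (h : q ∈ solidTorus (1 / 2)) :
    coreAngle k < ((lastTop k).map q).angle ∧
      ((lastTop k).map q).angle < lastAngle k + Real.pi := by
  have h1 := TopData.angle_map_mem (T := lastTop k) (TopData.profOK h)
  rw [abs_lt] at h1
  have e : (lastTop k).angle = k * Real.pi := rfl
  rw [e] at h1
  have := Real.pi_pos
  unfold coreAngle lastAngle
  constructor <;> linarith [h1.1, h1.2]

lemma heights_lastTop {q : Circle × ℝ × ℝ} (h : q ∈ solidTorus (1 / 2)) :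
    ((lastTop k).map q).pt.1.2 = sgn k * (1 / 2) ∧
      ((lastTop k).map q).pt.2.2 = -(sgn k * prof 1 (toricP q.2)) := by
  have ho : ProfOK (lastTop k).slope (toricP q.2) := TopData.profOK h
  rw [TopData.pt_map ho]
  have e := lastSym_heights k (topPt (lastTop k).slope q)
  refine ⟨e.1.trans ?_, e.2.trans ?_⟩
  · simp only [topPt]; ring
  · rw [topPt_fst_height ho]; rfl

/-- Along the wall `h₂ = -1/2` the side imposes `h₁ ≥ -1/4`, the boundary value of the profile of
framing two, and the sphere imposes `h₁ ≤ 1`, its value at the core. -/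
lemma top_image_first (hk : 1 < k) : firstTop.map '' solidTorus (1 / 2) =
    {y | y ∈ domain k ∧ y.angle < 0 ∧ y.pt.2.2 = -(1 / 2)} := by
  have hpi := Real.pi_pos
  ext y
  constructor
  · rintro ⟨q, hq, rfl⟩
    obtain ⟨a1, a2⟩ := angle_firstTop hq
    obtain ⟨p1, p2⟩ := heights_firstTop hq
    refine ⟨?_, a2, p2⟩
    rw [domain_first hk (by linarith) a2]
    refine ⟨(bottomFn_pos_of_snd (by rw [p2]; norm_num)).le, ?_, ?_⟩
    · have := (prof_mem (m := 2) (by norm_num) ⟨toricP_nonneg _, hq⟩).1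
      rw [aff, p1, p2]
      push_cast at this
      linarith
    · rw [aff, p2]; norm_num
  · rintro ⟨hy, ha, h2⟩
    have hl := lt_firstAngle
    have h1 := ((domain_first hk (by linarith [hy.2.1]) ha).1 hy).2.1
    rw [aff, h2] at h1
    obtain ⟨q, hq, e, -⟩ := TopData.exists_map (T := firstTop) (y := y) (x := y.pt) rfl
      (by
        have e : firstTop.angle = -(Real.pi / 2) := rfl
        rw [e, abs_lt]
        constructor <;> linarith [hy.2.1])
      (by
        have e : firstTop.slope = 2 := rfl
        rw [e]; push_cast; linarith) h2
    exact ⟨q, hq, e⟩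

/-- The point of the model which the symmetry takes to a given point. -/
lemma exists_lastSym (x : Amb) : ∃ x', lastSym k x' = x ∧ x'.2.2 = -(sgn k * x.1.2) ∧
    x'.1.2 = -(sgn k * x.2.2) := by
  have h : lastSym k ((lastSym k).symm x) = x := (lastSym k).apply_symm_apply x
  have e := lastSym_heights k ((lastSym k).symm x)
  rw [h] at e
  have hs := sgn_mul_self k
  refine ⟨_, h, ?_, ?_⟩
  · rw [e.1]; linear_combination (-((lastSym k).symm x).2.2) * hs
  · rw [e.2]; linear_combination (-((lastSym k).symm x).1.2) * hs

lemma top_image_last (hk : 1 < k) : (lastTop k).map '' solidTorus (1 / 2) =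
    {y | y ∈ domain k ∧ coreAngle k < y.angle ∧ sgn k * y.pt.1.2 = 1 / 2} := by
  have hpi := Real.pi_pos
  have hs := sgn_mul_self k
  ext y
  constructor
  · rintro ⟨q, hq, rfl⟩
    obtain ⟨a1, a2⟩ := angle_lastTop (k := k) hq
    obtain ⟨p1, p2⟩ := heights_lastTop (k := k) hq
    have h0 : sgn k * ((lastTop k).map q).pt.1.2 = 1 / 2 := by
      rw [p1]; linear_combination 1 / 2 * hs
    refine ⟨?_, a1, h0⟩
    rw [domain_last hk a1 a2]
    refine ⟨(bottomFn_pos_of_fst ?_).le, ?_, ?_⟩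
    · rw [p1, mul_pow, pow_two (sgn k), hs]; norm_num
    · have := (prof_mem (m := 1) le_rfl ⟨toricP_nonneg _, hq⟩).1
      have e : aff (sgn k) (-sgn k) 0 ((lastTop k).map q) = 1 / 2 + prof 1 (toricP q.2) := by
        rw [aff, p1, p2]; linear_combination (1 / 2 + prof 1 (toricP q.2)) * hs
      rw [e]
      push_cast at this
      linarith
    · rw [aff]; linarith
  · rintro ⟨hy, ha, h2⟩
    have hl := lastAngle_eq k
    have h1 := ((domain_last hk ha (by linarith [hy.2.2.1])).1 hy).2.1
    rw [aff] at h1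
    obtain ⟨x, hx, x2, x1⟩ := exists_lastSym (k := k) y.pt
    obtain ⟨q, hq, e, -⟩ := TopData.exists_map (T := lastTop k) (y := y) (x := x) hx
      (by
        have e : (lastTop k).angle = k * Real.pi := rfl
        have h3 := hy.2.2.1
        unfold coreAngle at ha
        unfold lastAngle at h3
        rw [e, abs_lt]
        constructor <;> linarith)
      (by
        have e : (lastTop k).slope = 1 := rfl
        rw [e, x1]; push_cast; linarith) (by rw [x2, h2])
    exact ⟨q, hq, e⟩

lemma top_image (hk : 1 < k) :
    ⋃ i, (topData k i).map '' solidTorus (1 / 2) = faceSet k Face.top := by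
  ext y
  simp only [mem_iUnion, Fin.exists_fin_two, topData_zero, topData_one, top_image_first hk,
    top_image_last hk]
  exact and_or_left.symm

lemma top_disjoint (hk : 1 < k) : Disjoint ((topData k 0).map '' solidTorus (1 / 2))
    ((topData k 1).map '' solidTorus (1 / 2)) := by
  rw [topData_zero, topData_one, top_image_first hk, top_image_last hk, Set.disjoint_left]
  rintro y ⟨_, h, _⟩ ⟨_, h', _⟩
  linarith [coreAngle_pos hk, Real.pi_pos]

/-- Both sets are the full torus over the heights `(-1/4, -1/2)`; each angular window singles out
the same lift. -/
lemma side_top_first : sideMap k 0 '' {m | m.1 = 1} = firstTop.map '' solidTorusBoundary (1 / 2) := by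
  have h01 : ∀ {m : ℝ × Circle × Circle}, m.1 = 1 → m.1 ∈ Icc (0 : ℝ) 1 := fun h => by
    rw [h]; norm_num
  have hat := arctan_half_pos
  have hat' := Real.arctan_lt_pi_div_two (1 / 2)
  ext y
  constructor
  · rintro ⟨m, hm, rfl⟩
    have hm : m.1 = 1 := hm
    obtain ⟨p1, p2⟩ := heights_side_first (k := k) (h01 hm)
    have ha := angle_side_first (k := k) (h01 hm)
    rw [hm] at p1 p2
    norm_num at p1 p2
    obtain ⟨q, hq, e, hb⟩ := TopData.exists_map (T := firstTop) (y := sideMap k 0 m)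
      (x := (sideMap k 0 m).pt) rfl
      (by
        have e : firstTop.angle = -(Real.pi / 2) := rfl
        rw [ha, e, firstAngle, abs_lt]
        constructor <;> linarith)
      (by
        have e : firstTop.slope = 2 := rfl
        rw [p1, e]; norm_num) p2
    refine ⟨q, (TopData.mem_boundary_iff (T := firstTop) hq).2 ?_, e⟩
    rw [hb, p1]
    have e : firstTop.slope = 2 := rfl
    rw [e]; norm_num
  · rintro ⟨q, hq, rfl⟩
    have hq' : q ∈ solidTorus (1 / 2) := hq.le
    obtain ⟨p1, p2⟩ := heights_firstTop hq'
    have hb := (TopData.mem_boundary_iff (T := firstTop) hq').1 hq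
    have e0 : firstTop.slope = 2 := rfl
    rw [e0] at hb
    rw [hb] at p1
    have h1 := TopData.angle_map_mem (T := firstTop) (TopData.profOK hq')
    obtain ⟨X, Z, e⟩ := exists_torusMap (t := 1) (P₁ := firstSideFst) (P₂ := firstSideSnd)
      (ψ := fun _ => -(Real.pi / 2)) (by rw [p1, firstSideFst]; norm_num)
      (by rw [p2, firstSideSnd]; norm_num) h1
    exact ⟨(1, X, Z), rfl, e⟩

lemma side_top_last :
    sideMap k 1 '' {m | m.1 = 1} = (lastTop k).map '' solidTorusBoundary (1 / 2) := by
  have h01 : ∀ {m : ℝ × Circle × Circle}, m.1 = 1 → m.1 ∈ Icc (0 : ℝ) 1 := fun h => by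
    rw [h]; norm_num
  have hpi := Real.pi_pos
  have hs := sgn_mul_self k
  ext y
  constructor
  · rintro ⟨m, hm, rfl⟩
    have hm : m.1 = 1 := hm
    obtain ⟨p1, p2⟩ := heights_side_last (k := k) (h01 hm)
    have ha := angle_side_last (k := k) (h01 hm)
    rw [hm] at p1 p2
    obtain ⟨x, hx, x2, x1⟩ := exists_lastSym (k := k) (sideMap k 1 m).pt
    have x2' : x.2.2 = -(1 / 2) := by rw [x2, p1]; linear_combination (-(1 / 2)) * hs
    have x1' : x.1.2 = -(1 / 2) := by rw [x1, p2]; linear_combination (-(1 / 2)) * hs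
    have e1 : (lastTop k).slope = 1 := rfl
    obtain ⟨q, hq, e, hb⟩ := TopData.exists_map (T := lastTop k) (y := sideMap k 1 m) hx
      (by
        have e : (lastTop k).angle = k * Real.pi := rfl
        rw [ha, e, lastAngle, add_sub_cancel_left, abs_of_pos] <;> linarith)
      (by rw [x1', e1]; norm_num) x2'
    refine ⟨q, (TopData.mem_boundary_iff (T := lastTop k) hq).2 ?_, e⟩
    rw [hb, x1', e1]; norm_num
  · rintro ⟨q, hq, rfl⟩
    have hq' : q ∈ solidTorus (1 / 2) := hq.le
    obtain ⟨p1, p2⟩ := heights_lastTop (k := k) hq'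
    have hb := (TopData.mem_boundary_iff (T := lastTop k) hq').1 hq
    have e0 : (lastTop k).slope = 1 := rfl
    rw [e0] at hb
    rw [hb] at p2
    have h1 := TopData.angle_map_mem (T := lastTop k) (TopData.profOK hq')
    obtain ⟨X, Z, e⟩ := exists_torusMap (t := 1) (P₁ := lastSideHeight k) (P₂ := lastSideHeight k)
      (ψ := fun _ => k * Real.pi) (by rw [p1, lastSideHeight]; ring)
      (by rw [p2, lastSideHeight]; push_cast; ring) h1
    exact ⟨(1, X, Z), rfl, e⟩

lemma side_top (i : Fin 2) :
    sideMap k i '' {m | m.1 = 1} = (topData k i).map '' solidTorusBoundary (1 / 2) := by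
  rcases Fin.exists_fin_two.1 ⟨i, rfl⟩ with h | h <;> rw [h]
  · exact side_top_first
  · exact side_top_last

/-! ### Orientation of the top -/

lemma mvfderiv_firstTop {q : Circle × ℝ × ℝ} (h : q ∈ solidTorus (1 / 2))
    (n : TangentSpace (𝓡 4) (firstTop.map q)) :
    mvfderiv (𝓡 4) (faceFn k (firstTop.map q) Face.top) (firstTop.map q) n =
      (dpt (firstTop.map q) n).2.2 := by
  have ht : faceFn k (firstTop.map q) Face.top = aff 0 1 (1 / 2) := by
    simp [faceFn, (angle_firstTop h).2]
  rw [ht, mvfderiv_aff]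
  ring

lemma mvfderiv_lastTop (hk : 1 < k) {q : Circle × ℝ × ℝ} (h : q ∈ solidTorus (1 / 2))
    (n : TangentSpace (𝓡 4) ((lastTop k).map q)) :
    mvfderiv (𝓡 4) (faceFn k ((lastTop k).map q) Face.top) ((lastTop k).map q) n =
      -(sgn k * (dpt ((lastTop k).map q) n).1.2) := by
  have ha := (angle_lastTop (k := k) h).1
  have h0 : ¬ ((lastTop k).map q).angle < 0 := by linarith [coreAngle_pos hk, Real.pi_pos]
  have ht : faceFn k ((lastTop k).map q) Face.top = aff (-sgn k) 0 (1 / 2) := by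
    simp [faceFn, ha, h0]
  rw [ht, mvfderiv_aff]
  ring

/-- The differential of the defining function of the top, in the model. -/
lemma mvfderiv_top (hk : 1 < k) (i : Fin 2) {q : Circle × ℝ × ℝ} (h : q ∈ solidTorus (1 / 2))
    (n : TangentSpace (𝓡 4) ((topData k i).map q)) :
    ∃ a, dpt ((topData k i).map q) n = (topData k i).sym a ∧
      mvfderiv (𝓡 4) (faceFn k ((topData k i).map q) Face.top) ((topData k i).map q) n = a.2.2 := by
  rcases Fin.exists_fin_two.1 ⟨i, rfl⟩ with h' | h' <;> subst h'
  · exact ⟨_, rfl, mvfderiv_firstTop h n⟩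
  · obtain ⟨x, hx, x2, -⟩ := exists_lastSym (k := k) (dpt ((lastTop k).map q) n)
    exact ⟨x, hx.symm, (mvfderiv_lastTop hk h n).trans x2.symm⟩

/-- Two signs multiply: the profile is decreasing, and an outward vector decreases the model's
second height. -/
lemma top_oriented (hk : 1 < k) (i : Fin 2) {z : ℝ × ℝ × ℝ} (h : solidCoord z ∈ solidTorus (1 / 2))
    {n : TangentSpace (𝓡 4) ((topData k i).map (solidCoord z))}
    (hn : mvfderiv (𝓡 4) (faceFn k ((topData k i).map (solidCoord z)) Face.top)
      ((topData k i).map (solidCoord z)) n < 0)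
    {v₁ v₂ v₃ : ℝ × ℝ × ℝ} (hv : 0 < vol3 v₁ v₂ v₃) :
    0 < omegaSq form ((topData k i).map (solidCoord z)) n
      (coordDeriv solidCoord (topData k i).map z v₁)
      (coordDeriv solidCoord (topData k i).map z v₂)
      (coordDeriv solidCoord (topData k i).map z v₃) := by
  obtain ⟨a, ha, e⟩ := mvfderiv_top hk i h n
  have ho : ProfOK (topData k i).slope (toricP z.2) := TopData.profOK h
  rw [e] at hn
  rw [TopData.omegaSq_map ho ha]
  exact mul_pos (mul_pos_of_neg_of_neg ho.deriv_prof_neg hn) hv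

end Chain

namespace Chain

/-! ### The cobordism -/

lemma faces_eq {k : ℕ} (hk : 1 < k) :
    faces ((k : ℝ) + 1 / 2) (1 / 2) bottomMap (sideMap k) (fun i => (topData k i).map) =
      faceSet k := by
  funext i
  cases i with
  | bottom => exact bottom_image
  | side => exact side_image hk
  | top => exact top_image hk

lemma faceSet_subset (k : ℕ) (i : Face) : faceSet k i ⊆ domain k := by
  cases i <;> exact fun _ h => h.1

/-- The cobordism with sides in the chain. -/
def cobordism {k : ℕ} (hk : 1 < k) : CobordismWithSides form ((k : ℝ) + 1 / 2) (1 / 2) where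
  X := domain k
  β := bottomMap
  σ := sideMap k
  τ i := (topData k i).map
  compact := isCompact_domain k
  connected := isConnected_domain k
  face_subset i := by rw [faces_eq hk]; exact faceSet_subset k i
  corners y hy := by
    rw [faces_eq hk]
    exact ⟨_, isAdapted_faceFn hk hy⟩
  bottom_embedding := isSmoothEmbeddingOn_bottomMap _ _
  side_embedding := isSmoothEmbeddingOn_sideMap k
  side_disjoint := side_disjoint hk
  top_embedding i := (topData k i).isSmoothEmbeddingOn_map
  top_disjoint := top_disjoint hk
  side_bottom_left := side_bottom_first k
  side_bottom_right := side_bottom_last k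
  side_top := side_top
  bottom_oriented z hz := by
    rw [faces_eq hk]
    have hy : bottomMap (torusCoord z) ∈ faceSet k Face.bottom := by
      rw [← bottom_image]; exact mem_image_of_mem _ hz
    refine ⟨_, isAdapted_faceFn hk hy.1, fun n hn v₁ v₂ v₃ hv => ?_⟩
    rw [omegaSq_bottomMap]
    have hn : mvfderiv (𝓡 4) bottomFn (bottomMap (torusCoord z)) n < 0 := hn
    exact mul_neg_of_neg_of_pos (mul_neg_of_pos_of_neg (by positivity) hn) hv
  top_oriented i z hz := by
    rw [faces_eq hk]
    have hy : (topData k i).map (solidCoord z) ∈ faceSet k Face.top := by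
      rw [← top_image hk]; exact mem_iUnion.2 ⟨i, mem_image_of_mem _ hz⟩
    exact ⟨_, isAdapted_faceFn hk hy.1, fun n hn v₁ v₂ v₃ hv => top_oriented hk i hz hn hv⟩

lemma face_cobordism {k : ℕ} (hk : 1 < k) : (cobordism hk).face = faceSet k := faces_eq hk

/-! ### The Liouville field along the bottom and the sides -/

lemma free_of_side {k : ℕ} {y : Chain} (h : y ∈ faceSet k Face.side) (hk : 1 < k) :
    Free y.pt := by
  rw [← side_image hk] at h
  simp only [mem_iUnion, Fin.exists_fin_two] at h
  obtain ⟨m, hm, rfl⟩ | ⟨m, hm, rfl⟩ := h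
  · rw [sideMap_zero]; exact free_torusMap (torusOK_first hm)
  · rw [sideMap_one]; exact free_torusMap (torusOK_last hm)

lemma fst_height_field {y : Chain} (h : Free y.pt) : (dpt y (field y)).1.2 = y.pt.1.2 := by
  rw [dpt_field h]; rfl

lemma snd_height_field {y : Chain} (h : Free y.pt) : (dpt y (field y)).2.2 = y.pt.2.2 := by
  rw [dpt_field h]; rfl

/-- Euler's identity for the quadratic form: along the radial field its derivative is twice its
value, which is positive on the ellipse. -/
lemma field_inward {y : Chain} (h : bottomFn y = 0) :
    0 < mvfderiv (𝓡 4) bottomFn y (field y) := by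
  have hf := free_of_bottom h
  rw [mvfderiv_bottomFn, dpt_field hf]
  have e1 : fstLin (ambField y.pt) = fstLin y.pt := rfl
  have e2 : sndLin (ambField y.pt) = sndLin y.pt := rfl
  rw [e1, e2]
  unfold bottomFn at h
  nlinarith

/-- Euler's identity in degree one. Since a side is the zero set of a linear function of the
heights, the field is tangent to it. -/
lemma mvfderiv_aff_field {y : Chain} (hf : Free y.pt) (α β : ℝ) :
    mvfderiv (𝓡 4) (aff α β 0) y (field y) = aff α β 0 y := by
  rw [mvfderiv_aff, fst_height_field hf, snd_height_field hf, aff, add_zero]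

lemma field_tangent_side {k : ℕ} (hk : 1 < k) {y : Chain} (h : y ∈ faceSet k Face.side) :
    mvfderiv (𝓡 4) (faceFn k y Face.side) y (field y) = 0 := by
  have hf := free_of_side h hk
  have hz : faceFn k y Face.side y = 0 :=
    (((isAdapted_faceFn hk h.1).face.self_of_nhds Face.side).1 h).2
  have hpi := Real.pi_pos
  have h1 := firstAngle_lt
  have h2 := coreAngle_pos hk
  have h3 := lastAngle_eq k
  obtain ⟨-, ha | ha⟩ := h
  · have hs : faceFn k y Face.side = aff 2 (-1) 0 := by
      have : y.angle < 0 := by linarith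
      simp [faceFn, this]
    rw [hs] at hz ⊢
    rw [mvfderiv_aff_field hf, hz]
  · have hs : faceFn k y Face.side = aff (sgn k) (-sgn k) 0 := by
      have h4 : ¬ y.angle < 0 := by linarith
      have h5 : coreAngle k < y.angle := by linarith
      simp [faceFn, h4, h5]
    rw [hs] at hz ⊢
    rw [mvfderiv_aff_field hf, hz]

lemma faces_subset_freeSet {k : ℕ} (hk : 1 < k) :
    faceSet k Face.bottom ∪ faceSet k Face.side ⊆ freeSet := by
  rintro y (h | h)
  · exact free_of_bottom h.2
  · exact free_of_side h hk

lemma xiForm_eq_zero_iff (z v : ℝ × ℝ × ℝ) : xiForm z v = 0 ↔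
    form (bottomMap (torusCoord z)) ![field (bottomMap (torusCoord z)),
      coordDeriv torusCoord bottomMap z v] = 0 := by
  rw [form_field_bottomMap, mul_eq_zero, or_iff_right (by norm_num)]

/-- Beyond `p = 3/8` the cutoff equals one, so the Liouville field induces a positive multiple of
the contact form. -/
lemma etaForm_eq_zero_iff (T : TopData) : ∃ N : Set (Circle × ℝ × ℝ), IsOpen N ∧
    solidTorusBoundary (1 / 2) ⊆ N ∧ ∀ z, solidCoord z ∈ N → solidCoord z ∈ solidTorus (1 / 2) →
      T.map (solidCoord z) ∈ freeSet ∧ ∀ v, etaForm z v = 0 ↔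
        form (T.map (solidCoord z))
          ![field (T.map (solidCoord z)), coordDeriv solidCoord T.map z v] = 0 := by
  have hc : Continuous fun q : Circle × ℝ × ℝ => toricP q.2 := by unfold toricP; fun_prop
  refine ⟨{q | 3 / 8 < toricP q.2}, isOpen_lt continuous_const hc, fun q hq => ?_,
    fun z hz hz' => ?_⟩
  · have hq : toricP q.2 = 1 / 2 := hq
    rw [mem_ofPred_eq, hq]; norm_num
  · have ho : ProfOK T.slope (toricP z.2) := TopData.profOK hz'
    have h8 : 3 / 8 < toricP z.2 := hz
    refine ⟨TopData.free_map (q := solidCoord z) ho h8.le, fun v => ?_⟩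
    have : 1 / 2 / den T.slope (toricP z.2) ≠ 0 := (div_pos (by norm_num) ho.den_pos).ne'
    rw [TopData.form_field_map ho h8.le, mul_eq_zero, or_iff_right this]

end Chain

/-! ### The round sphere -/

/-- Euclidean space as the product of a plane and a line. -/
def planeLine : EuclideanSpace ℝ (Fin 3) ≃L[ℝ] ℂ × ℝ := LinearEquiv.toContinuousLinearEquiv
  { toFun := fun x => (⟨x 0, x 1⟩, x 2)
    invFun := fun p => !₂[p.1.re, p.1.im, p.2]
    map_add' := fun x y => Prod.ext (Complex.ext (by simp) (by simp)) (by simp)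
    map_smul' := fun r x => Prod.ext (Complex.ext (by simp) (by simp)) (by simp)
    left_inv := fun x => by ext i; fin_cases i <;> simp
    right_inv := fun p => Prod.ext (Complex.ext (by simp) (by simp)) (by simp) }

lemma planeLine_apply (x : EuclideanSpace ℝ (Fin 3)) : planeLine x = (⟨x 0, x 1⟩, x 2) := rfl

lemma inner_planeLine (x y : EuclideanSpace ℝ (Fin 3)) :
    inner ℝ x y = dot (planeLine x).1 (planeLine y).1 + (planeLine x).2 * (planeLine y).2 := by
  simp [planeLine_apply, dot, PiLp.inner_apply, Fin.sum_univ_three, mul_comm]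

/-- The inclusion of the round sphere. -/
def incl (p : S2) : ℂ × ℝ := planeLine (p : EuclideanSpace ℝ (Fin 3))

lemma onSphere_planeLine (x : EuclideanSpace ℝ (Fin 3)) : OnSphere (planeLine x) ↔ ‖x‖ = 1 := by
  have h := inner_planeLine x x
  rw [real_inner_self_eq_norm_sq] at h
  have e : OnSphere (planeLine x) ↔ ‖x‖ ^ 2 = 1 := by
    rw [h]
    simp only [OnSphere, dot]
    constructor <;> intro h <;> linarith
  rw [e]
  exact pow_eq_one_iff_of_nonneg (norm_nonneg x) two_ne_zero

lemma onSphere_incl (p : S2) : OnSphere (incl p) := by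
  rw [incl, onSphere_planeLine]; simp

lemma incl_injective : Function.Injective incl :=
  planeLine.injective.comp Subtype.val_injective

lemma exists_incl {s : ℂ × ℝ} (h : OnSphere s) : ∃ p, incl p = s := by
  rw [← planeLine.apply_symm_apply s, onSphere_planeLine] at h
  exact ⟨⟨planeLine.symm s, by simpa using h⟩, planeLine.apply_symm_apply s⟩

lemma continuous_incl : Continuous incl := planeLine.continuous.comp continuous_subtype_val

/-- The differential of the inclusion of the round sphere. -/
def dincl (p : S2) : TangentSpace (𝓡 2) p →L[ℝ] ℂ × ℝ :=
  (planeLine : EuclideanSpace ℝ (Fin 3) →L[ℝ] ℂ × ℝ) ∘L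
    mvfderiv (𝓡 2) ((↑) : S2 → EuclideanSpace ℝ (Fin 3)) p

instance : Fact (Module.finrank ℝ (EuclideanSpace ℝ (Fin 3)) = 2 + 1) :=
  ⟨finrank_euclideanSpace_fin⟩

lemma contMDiff_val : ContMDiff (𝓡 2) 𝓘(ℝ, EuclideanSpace ℝ (Fin 3)) ∞
    ((↑) : S2 → EuclideanSpace ℝ (Fin 3)) := contMDiff_coe_sphere

lemma dincl_injective (p : S2) : Function.Injective (dincl p) :=
  planeLine.injective.comp (injective_mvfderiv_subtypeVal_sphere (n := 2) p)

lemma exists_dincl {p : S2} {a : ℂ × ℝ} : TangentTo (incl p) a ↔ ∃ u, dincl p u = a := by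
  have h := range_mvfderiv_subtypeVal (n := 2) p
  have e : TangentTo (incl p) a ↔ planeLine.symm a ∈
      (Submodule.span ℝ {(p : EuclideanSpace ℝ (Fin 3))})ᗮ := by
    rw [Submodule.mem_orthogonal_singleton_iff_inner_right, inner_planeLine,
      ContinuousLinearEquiv.apply_symm_apply]
    rfl
  rw [e, ← h]
  constructor
  · rintro ⟨u, hu⟩
    exact ⟨u, (congrArg planeLine hu).trans (planeLine.apply_symm_apply a)⟩
  · rintro ⟨u, hu⟩
    exact ⟨u, (planeLine.symm_apply_apply _).symm.trans (congrArg planeLine.symm hu)⟩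

/-- The area form of the round sphere is positive on a vector and its rotation. -/
lemma exists_area_pos {s a : ℂ × ℝ} (hs : OnSphere s) (ha : TangentTo s a) (h0 : a ≠ 0) :
    ∃ b, TangentTo s b ∧ 0 < area s a b := by
  refine ⟨(⟨s.1.im * a.2 - s.2 * a.1.im, s.2 * a.1.re - s.1.re * a.2⟩,
    s.1.re * a.1.im - s.1.im * a.1.re), ?_, ?_⟩
  · simp only [TangentTo, dot]; ring
  · simp only [OnSphere, TangentTo, dot] at hs ha
    have e : area s a (⟨s.1.im * a.2 - s.2 * a.1.im, s.2 * a.1.re - s.1.re * a.2⟩,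
        s.1.re * a.1.im - s.1.im * a.1.re) = a.1.re ^ 2 + a.1.im ^ 2 + a.2 ^ 2 := by
      simp only [area, cross]
      linear_combination (a.1.re ^ 2 + a.1.im ^ 2 + a.2 ^ 2) * hs -
        (s.1.re * a.1.re + s.1.im * a.1.im + s.2 * a.2) * ha
    rw [e]
    by_contra! h
    apply h0
    have h1 : a.1.re = 0 := by nlinarith [sq_nonneg a.1.re, sq_nonneg a.1.im, sq_nonneg a.2]
    have h2 : a.1.im = 0 := by nlinarith [sq_nonneg a.1.re, sq_nonneg a.1.im, sq_nonneg a.2]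
    have h3 : a.2 = 0 := by nlinarith [sq_nonneg a.1.re, sq_nonneg a.1.im, sq_nonneg a.2]
    exact Prod.ext (Complex.ext h1 h2) h3

lemma exists_dincl_area_pos {p : S2} {u : TangentSpace (𝓡 2) p} (hu : u ≠ 0) :
    ∃ v, 0 < area (incl p) (dincl p u) (dincl p v) := by
  obtain ⟨b, hb, h⟩ := exists_area_pos (onSphere_incl p) (exists_dincl.2 ⟨u, rfl⟩)
    (fun h0 => hu (dincl_injective p (h0.trans (map_zero _).symm)))
  obtain ⟨v, rfl⟩ := exists_dincl.1 hb
  exact ⟨v, h⟩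

namespace Chain

/-! ### Spheres over the vertices of the chain -/

/-- The sphere through the `n`-th coordinate axis of the heights with first component `u`. -/
def sphereMap (n : ℤ) (u : ℂ × ℝ) (p : S2) : Chain :=
  mk (n * (Real.pi / 2)) ((quarter ^ n) (u, incl p))

/-- The admissible first components. -/
def Cap (u : ℂ × ℝ) : Prop := OnSphere u ∧ 0 < u.2

variable {n : ℤ} {u : ℂ × ℝ} {p q : S2}

lemma Cap.good (h : Cap u) (n : ℤ) (p : S2) :
    Good (n * (Real.pi / 2)) ((quarter ^ n) (u, incl p)) := by
  have := (good_quarter (n := n) (ψ := 0) (x := (u, incl p))).2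
    ⟨⟨h.1, onSphere_incl p⟩, by simpa [along] using h.2⟩
  rwa [zero_add] at this

lemma pt_sphereMap (h : Cap u) : (sphereMap n u p).pt = (quarter ^ n) (u, incl p) :=
  pt_mk (h.good n p)

lemma angle_sphereMap (h : Cap u) :
    (sphereMap n u p).angle = Real.arctan ((incl p).2 / u.2) + n * (Real.pi / 2) := by
  have := lift_quarter_zpow n 0 (u, incl p)
  rw [zero_add] at this
  rw [sphereMap, angle_mk (h.good n p), this]
  simp [lift, across, along]

lemma angle_sphereMap_mem (h : Cap u) : n * (Real.pi / 2) - Real.pi / 2 < (sphereMap n u p).angle ∧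
    (sphereMap n u p).angle < n * (Real.pi / 2) + Real.pi / 2 := by
  rw [angle_sphereMap h]
  constructor <;> linarith [Real.neg_pi_div_two_lt_arctan ((incl p).2 / u.2),
    Real.arctan_lt_pi_div_two ((incl p).2 / u.2)]

lemma hasFDerivAt_slice (n : ℤ) (u : ℂ × ℝ) (x : EuclideanSpace ℝ (Fin 3)) :
    HasFDerivAt (fun x => (quarter ^ n) (u, planeLine x))
      ((quarter ^ n : Amb ≃L[ℝ] Amb).toContinuousLinearMap ∘L
        ((0 : EuclideanSpace ℝ (Fin 3) →L[ℝ] ℂ × ℝ).prod planeLine.toContinuousLinearMap)) x :=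
  (quarter ^ n).hasFDerivAt.comp x ((hasFDerivAt_const u x).prodMk planeLine.hasFDerivAt)

lemma contMDiff_sphereMap (h : Cap u) : ContMDiff (𝓡 2) (𝓡 4) ∞ (sphereMap n u) := by
  intro p
  apply contMDiffAt_of_pt
  · have e : pt ∘ sphereMap n u = (fun x => (quarter ^ n) (u, planeLine x)) ∘
        ((↑) : S2 → EuclideanSpace ℝ (Fin 3)) := funext fun p => pt_sphereMap h
    rw [e]
    have : ContDiff ℝ ∞ (fun x => (quarter ^ n) (u, planeLine x)) :=
      (quarter ^ n).contDiff.comp (contDiff_const.prodMk planeLine.contDiff)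
    exact (this.contMDiff.comp contMDiff_val) p
  · have e : angle ∘ sphereMap n u = fun p => Real.arctan ((incl p).2 / u.2) + n * (Real.pi / 2) :=
      funext fun p => angle_sphereMap h
    rw [e]
    have h2 : Continuous fun p => (incl p).2 := continuous_snd.comp continuous_incl
    exact ((Real.continuous_arctan.comp (h2.div_const _)).add continuous_const).continuousAt

lemma dpt_mfderiv_sphereMap (h : Cap u) (v : TangentSpace (𝓡 2) p) :
    dpt (sphereMap n u p) (mfderiv (𝓡 2) (𝓡 4) (sphereMap n u) p v) =
      (quarter ^ n) (0, dincl p v) := by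
  have h1 := mfderiv_comp p (mdifferentiableAt_pt (sphereMap n u p))
    ((contMDiff_sphereMap (n := n) h p).mdifferentiableAt (by simp : (∞ : WithTop ℕ∞) ≠ 0))
  have e : pt ∘ sphereMap n u = (fun x => (quarter ^ n) (u, planeLine x)) ∘
        ((↑) : S2 → EuclideanSpace ℝ (Fin 3)) := funext fun p => pt_sphereMap h
  have h2 := mfderiv_comp p (hasFDerivAt_slice n u p).differentiableAt.mdifferentiableAt
    ((contMDiff_val p).mdifferentiableAt (by simp : (∞ : WithTop ℕ∞) ≠ 0))
  rw [mfderiv_eq_fderiv, (hasFDerivAt_slice n u p).fderiv] at h2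
  rw [e, h2] at h1
  exact (congrArg (fun L : EuclideanSpace ℝ (Fin 2) →L[ℝ] Amb => L v) h1).symm

lemma pullTwo_sphereMap (h : Cap u) (v w : TangentSpace (𝓡 2) p) :
    pullTwo form (sphereMap n u) p v w = area (incl p) (dincl p v) (dincl p w) := by
  rw [pullTwo, form_vec, dpt_mfderiv_sphereMap h, dpt_mfderiv_sphereMap h, pt_sphereMap h,
    (isSymm_quarter_zpow n).area]
  simp [ambArea, area, cross]

lemma isEmbeddedSphere_sphereMap (h : Cap u) : IsEmbeddedSphere (sphereMap n u) where
  smooth := contMDiff_sphereMap h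
  injective p q e := by
    have := congrArg pt e
    rw [pt_sphereMap h, pt_sphereMap h] at this
    exact incl_injective (congrArg Prod.snd ((quarter ^ n).injective this))
  immersion p := by
    rw [injective_iff_map_eq_zero]
    intro v hv
    have := dpt_mfderiv_sphereMap (n := n) h v
    rw [hv, map_zero] at this
    have h1 := (quarter ^ n).injective ((map_zero (quarter ^ n)).trans this)
    exact dincl_injective p ((congrArg Prod.snd h1).symm.trans (map_zero _).symm)

lemma isSymplecticSphere_sphereMap (h : Cap u) : IsSymplecticSphere form (sphereMap n u) := by
  intro p v hv
  obtain ⟨w, hw⟩ := exists_dincl_area_pos hv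
  exact ⟨w, by rw [pullTwo_sphereMap h]; exact hw.ne'⟩

lemma exists_pullTwo_pos (h : Cap u) (n : ℤ) (p : S2) :
    ∃ v w, 0 < pullTwo form (sphereMap n u) p v w := by
  obtain ⟨v, hv⟩ : ∃ v : TangentSpace (𝓡 2) p, v ≠ 0 := exists_ne (0 : EuclideanSpace ℝ (Fin 2))
  obtain ⟨w, hw⟩ := exists_dincl_area_pos hv
  exact ⟨v, w, by rw [pullTwo_sphereMap h]; exact hw⟩

/-- A pair of heights one of which is at least one half. -/
lemma large_quarter_zpow (n : ℤ) (x : Amb) :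
    (1 / 4 ≤ ((quarter ^ n) x).1.2 ^ 2 ∨ 1 / 4 ≤ ((quarter ^ n) x).2.2 ^ 2) ↔
      (1 / 4 ≤ x.1.2 ^ 2 ∨ 1 / 4 ≤ x.2.2 ^ 2) := by
  have h : ∀ x : Amb, (1 / 4 ≤ (quarter x).1.2 ^ 2 ∨ 1 / 4 ≤ (quarter x).2.2 ^ 2) ↔
      (1 / 4 ≤ x.1.2 ^ 2 ∨ 1 / 4 ≤ x.2.2 ^ 2) := fun x => by simp [or_comm]
  induction n using Int.induction_on generalizing x with
  | zero => simp
  | succ n ih => rw [zpow_add_one, cle_mul_apply]; exact (ih _).trans (h x)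
  | pred n ih =>
    rw [zpow_sub_one, cle_mul_apply]
    refine (ih _).trans ?_
    rw [← h (quarter⁻¹ x), show quarter (quarter⁻¹ x) = x from quarter.apply_symm_apply x]

lemma mem_interior_domain {k : ℕ} {y : Chain} (h0 : 0 < bottomFn y) (h1 : 0 < y.angle)
    (h2 : y.angle < coreAngle k) : y ∈ interior (domain k) := by
  refine mem_interior.2 ⟨{y | 0 < bottomFn y} ∩ ({y | 0 < y.angle} ∩ {y | y.angle < coreAngle k}),
    ?_, ?_, h0, h1, h2⟩
  · rintro z ⟨h0, h1, h2⟩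
    have h1 : 0 < z.angle := h1
    have h2 : z.angle < coreAngle k := h2
    have h0 : 0 < bottomFn z := h0
    have := firstAngle_lt
    have := lastAngle_eq k
    have := Real.pi_pos
    exact ⟨h0.le, by linarith, by linarith, Or.inl h1.le, Or.inl h2.le⟩
  · exact (isOpen_lt continuous_const continuous_bottomFn).inter
      ((isOpen_lt continuous_const continuous_angle).inter
        (isOpen_lt continuous_angle continuous_const))

/-- The angles over the `n`-th edge lie strictly between `(n - 1) π / 2` and `(n + 1) π / 2`, so for
these `n` they avoid both truncated ends; one height is at least `1/2` in absolute value, so the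
bottom is avoided too. -/
lemma sphereMap_mem_interior {k : ℕ} (h : Cap u) (hu : 1 / 2 ≤ u.2) (h1 : 1 ≤ n)
    (h2 : n ≤ 2 * k - 2) : sphereMap n u p ∈ interior (domain k) := by
  have hpi := Real.pi_pos
  obtain ⟨a1, a2⟩ := angle_sphereMap_mem (n := n) (p := p) h
  have h1 : (1 : ℝ) ≤ n := by exact_mod_cast h1
  have h2 : (n : ℝ) ≤ 2 * k - 2 := by exact_mod_cast h2
  refine mem_interior_domain ?_ ?_ ?_
  · rcases (large_quarter_zpow n (u, incl p)).2 (Or.inl (by nlinarith)) with h3 | h3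
    · exact bottomFn_pos_of_fst (by rw [pt_sphereMap h]; exact h3)
    · exact bottomFn_pos_of_snd (by rw [pt_sphereMap h]; exact h3)
  · nlinarith
  · unfold coreAngle
    nlinarith

/-! ### Intersections -/

/-- The angular ranges are disjoint. This is where the cover is needed: in `S² × S²` itself the
indices would only count modulo four. -/
lemma sphereMap_ne_of_lt {n' : ℤ} {u' : ℂ × ℝ} (h : Cap u) (h' : Cap u') (hn : n + 2 ≤ n') :
    sphereMap n u p ≠ sphereMap n' u' q := by
  intro e
  have a := (angle_sphereMap_mem (n := n) (p := p) h).2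
  have a' := (angle_sphereMap_mem (n := n') (p := q) h').1
  rw [e] at a
  have hn : (n : ℝ) + 2 ≤ n' := by exact_mod_cast hn
  nlinarith [Real.pi_pos]

lemma sphereMap_ne_of_ne {u' : ℂ × ℝ} (h : Cap u) (h' : Cap u') (hu : u ≠ u') :
    sphereMap n u p ≠ sphereMap n u' q := by
  intro e
  have := congrArg pt e
  rw [pt_sphereMap h, pt_sphereMap h'] at this
  exact hu (congrArg Prod.fst ((quarter ^ n).injective this))

/-- The unique intersection of neighbours. -/
lemma sphereMap_eq_succ_iff {u' : ℂ × ℝ} (h : Cap u) (h' : Cap u') :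
    sphereMap n u p = sphereMap (n + 1) u' q ↔ incl p = u' ∧ incl q = flip u := by
  have hflip : ∀ s, flip (flip s) = s := fun s =>
    Prod.ext (Complex.ext (by simp) (by simp)) (by simp)
  constructor
  · intro e
    have := congrArg pt e
    rw [pt_sphereMap h, pt_sphereMap h', zpow_add_one, cle_mul_apply] at this
    have := (quarter ^ n).injective this
    have e1 : u = flip (incl q) := congrArg Prod.fst this
    exact ⟨congrArg Prod.snd this, by rw [e1, hflip]⟩
  · rintro ⟨e1, e2⟩
    have hpi := Real.pi_pos
    refine ext_of_angle ?_ ?_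
    · rw [pt_sphereMap h, pt_sphereMap h', zpow_add_one, cle_mul_apply]
      congr 1
      exact Prod.ext (by rw [quarter_fst, e2, hflip]) e1
    -- The projections agree; it remains to see that the sheets do. The point on the first sphere is
    -- in the upper half of its angular range because `u'` has positive height, which leaves a gap
    -- of less than `π`.
    · have a1 := (angle_sphereMap_mem (n := n) (p := p) h).2
      have a2 := angle_sphereMap_mem (n := n + 1) (p := q) h'
      have a3 : n * (Real.pi / 2) < (sphereMap n u p).angle := by
        rw [angle_sphereMap h, e1]
        have : 0 < Real.arctan (u'.2 / u.2) := Real.arctan_pos.2 (div_pos h'.2 h.2)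
        linarith
      push_cast at a2
      rw [abs_lt]
      constructor <;> linarith [a2.1, a2.2]

/-- Neighbours are orthogonal. -/
lemma ambArea_neighbours (n : ℤ) (x : Amb) (a b : ℂ × ℝ) :
    ambArea x ((quarter ^ n) (0, a)) ((quarter ^ (n + 1)) (0, b)) = 0 ∧
      ambArea x ((quarter ^ (n + 1)) (0, b)) ((quarter ^ n) (0, a)) = 0 := by
  have hx : x = (quarter ^ n) ((quarter ^ (-n)) x) := (quarter_neg_apply n x).symm
  rw [hx, zpow_add_one, cle_mul_apply, (isSymm_quarter_zpow n).area,
    (isSymm_quarter_zpow n).area]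
  simp [ambArea, area, cross]

/-- Tangent planes of neighbours are the two factors of `S² × S²`, hence orthogonal for the
symplectic form. The mixed terms of the square vanish and the product of the two areas remains. -/
lemma crossing_neighbours {n n' : ℤ} {u u' : ℂ × ℝ} (h : Cap u) (h' : Cap u')
    (hn : n' = n + 1 ∨ n = n' + 1) (e : sphereMap n u p = sphereMap n' u' q)
    (u₁ u₂ : TangentSpace (𝓡 2) p) (v₁ v₂ : TangentSpace (𝓡 2) q) :
    crossing form (sphereMap n u) (sphereMap n' u') p q u₁ u₂ v₁ v₂ =
      pullTwo form (sphereMap n u) p u₁ u₂ * pullTwo form (sphereMap n' u') q v₁ v₂ := by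
  -- The vectors tangent to the second sphere must be read at the base point of the first; a general
  -- `y` equal to that point allows substitution.
  have key : ∀ y : Chain, y = sphereMap n' u' q → ∀ v : TangentSpace (𝓡 2) q,
      dpt y (mfderiv (𝓡 2) (𝓡 4) (sphereMap n' u') q v) = (quarter ^ n') (0, dincl q v) := by
    rintro y rfl v
    exact dpt_mfderiv_sphereMap h' v
  have key2 : ∀ y : Chain, y = sphereMap n' u' q →
      form y ![mfderiv (𝓡 2) (𝓡 4) (sphereMap n' u') q v₁,
        mfderiv (𝓡 2) (𝓡 4) (sphereMap n' u') q v₂] = pullTwo form (sphereMap n' u') q v₁ v₂ := by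
    rintro y rfl
    rfl
  have mixed : ∀ (a : TangentSpace (𝓡 2) p) (b : TangentSpace (𝓡 2) q),
      form (sphereMap n u p) ![mfderiv (𝓡 2) (𝓡 4) (sphereMap n u) p a,
        mfderiv (𝓡 2) (𝓡 4) (sphereMap n' u') q b] = 0 := by
    intro a b
    refine (form_vec _ _).trans ?_
    rw [key _ e, dpt_mfderiv_sphereMap h]
    rcases hn with rfl | rfl
    · exact (ambArea_neighbours n _ _ _).1
    · exact (ambArea_neighbours n' _ _ _).2
  unfold crossing omegaSq
  rw [mixed, mixed, mixed, mixed, key2 _ e]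
  simp only [pullTwo]
  ring

lemma isPositiveCrossing_neighbours {n n' : ℤ} {u u' : ℂ × ℝ} (h : Cap u) (h' : Cap u')
    (hn : n' = n + 1 ∨ n = n' + 1) (e : sphereMap n u p = sphereMap n' u' q) :
    IsPositiveCrossing form (sphereMap n u) (sphereMap n' u') (sphereMap n' u') p q := by
  obtain ⟨u₁, u₂, hu⟩ := exists_pullTwo_pos h n p
  obtain ⟨v₁, v₂, hv⟩ := exists_pullTwo_pos h' n' q
  refine ⟨e, u₁, u₂, v₁, v₂, hu, hv, ?_⟩
  rw [crossing_neighbours h h' hn e]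
  exact mul_pos hu hv

lemma not_isNegativeCrossing_neighbours {n n' : ℤ} {u u' : ℂ × ℝ} (h : Cap u) (h' : Cap u')
    (hn : n' = n + 1 ∨ n = n' + 1) :
    ¬ IsNegativeCrossing form (sphereMap n u) (sphereMap n' u') (sphereMap n' u') p q := by
  rintro ⟨e, u₁, u₂, v₁, v₂, hu, hv, hc⟩
  rw [crossing_neighbours h h' hn e] at hc
  exact absurd (mul_pos hu hv) hc.not_gt

lemma existsUnique_crossing {n n' : ℤ} {u u' : ℂ × ℝ} (h : Cap u) (h' : Cap u')
    (hn : n' = n + 1 ∨ n = n' + 1) :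
    ∃ z : S2 × S2, ∀ w : S2 × S2, sphereMap n u w.1 = sphereMap n' u' w.2 ↔ w = z := by
  have hflip : ∀ s, OnSphere s → OnSphere (flip s) := fun s hs => by
    simpa [OnSphere] using hs
  rcases hn with rfl | rfl
  · obtain ⟨a, ha⟩ := exists_incl h'.1
    obtain ⟨b, hb⟩ := exists_incl (hflip u h.1)
    refine ⟨(a, b), fun w => ?_⟩
    rw [sphereMap_eq_succ_iff h h', ← ha, ← hb, incl_injective.eq_iff, incl_injective.eq_iff,
      Prod.ext_iff]
  · obtain ⟨a, ha⟩ := exists_incl h.1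
    obtain ⟨b, hb⟩ := exists_incl (hflip u' h'.1)
    refine ⟨(b, a), fun w => ?_⟩
    rw [eq_comm, sphereMap_eq_succ_iff h' h, ← ha, ← hb, incl_injective.eq_iff,
      incl_injective.eq_iff, Prod.ext_iff, and_comm]

/-- The spheres are already transverse with a single positive crossing, so the constant homotopy
serves. -/
lemma hasIntersectionNumber_neighbours {n n' : ℤ} {u u' : ℂ × ℝ} {A : Set Chain} (h : Cap u)
    (h' : Cap u') (hn : n' = n + 1 ∨ n = n' + 1) (hA : ∀ p, sphereMap n' u' p ∈ A) :
    HasIntersectionNumber form A (sphereMap n u) (sphereMap n' u') 1 := by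
  obtain ⟨z, hz⟩ := existsUnique_crossing h h' hn
  have hpos : {z : S2 × S2 | IsPositiveCrossing form (sphereMap n u) (sphereMap n' u')
      (sphereMap n' u') z.1 z.2} = {z} := by
    ext w
    rw [mem_singleton_iff, ← hz w]
    exact ⟨fun hw => hw.1, fun hw => isPositiveCrossing_neighbours h h' hn hw⟩
  have hneg : {z : S2 × S2 | IsNegativeCrossing form (sphereMap n u) (sphereMap n' u')
      (sphereMap n' u') z.1 z.2} = ∅ :=
    eq_empty_of_forall_notMem fun w hw => not_isNegativeCrossing_neighbours h h' hn hw
  refine ⟨sphereMap n' u', contMDiff_sphereMap h', ⟨fun z => sphereMap n' u' z.2,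
    (contMDiff_sphereMap h').continuous.comp continuous_snd, fun z => hA _, fun _ => rfl,
    fun _ => rfl⟩, fun p q e => Or.inl (isPositiveCrossing_neighbours h h' hn e), ?_, ?_⟩
  · refine (finite_singleton z).subset fun w hw => (hz w).1 hw
  · rw [hpos, hneg]; simp

lemma hasIntersectionNumber_zero {A : Set Chain} {s r₀ r : S2 → Chain}
    (hr : ContMDiff (𝓡 2) (𝓡 4) ∞ r) {H : unitInterval × S2 → Chain} (hH : Continuous H)
    (hA : ∀ z, H z ∈ A) (h0 : ∀ p, H (0, p) = r₀ p) (h1 : ∀ p, H (1, p) = r p)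
    (hd : ∀ p q, s p ≠ r q) : HasIntersectionNumber form A s r₀ 0 := by
  refine ⟨r, hr, ⟨H, hH, hA, h0, h1⟩, fun p q e => absurd e (hd p q), ?_, ?_⟩
  · convert finite_empty
    exact eq_empty_of_forall_notMem fun w hw => hd _ _ hw
  · have hpos : {z : S2 × S2 | IsPositiveCrossing form s r₀ r z.1 z.2} = ∅ :=
      eq_empty_of_forall_notMem fun w hw => hd _ _ hw.1
    have hneg : {z : S2 × S2 | IsNegativeCrossing form s r₀ r z.1 z.2} = ∅ :=
      eq_empty_of_forall_notMem fun w hw => hd _ _ hw.1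
    rw [hpos, hneg]; simp

/-! ### The chain of spheres -/

/-- The path of first components used to push a sphere off itself. -/
def capPath (t : ℝ) : ℂ × ℝ := lambert t

lemma nsq_ofReal (t : ℝ) : nsq (t : ℂ) = t ^ 2 := by simp [nsq]

lemma cap_capPath {t : ℝ} (h : t ∈ Icc (0 : ℝ) 1) : Cap (capPath t) ∧ 1 / 2 ≤ (capPath t).2 := by
  have h2 : t ^ 2 ≤ 1 := by nlinarith [h.1, h.2]
  have h3 : (capPath t).2 = 1 - t ^ 2 / 2 := by rw [capPath, lambert, nsq_ofReal]
  exact ⟨⟨lambert_onSphere (by rw [nsq_ofReal]; linarith), by rw [h3]; linarith⟩,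
    by rw [h3]; linarith⟩

/-- The chain of symplectic spheres. -/
def chainSphere (n : ℤ) : S2 → Chain := sphereMap n (capPath 0)

lemma cap_zero : Cap (capPath 0) ∧ 1 / 2 ≤ (capPath 0).2 := cap_capPath ⟨le_rfl, zero_le_one⟩

lemma continuous_pushOff (n : ℤ) :
    Continuous fun z : unitInterval × S2 => sphereMap n (capPath z.1) z.2 := by
  rw [← continuousOn_univ]
  have hl : Continuous fun t : unitInterval => capPath t := by
    rw [continuous_iff_continuousAt]
    intro t
    have ht : nsq ((t : ℝ) : ℂ) < 4 := by
      rw [nsq_ofReal]; nlinarith [t.2.1, t.2.2]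
    exact ContinuousAt.comp (g := lambert) (f := fun t : unitInterval => ((t : ℝ) : ℂ))
      (contDiffAt_lambert (n := 0) ht).continuousAt (by fun_prop)
  refine continuousOn_mk continuousOn_const ?_ fun z _ => (cap_capPath z.1.2).1.good n z.2
  exact ((quarter ^ n).continuous.comp ((hl.comp continuous_fst).prodMk
    (continuous_incl.comp continuous_snd))).continuousOn

/-- The sphere lies over a pole of the other factor. Moving that pole along a meridian to height
`1/2` gives a disjoint parallel copy, and the heights met on the way keep the homotopy inside the
domain. -/
lemma hasIntersectionNumber_self {A : Set Chain} (n : ℤ)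
    (hA : ∀ t ∈ Icc (0 : ℝ) 1, ∀ p, sphereMap n (capPath t) p ∈ A) :
    HasIntersectionNumber form A (chainSphere n) (chainSphere n) 0 := by
  have h1 := cap_capPath (t := 1) ⟨zero_le_one, le_rfl⟩
  refine hasIntersectionNumber_zero (r := sphereMap n (capPath 1)) (contMDiff_sphereMap h1.1)
    (continuous_pushOff n) (fun z => hA z.1 z.1.2 z.2) (fun p => by simp [chainSphere])
    (fun p => by simp) fun p q => sphereMap_ne_of_ne cap_zero.1 h1.1 fun e => ?_
  have := congrArg Prod.snd e
  simp only [capPath, lambert, nsq_ofReal] at this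
  norm_num at this

lemma chainSphere_ne {n n' : ℤ} (h : n + 2 ≤ n' ∨ n' + 2 ≤ n) (p q : S2) :
    chainSphere n p ≠ chainSphere n' q := by
  rcases h with h | h
  · exact sphereMap_ne_of_lt cap_zero.1 cap_zero.1 h
  · exact (sphereMap_ne_of_lt cap_zero.1 cap_zero.1 h).symm

lemma hasIntersectionNumber_chainSphere {A : Set Chain} (n n' : ℤ)
    (hA : ∀ t ∈ Icc (0 : ℝ) 1, ∀ p, sphereMap n' (capPath t) p ∈ A) :
    HasIntersectionNumber form A (chainSphere n) (chainSphere n')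
      (if n + 1 = n' ∨ n' + 1 = n then 1 else 0) := by
  have hA0 := hA 0 ⟨le_rfl, zero_le_one⟩
  split_ifs with h
  · exact hasIntersectionNumber_neighbours cap_zero.1 cap_zero.1
      (h.imp Eq.symm Eq.symm) hA0
  · rcases eq_or_ne n n' with rfl | hne
    · exact hasIntersectionNumber_self n hA
    · exact hasIntersectionNumber_zero (contMDiff_sphereMap cap_zero.1)
        (H := fun z => chainSphere n' z.2)
        ((contMDiff_sphereMap cap_zero.1).continuous.comp continuous_snd) (fun z => hA0 z.2)
        (fun _ => rfl) (fun _ => rfl) fun p q => chainSphere_ne (by omega) p q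

lemma isPositiveCrossing_chainSphere {n n' : ℤ} (hne : n ≠ n')
    (e : chainSphere n p = chainSphere n' q) :
    IsPositiveCrossing form (chainSphere n) (chainSphere n') (chainSphere n') p q := by
  by_cases h : n' = n + 1 ∨ n = n' + 1
  · exact isPositiveCrossing_neighbours cap_zero.1 cap_zero.1 h e
  · exact absurd e (chainSphere_ne (by omega) p q)

end Chain

end ToricChain

end

/-! ### Assembly -/

theorem theorem1p1 (k : ℕ) (hk : 1 < k) :
    ∃ (Y : Type) (_ : TopologicalSpace Y) (_ : ChartedSpace E4 Y) (_ : IsManifold (𝓡 4) ∞ Y)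
      (_ : T2Space Y) (_ : SecondCountableTopology Y)
      (Ω : TwoForm Y) (W : CobordismWithSides Ω ((k : ℝ) + 1 / 2) (1 / 2))
      (S : Fin (2 * k - 2) → S2 → Y) (V : ∀ y : Y, TangentSpace (𝓡 4) y) (U : Set Y),
      IsSymplectic Ω ∧
      -- the chain of symplectic spheres
      (∀ i, IsEmbeddedSphere (S i) ∧ (∀ p, S i p ∈ interior W.X) ∧ IsSymplecticSphere Ω (S i)) ∧
      (∀ i j, i ≠ j → ∀ p q, S i p = S j q → IsPositiveCrossing Ω (S i) (S j) (S j) p q) ∧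
      (∀ i j, HasIntersectionNumber Ω (interior W.X) (S i) (S j)
        (if (i : ℕ) + 1 = j ∨ (j : ℕ) + 1 = i then 1 else 0)) ∧
      -- the Liouville field near the bottom and the sides
      IsLiouvilleOn Ω V U ∧ W.face Face.bottom ∪ W.face Face.side ⊆ U ∧ (∀ y ∈ U, V y ≠ 0) ∧
      (∀ y ∈ W.face Face.bottom, ∃ f, IsAdapted W.X W.face f y ∧
        0 < mvfderiv (𝓡 4) (f Face.bottom) y (V y)) ∧
      (∀ y ∈ W.face Face.side, ∃ f, IsAdapted W.X W.face f y ∧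
        mvfderiv (𝓡 4) (f Face.side) y (V y) = 0) ∧
      (∀ z, torusCoord z ∈ thickTorus 0 ((k : ℝ) + 1 / 2) → ∀ v,
        xiForm z v = 0 ↔
          Ω (W.β (torusCoord z)) ![V (W.β (torusCoord z)), coordDeriv torusCoord W.β z v] = 0) ∧
      -- along the top, `η` is dominated by `Ω`
      (∀ i, ∀ z, solidCoord z ∈ solidTorus (1 / 2) → ∀ n v w,
        0 < etaForm z n → etaForm z v = 0 → etaForm z w = 0 → 0 < vol3 n v w →
          0 < Ω (W.τ i (solidCoord z))
            ![coordDeriv solidCoord (W.τ i) z v, coordDeriv solidCoord (W.τ i) z w]) ∧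
      -- and agrees near the boundary with the structure induced by the Liouville field
      (∀ i, ∃ N : Set (Circle × ℝ × ℝ), IsOpen N ∧ solidTorusBoundary (1 / 2) ⊆ N ∧
        ∀ z, solidCoord z ∈ N → solidCoord z ∈ solidTorus (1 / 2) →
          W.τ i (solidCoord z) ∈ U ∧ ∀ v, etaForm z v = 0 ↔
            Ω (W.τ i (solidCoord z))
              ![V (W.τ i (solidCoord z)), coordDeriv solidCoord (W.τ i) z v] = 0) := by
  -- The index is shifted by one: edge `0` is cut by the first solid torus and edge `2k - 1` by the
  -- last, so the complete edges are `1` to `2k - 2`.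
  have hmem : ∀ i : Fin (2 * k - 2), ∀ u, ToricChain.Chain.Cap u → 1 / 2 ≤ u.2 → ∀ p,
      ToricChain.Chain.sphereMap ((i : ℕ) + 1 : ℤ) u p ∈
        interior (ToricChain.Chain.domain k) := fun i u hu hu2 p =>
    ToricChain.Chain.sphereMap_mem_interior hu hu2 (by omega) (by have := i.2; omega)
  refine ⟨ToricChain.Chain, inferInstance, inferInstance, inferInstance, inferInstance,
    inferInstance, ToricChain.Chain.form, ToricChain.Chain.cobordism hk,
    fun i => ToricChain.Chain.chainSphere ((i : ℕ) + 1 : ℤ), ToricChain.Chain.field,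
    ToricChain.Chain.freeSet, ToricChain.Chain.isSymplectic_form, ?_, ?_, ?_,
    ToricChain.Chain.isLiouvilleOn_field, ?_, ?_, ?_, ?_, ?_, ?_, ?_⟩
  · exact fun i => ⟨ToricChain.Chain.isEmbeddedSphere_sphereMap ToricChain.Chain.cap_zero.1,
      hmem i _ ToricChain.Chain.cap_zero.1 ToricChain.Chain.cap_zero.2,
      ToricChain.Chain.isSymplecticSphere_sphereMap ToricChain.Chain.cap_zero.1⟩
  · intro i j hij p q e
    exact ToricChain.Chain.isPositiveCrossing_chainSphere
      (fun h => hij (Fin.ext (by omega))) e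
  · intro i j
    have h := ToricChain.Chain.hasIntersectionNumber_chainSphere ((i : ℕ) + 1 : ℤ)
      ((j : ℕ) + 1 : ℤ) (fun t ht => hmem j _ (ToricChain.Chain.cap_capPath ht).1
        (ToricChain.Chain.cap_capPath ht).2)
    have e : ((i : ℕ) + 1 + 1 : ℤ) = (j : ℕ) + 1 ∨ ((j : ℕ) + 1 + 1 : ℤ) = (i : ℕ) + 1 ↔
        (i : ℕ) + 1 = j ∨ (j : ℕ) + 1 = i := by omega
    rw [if_congr e rfl rfl] at h
    exact h
  · rw [ToricChain.Chain.face_cobordism hk]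
    exact ToricChain.Chain.faces_subset_freeSet hk
  · exact fun y hy => ToricChain.Chain.field_ne_zero hy
  · rw [ToricChain.Chain.face_cobordism hk]
    exact fun y hy => ⟨ToricChain.Chain.faceFn k y, ToricChain.Chain.isAdapted_faceFn hk hy.1,
      ToricChain.Chain.field_inward hy.2⟩
  · rw [ToricChain.Chain.face_cobordism hk]
    exact fun y hy => ⟨ToricChain.Chain.faceFn k y, ToricChain.Chain.isAdapted_faceFn hk hy.1,
      ToricChain.Chain.field_tangent_side hk hy⟩
  · exact fun z _ v => ToricChain.Chain.xiForm_eq_zero_iff z v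
  · exact fun i z hz n v w hn hv hw hvol =>
      (ToricChain.topData k i).dominates
        (ToricChain.TopData.profOK (q := solidCoord z) hz) hn hv hw hvol
  · exact fun i => ToricChain.Chain.etaForm_eq_zero_iff (ToricChain.topData k i)
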